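/- **Setting.** Let $E\subseteq\mathbb R$ be open (e.g. the state interval of the diffusion $dX=\mu(X)\,dt+dW$), let $\mu\in C^\infty(E)$ solve a Riccati equation $\mu'+\mu^2=V$ on $E$, and let $\theta$ be a nowhere vanishing function on $E$ with $\mu=\theta'/\theta$. The FPKE is $$u_t=\tfrac12u_{xx}-\mu u_x-\mu' u ,\qquad x\in E,\ t\in\mathbb R ,$$ and solutions are smooth functions on open subsets of $E\times\mathbb R$. We consider four families: - $\mathscr F_1$: $V=4Bx+2C$; - $\mathscr F_2$: $V=Ax^2+4Bx+2C$, $A>0$; - $\mathscr F_3$: $V=2C+D/x^2$, $D\ne0$, $E\subseteq(0,\infty)$; - $\mathscr F_4$: $V=Ax^2+2C+D/x^2$, $A>0$, $D\neq 0$, $E\subseteq(0,\infty)$, with $A,B,C,D$ real and otherwise arbitrary. A transformation $u(x,t)=f(x,t)\,U(X(x,t),T(t))$ is a *symmetry* if, on its domain, it turns every local solution $U$ into a solution $u$; it acts on points by $(x,t,u)\mapsto(X,T,u/f)$. All transformations below have $f=\frac{\theta(x)}{\theta(X)}\,m(x,t)$, are considered where $x,X\in E$, and expressions singular at $t=0$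 are understood through their smooth extension. Write $a=\sqrt A$. **Part 1 (complete list of symmetries).** The transformations listed below are symmetries. For each $i$ they form a local one-parameter group $\mathscr S_i^\epsilon=e^{\epsilon\mathbf v_i}$: the group law holds and $\epsilon\mapsto(X,T,u/f)$ solves the ODE of its generator $\mathbf v_i$ with initial value $(x,t,u)$. The superposition $u=\beta+U$ with a solution $\beta$ is also a symmetry. There are no others: for nonempty open intervals $I\subseteq E$, $J\subseteq\mathbb R$, a smooth vector field $\mathbf v=\xi\partial_x+\tau\partial_t+\varphi\partial_u$ on $I\times J\times\mathbb R$ (coefficients depending on $x,t,u$) satisfies $\mathrm{pr}^2\mathbf v[\tfrac12u_{xx}-\mu u_x-\mu'u-u_t]=0$ on the equation if and only if $\mathbf v=\sum_i c_i\mathbf v_i+\beta(x,t)\partial_u$ with constants $c_i$ and a solution $\beta$; and the $\mathbf v_i$ are linearly independent. *Family $\mathscr F_1$ (six groups).* With $Q(x,t)=-2Bxt+\frac{2B^2t^3}{3}-Ct$: - $\mathscr S_1^\epsilon$: $X=\frac{x-Bt^2}{1+\epsilon t}+\frac{Bt^2}{(1+\epsilon t)^2}$, $T=\frac t{1+\epsilon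 t}$, $m=\dfrac{t^{-1/2}\exp\left(-\frac{(x+Bt^2)^2}{2t}+\frac{2B^2t^3}{3}-Ct\right)}{T^{-1/2}\exp\left(-\frac{(X+BT^2)^2}{2T}+\frac{2B^2T^3}{3}-CT\right)}$, for $1+\epsilon t>0$; - $\mathscr S_2^\epsilon$: $X=(x-Bt^2)e^{-\epsilon/2}+Bt^2e^{-2\epsilon}$, $T=te^{-\epsilon}$, $m=e^{Q(x,t)-Q(X,T)}$; - $\mathscr S_3^\epsilon$: $X=x-\epsilon t$, $T=t$, $m=\exp\left(-\frac{(x+Bt^2)^2}{2t}+\frac{(x-\epsilon t+Bt^2)^2}{2t}\right)$; - $\mathscr S_4^\epsilon$: $X=x-\epsilon$, $T=t$, $m=e^{-2B\epsilon t}$; - $\mathscr S_5^\epsilon$: $u=U(x,t+\epsilon)$; $\quad\mathscr S_6^\epsilon$: $u=e^\epsilon U(x,t)$. *Family $\mathscr F_2$ (six groups).* With $c=2B/A$, $\nu=\frac1{2a}\left(\frac{2B^2}A-\frac a2-C\right)$: - $\mathscr S_{1,2}^\epsilon$: $X=\frac{x+c}{\sqrt{1+\epsilon e^{\pm2at}}}-c$,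 $T=\mp\frac{\ln(\epsilon+e^{\mp2at})}{2a}$, $m=\dfrac{\exp\left(2a(\nu+\frac14\mp\frac14)t\mp\frac a2(x+c)^2\right)}{\exp\left(2a(\nu+\frac14\mp\frac14)T\mp\frac a2(X+c)^2\right)}$, for $\epsilon+e^{\mp2at}>0$; - $\mathscr S_{3,4}^\epsilon$: $X=x-\epsilon e^{\pm at}$, $T=t$, $m=\exp\left(\mp\frac a2\epsilon e^{\pm at}[(x+c)+(X+c)]\right)$; - $\mathscr S_5^\epsilon$: $u=U(x,t+\epsilon)$; $\quad\mathscr S_6^\epsilon$: $u=e^\epsilon U(x,t)$. *Family $\mathscr F_3$ (four groups).* - $\mathscr S_1^\epsilon$: $X=\frac x{1+\epsilon t}$, $T=\frac t{1+\epsilon t}$, $m=\frac{1}{\sqrt{1+\epsilon t}}\exp\left(\left[\frac{x^2}{2t^2}+C\right](T-t)\right)$, for $1+\epsilon t>0$; - $\mathscr S_2^\epsilon$: $X=xe^{-\epsilon/2}$, $T=te^{-\epsilon}$, $m=e^{Ct(e^{-\epsilon}-1)}$; - $\mathscr S_3^\epsilon$: $u=U(x,t+\epsilon)$; $\quad\mathscr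 S_4^\epsilon$: $u=e^\epsilon U(x,t)$. *Family $\mathscr F_4$ (four groups).* With $\nu=-\frac14-\frac C{2a}$: $\mathscr S^\epsilon_{1,2}$ given by the formulas of $\mathscr F_2$ with $c=0$ and this $\nu$; $\mathscr S_3^\epsilon$: $u=U(x,t+\epsilon)$; $\mathscr S_4^\epsilon$: $u=e^\epsilon U(x,t)$. **Part 2 (symmetries with $T(0)=0$).** The following two-parameter transformations are symmetries with $T(0)=0$. *$\mathscr F_1$:* - $\mathscr S_1^{\alpha,\beta}$ ($\alpha\neq0$, $1+\alpha\beta t>0$): $X=\alpha\frac{x-Bt^2}{1+\alpha\beta t}+\frac{B\alpha^4t^2}{(1+\alpha\beta t)^2}$, $T=\frac{\alpha^2t}{1+\alpha\beta t}$, and $m$ is the same expression in $(x,t,X,T)$ as for $\mathscr S_1^\epsilon$; - $\mathscr S_2^{\alpha,\beta}$: $X=x-\alpha-\beta t$, $T=t$, $m=e^{-2\alpha Bt}\exp\left(-\frac{(x+Bt^2)^2}{2t}+\frac{(x-\beta t+Bt^2)^2}{2t}\right)$. *$\mathscr F_2$:* with $T_-=\beta+1+\alpha e^{-2at}$, $T_+=\alpha+1+\beta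 e^{2at}$, - $\mathscr S_1^{\alpha,\beta}$ ($\alpha+\beta+1>0$, $T_\pm>0$): $X=\frac{(x+c)\sqrt{\alpha+\beta+1}}{\sqrt{T_+T_-}}-c$, $T=t+\frac{\ln(T_- /T_+)}{2a}$, $m=T_+^{\nu}\,T_-^{-\nu-1/2}\exp\left(-\frac{a(x+c)^2[(\beta+1)T_+-(\alpha+1)T_-]}{2T_+T_-}\right)$; - $\mathscr S_2^{\alpha,\beta}$: $X=x-\alpha e^{at}-\beta e^{-at}$, $T=t$, $m=\exp\left(-\frac a2(\alpha e^{at}-\beta e^{-at})[(x+c)+(X+c)]\right)$. *$\mathscr F_3$:* $\mathscr S_1^{\alpha,\beta}$ ($\alpha>0$, $1+\alpha\beta t>0$): $X=\frac{\alpha x}{1+\alpha\beta t}$, $T=\frac{\alpha^2t}{1+\alpha\beta t}$, $m=\frac1{\sqrt{1+\alpha\beta t}}\exp\left(-\frac{\alpha\beta x^2}{2(1+\alpha\beta t)}+Ct\left[\frac{\alpha^2}{1+\alpha\beta t}-1\right]\right)$. *$\mathscr F_4$:* $\mathscr S_1^{\alpha,\beta}$, the formulas of $\mathscr F_2$ with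 $c=0$ and $\nu=-\frac14-\frac C{2a}$. Conversely, let $I\subseteq E$ be a nonempty open interval, $J\ni0$ an open interval, and let $u=f\,U(X,T)$ be any symmetry on $I\times J$ with $f,X,T$ smooth, $X(I\times J)\subseteq E$, $f\ne0$, $\partial_xX\neq0$, and $T(0)=0$. Then on $I\times J$: - for $\mathscr F_1$, up to a constant factor $\pm1$ in $f$, it is a composition of finitely many of the symmetries $\mathscr S_1^{\alpha,\beta}$, $\mathscr S_2^{\alpha,\beta}$; - for $\mathscr F_2$, the same holds up to a constant factor $\pm1$ in $f$ and possibly the reflection $X+c\mapsto-(X+c)$; - for $\mathscr F_3$ and $\mathscr F_4$, it is a single $\mathscr S_1^{\alpha,\beta}$, up to a nonzero constant factor in $f$. In compositions the factors $\theta$ telescope, so that $f=\pm\frac{\theta(x)}{\theta(X)}m$, where $X$ is the final point and $m$ is the product of the individual factors $m$ along the composition; intermediate points need not lie in $E$. -/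

import Mathlib

open scoped ContDiff

namespace FPK

/-! ### The Fokker–Planck–Kolmogorov equation of `dX = μ(X) dt + dW` -/

/-- `μ` is a smooth drift on the open set `E` that solves the Riccati equation `μ' + μ² = V` there,
and `θ` is a nowhere vanishing function on `E` with `μ = θ' / θ`, that is, `θ = exp (∫ μ)` up to a
constant factor. -/
def IsDrift (V : ℝ → ℝ) (E : Set ℝ) (μ θ : ℝ → ℝ) : Prop :=
  ContDiffOn ℝ ∞ μ E ∧ (∀ x ∈ E, deriv μ x + μ x ^ 2 = V x) ∧
    ∀ x ∈ E, θ x ≠ 0 ∧ HasDerivAt θ (μ x * θ x) x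

/-- `u` is a smooth solution of `u_t = u_xx / 2 - μ u_x - μ' u` on the (open) set `O` of points
`(x, t)`. -/
def IsSolution (μ : ℝ → ℝ) (O : Set (ℝ × ℝ)) (u : ℝ → ℝ → ℝ) : Prop :=
  ContDiffOn ℝ ∞ (fun p : ℝ × ℝ => u p.1 p.2) O ∧
    ∀ x t, (x, t) ∈ O →
      deriv (fun s => u x s) t =
        1 / 2 * deriv (deriv fun y => u y t) x - μ x * deriv (fun y => u y t) x
          - deriv μ x * u x t

/-- The substitution `U ↦ f(x,t) U(X(x,t), T(t))`, restricted to the points of `P`, turns every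
local solution `U` into a local solution. -/
def PreservesSolutions (μ : ℝ → ℝ) (E : Set ℝ) (P : Set (ℝ × ℝ))
    (f X : ℝ → ℝ → ℝ) (T : ℝ → ℝ) : Prop :=
  ∀ O : Set (ℝ × ℝ), IsOpen O → O ⊆ E ×ˢ Set.univ → ∀ U : ℝ → ℝ → ℝ, IsSolution μ O U →
    IsSolution μ (P ∩ {p | (X p.1 p.2, T p.2) ∈ O}) fun x t => f x t * U (X x t) (T t)

/-! ### Explicit local transformations -/

/-- Data of a local transformation
`u(x,t) = (θ(x) / θ(X(x,t))) m(x,t) U(X(x,t), T(t))`, with its domain `dom` in the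
`(x,t)`-plane. -/
structure Transf where
  dom : Set (ℝ × ℝ)
  X : ℝ → ℝ → ℝ
  T : ℝ → ℝ
  m : ℝ → ℝ → ℝ

namespace Transf

/-- The quotient `u(x,t) / U(X,T) = (θ(x) / θ(X)) m(x,t)`. -/
noncomputable def mult (θ : ℝ → ℝ) (g : Transf) (x t : ℝ) : ℝ :=
  θ x / θ (g.X x t) * g.m x t

/-- The points of the domain that lie, together with their image, over the state space `E`. -/
def region (E : Set ℝ) (g : Transf) : Set (ℝ × ℝ) :=
  {p | p ∈ g.dom ∧ p.1 ∈ E ∧ g.X p.1 p.2 ∈ E}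

/-- Composition: the result of acting on `U` by `g₂` and then on the outcome by `g₁`. The factors
`θ` telescope, see `mult_comp`. -/
def comp (g₁ g₂ : Transf) : Transf where
  dom := {p | p ∈ g₁.dom ∧ (g₁.X p.1 p.2, g₁.T p.2) ∈ g₂.dom}
  X x t := g₂.X (g₁.X x t) (g₁.T t)
  T t := g₂.T (g₁.T t)
  m x t := g₁.m x t * g₂.m (g₁.X x t) (g₁.T t)

theorem mult_comp (θ : ℝ → ℝ) (g₁ g₂ : Transf) (x t : ℝ) (h : θ (g₁.X x t) ≠ 0) :
    (g₁.comp g₂).mult θ x t = g₁.mult θ x t * g₂.mult θ (g₁.X x t) (g₁.T t) := by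
  simp only [mult, comp]
  field_simp

/-- Finite compositions of members of `G`. -/
inductive IsComposition (G : Set Transf) : Transf → Prop
  | of (g : Transf) (hg : g ∈ G) : IsComposition G g
  | comp (g₁ g₂ : Transf) (h₁ : IsComposition G g₁) (h₂ : IsComposition G g₂) :
      IsComposition G (g₁.comp g₂)

/-- The transformation is a symmetry: on its region it turns solutions into solutions. -/
def IsSymmetry (μ θ : ℝ → ℝ) (E : Set ℝ) (g : Transf) : Prop :=
  PreservesSolutions μ E (g.region E) (g.mult θ) g.X g.T

end Transf

/-! ### One-parameter groups and their generators

The one-parameter family `S ε` acts on the points of `(x,t,u)`-space by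
`(x, t, u) ↦ (X, T, u / mult)`. Its generator is the field
`genX ∂_x + genT ∂_t + (genU · u) ∂_u`. -/

noncomputable def genX (S : ℝ → Transf) (x t : ℝ) : ℝ := deriv (fun ε => (S ε).X x t) 0

noncomputable def genT (S : ℝ → Transf) (t : ℝ) : ℝ := deriv (fun ε => (S ε).T t) 0

noncomputable def genU (θ : ℝ → ℝ) (S : ℝ → Transf) (x t : ℝ) : ℝ :=
  deriv (fun ε => 1 / (S ε).mult θ x t) 0

/-- `S` is a local one-parameter group of transformations, obtained by exponentiating its generator:
`ε ↦ (X, T, u / mult)` solves the differential equation of the generator with initial value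
`(x, t, u)`. -/
structure IsOneParameterGroup (θ : ℝ → ℝ) (E : Set ℝ) (S : ℝ → Transf) : Prop where
  interval : ∀ x t, {ε : ℝ | (x, t) ∈ (S ε).dom}.OrdConnected
  zero : (S 0).dom = Set.univ ∧ ∀ x t, (S 0).X x t = x ∧ (S 0).T t = t ∧ (S 0).m x t = 1
  add : ∀ ε δ x t, (x, t) ∈ (S ε).dom → ((S ε).X x t, (S ε).T t) ∈ (S δ).dom →
    (x, t) ∈ (S (ε + δ)).dom ∧
    (S (ε + δ)).X x t = (S δ).X ((S ε).X x t) ((S ε).T t) ∧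
    (S (ε + δ)).T t = (S δ).T ((S ε).T t) ∧
    (S (ε + δ)).m x t = (S ε).m x t * (S δ).m ((S ε).X x t) ((S ε).T t)
  flow : ∀ ε x t, (x, t) ∈ (S ε).region E →
    HasDerivAt (fun e => (S e).X x t) (genX S ((S ε).X x t) ((S ε).T t)) ε ∧
    HasDerivAt (fun e => (S e).T t) (genT S ((S ε).T t)) ε ∧
    ∀ u : ℝ, HasDerivAt (fun e => u / (S e).mult θ x t)
      (genU θ S ((S ε).X x t) ((S ε).T t) * (u / (S ε).mult θ x t)) ε

/-! ### Infinitesimal symmetries: vector fields `ξ ∂_x + τ ∂_t + φ ∂_u` -/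

/-- `∂F/∂x` for `F(x,t,u)`. -/
noncomputable def pdx (F : ℝ → ℝ → ℝ → ℝ) (x t u : ℝ) : ℝ := deriv (fun y => F y t u) x

/-- `∂F/∂t` for `F(x,t,u)`. -/
noncomputable def pdt (F : ℝ → ℝ → ℝ → ℝ) (x t u : ℝ) : ℝ := deriv (fun s => F x s u) t

/-- `∂F/∂u` for `F(x,t,u)`. -/
noncomputable def pdu (F : ℝ → ℝ → ℝ → ℝ) (x t u : ℝ) : ℝ := deriv (fun w => F x t w) u

/-- Coefficient of `∂/∂u_x` in the prolongation (`ux`, `ut` stand for the jet variables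
`u_x`, `u_t`). -/
noncomputable def prolX (ξ τ φ : ℝ → ℝ → ℝ → ℝ) (x t u ux ut : ℝ) : ℝ :=
  pdx φ x t u + (pdu φ x t u - pdx ξ x t u) * ux - pdx τ x t u * ut
    - pdu ξ x t u * ux ^ 2 - pdu τ x t u * ux * ut

/-- Coefficient of `∂/∂u_t` in the prolongation. -/
noncomputable def prolT (ξ τ φ : ℝ → ℝ → ℝ → ℝ) (x t u ux ut : ℝ) : ℝ :=
  pdt φ x t u - pdt ξ x t u * ux + (pdu φ x t u - pdt τ x t u) * ut
    - pdu ξ x t u * ux * ut - pdu τ x t u * ut ^ 2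

/-- Coefficient of `∂/∂u_xx` in the second prolongation. -/
noncomputable def prolXX (ξ τ φ : ℝ → ℝ → ℝ → ℝ) (x t u ux ut uxx uxt : ℝ) : ℝ :=
  pdx (pdx φ) x t u + (2 * pdx (pdu φ) x t u - pdx (pdx ξ) x t u) * ux
    - pdx (pdx τ) x t u * ut
    + (pdu (pdu φ) x t u - 2 * pdx (pdu ξ) x t u) * ux ^ 2
    - 2 * pdx (pdu τ) x t u * ux * ut
    - pdu (pdu ξ) x t u * ux ^ 3 - pdu (pdu τ) x t u * ux ^ 2 * ut
    + (pdu φ x t u - 2 * pdx ξ x t u) * uxx - 2 * pdx τ x t u * uxt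
    - 3 * pdu ξ x t u * ux * uxx - pdu τ x t u * ut * uxx - 2 * pdu τ x t u * ux * uxt

/-- `F(x,t,u)` is smooth over `(x,t) ∈ D`, `u ∈ ℝ`. -/
def SmoothCoeff (D : Set (ℝ × ℝ)) (F : ℝ → ℝ → ℝ → ℝ) : Prop :=
  ContDiffOn ℝ ∞ (fun p : (ℝ × ℝ) × ℝ => F p.1.1 p.1.2 p.2) (D ×ˢ Set.univ)

/-- The second prolongation of `ξ ∂_x + τ ∂_t + φ ∂_u` annihilates
`u_xx / 2 - μ u_x - μ' u - u_t` on the variety where this expression vanishes. -/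
def IsInfinitesimalSymmetry (μ : ℝ → ℝ) (D : Set (ℝ × ℝ)) (ξ τ φ : ℝ → ℝ → ℝ → ℝ) : Prop :=
  ∀ x t, (x, t) ∈ D → ∀ u ux ut uxx uxt : ℝ,
    1 / 2 * uxx - μ x * ux - deriv μ x * u - ut = 0 →
    1 / 2 * prolXX ξ τ φ x t u ux ut uxx uxt - μ x * prolX ξ τ φ x t u ux ut
      - deriv μ x * φ x t u - prolT ξ τ φ x t u ux ut
      - ξ x t u * (deriv μ x * ux + deriv (deriv μ) x * u) = 0

/-- The FPKE has exactly the Lie symmetries `S 0, …, S (n-1)` and the superposition symmetry: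
each `S i` is a one-parameter group of symmetries, addition of a solution is a symmetry, over every
rectangle the infinitesimal symmetries are exactly the linear combinations of the `n` generators
plus fields `β(x,t) ∂_u` with `β` a solution, and the generators are linearly independent. -/
structure IsSymmetryList (μ θ : ℝ → ℝ) (E : Set ℝ) {n : ℕ} (S : Fin n → ℝ → Transf) : Prop where
  group : ∀ i, IsOneParameterGroup θ E (S i)
  symm : ∀ i ε, (S i ε).IsSymmetry μ θ E
  superposition : ∀ O : Set (ℝ × ℝ), IsOpen O → O ⊆ E ×ˢ Set.univ → ∀ β U : ℝ → ℝ → ℝ,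
    IsSolution μ O β → IsSolution μ O U → IsSolution μ O fun x t => β x t + U x t
  complete : ∀ I J : Set ℝ, IsOpen I → I.OrdConnected → I.Nonempty → I ⊆ E →
    IsOpen J → J.OrdConnected → J.Nonempty → ∀ ξ τ φ : ℝ → ℝ → ℝ → ℝ,
    SmoothCoeff (I ×ˢ J) ξ → SmoothCoeff (I ×ˢ J) τ → SmoothCoeff (I ×ˢ J) φ →
    (IsInfinitesimalSymmetry μ (I ×ˢ J) ξ τ φ ↔
      ∃ (c : Fin n → ℝ) (β : ℝ → ℝ → ℝ), IsSolution μ (I ×ˢ J) β ∧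
        ∀ x ∈ I, ∀ t ∈ J, ∀ u : ℝ,
          ξ x t u = ∑ i, c i * genX (S i) x t ∧
          τ x t u = ∑ i, c i * genT (S i) t ∧
          φ x t u = (∑ i, c i * genU θ (S i) x t) * u + β x t)
  independent : ∀ I J : Set ℝ, IsOpen I → I.OrdConnected → I.Nonempty → I ⊆ E →
    IsOpen J → J.OrdConnected → J.Nonempty → ∀ c : Fin n → ℝ,
    (∀ x ∈ I, ∀ t ∈ J, ∑ i, c i * genX (S i) x t = 0 ∧ ∑ i, c i * genT (S i) t = 0 ∧
      ∑ i, c i * genU θ (S i) x t = 0) → c = 0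

/-- `u(x,t) = f(x,t) U(X(x,t), T(t))` is a smooth, nondegenerate symmetry of the FPKE, defined for
`x ∈ I`, `t ∈ J`, with `T(0) = 0`. -/
structure IsLieSymmetryFixingZero (μ : ℝ → ℝ) (E I J : Set ℝ) (f X : ℝ → ℝ → ℝ) (T : ℝ → ℝ) :
    Prop where
  openI : IsOpen I
  ordI : I.OrdConnected
  nonemptyI : I.Nonempty
  subI : I ⊆ E
  openJ : IsOpen J
  ordJ : J.OrdConnected
  zero_mem : (0 : ℝ) ∈ J
  smooth_f : ContDiffOn ℝ ∞ (fun p : ℝ × ℝ => f p.1 p.2) (I ×ˢ J)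
  smooth_X : ContDiffOn ℝ ∞ (fun p : ℝ × ℝ => X p.1 p.2) (I ×ˢ J)
  smooth_T : ContDiffOn ℝ ∞ T J
  maps : ∀ x ∈ I, ∀ t ∈ J, X x t ∈ E
  f_ne : ∀ x ∈ I, ∀ t ∈ J, f x t ≠ 0
  X_ne : ∀ x ∈ I, ∀ t ∈ J, deriv (fun y => X y t) x ≠ 0
  preserves : PreservesSolutions μ E (I ×ˢ J) f X T
  T_zero : T 0 = 0

/-! ### Family 1: `μ' + μ² = 4 B x + 2 C` -/

namespace F1

/-- `Q(x,t) = -2 B x t + 2 B² t³ / 3 - C t`. -/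
noncomputable def Q (B C x t : ℝ) : ℝ := -2 * B * x * t + 2 * B ^ 2 * t ^ 3 / 3 - C * t

/-- The two-parameter symmetry `S₁^{α,β}`. The multiplier is written in a form that is regular at
`t = 0`, see `two1_m_eq`. -/
noncomputable def two1 (B C α β : ℝ) : Transf where
  dom := {p | 0 < 1 + α * β * p.2}
  X x t := α * (x - B * t ^ 2) / (1 + α * β * t) + B * α ^ 4 * t ^ 2 / (1 + α * β * t) ^ 2
  T t := α ^ 2 * t / (1 + α * β * t)
  m x t := |α| / √(1 + α * β * t) * Real.exp (-(α * β * (x - B * t ^ 2) ^ 2) / (2 * (1 + α * β * t))) *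
    (Real.exp (Q B C x t) /
      Real.exp (Q B C
        (α * (x - B * t ^ 2) / (1 + α * β * t) + B * α ^ 4 * t ^ 2 / (1 + α * β * t) ^ 2)
        (α ^ 2 * t / (1 + α * β * t))))

/-- The two-parameter symmetry `S₂^{α,β}`; for the multiplier see `two2_m_eq`. -/
noncomputable def two2 (B α β : ℝ) : Transf where
  dom := Set.univ
  X x t := x - α - β * t
  T t := t
  m x t := Real.exp (-2 * α * B * t - β * (x + B * t ^ 2) + β ^ 2 * t / 2)

/-- Scaling. -/
noncomputable def scaling (B C ε : ℝ) : Transf where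
  dom := Set.univ
  X x t := (x - B * t ^ 2) * Real.exp (-ε / 2) + B * t ^ 2 * Real.exp (-2 * ε)
  T t := t * Real.exp (-ε)
  m x t := Real.exp (Q B C x t) /
    Real.exp (Q B C ((x - B * t ^ 2) * Real.exp (-ε / 2) + B * t ^ 2 * Real.exp (-2 * ε))
      (t * Real.exp (-ε)))

/-- Space translation. -/
noncomputable def spaceShift (B ε : ℝ) : Transf where
  dom := Set.univ
  X x _ := x - ε
  T t := t
  m x t := Real.exp (-2 * B * x * t) / Real.exp (-2 * B * (x - ε) * t)

end F1

/-- Time translation `u(x,t) = U(x, t + ε)`. -/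
def timeShift (ε : ℝ) : Transf where
  dom := Set.univ
  X x _ := x
  T t := t + ε
  m _ _ := 1

/-- Multiplication `u(x,t) = e^ε U(x,t)`. -/
noncomputable def rescale (ε : ℝ) : Transf where
  dom := Set.univ
  X x _ := x
  T t := t
  m _ _ := Real.exp ε

namespace F1

/-- The six one-parameter groups; the first is `S₁^{1,ε}` and the third is `S₂^{0,ε}`. -/
noncomputable def list (B C : ℝ) : Fin 6 → ℝ → Transf :=
  ![fun ε => two1 B C 1 ε, scaling B C, fun ε => two2 B 0 ε, spaceShift B, timeShift, rescale]

/-- The two-parameter symmetries. -/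
def two (B C : ℝ) : Set Transf :=
  {g | (∃ α β, α ≠ 0 ∧ g = two1 B C α β) ∨ ∃ α β, g = two2 B α β}

/-- For `t > 0`, the multiplier of `S₁^{α,β}` as a quotient of values of one function at `(x,t)`
and `(X,T)`. -/
theorem two1_m_eq (B C α β x t : ℝ) (hα : α ≠ 0) (ht : 0 < t) (h : 0 < 1 + α * β * t) :
    let X := (two1 B C α β).X x t
    let T := (two1 B C α β).T t
    (two1 B C α β).m x t =
      Real.exp (-(x + B * t ^ 2) ^ 2 / (2 * t) + 2 * B ^ 2 * t ^ 3 / 3 - C * t) /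
        Real.exp (-(X + B * T ^ 2) ^ 2 / (2 * T) + 2 * B ^ 2 * T ^ 3 / 3 - C * T) *
      (t ^ (-(1 / 2) : ℝ) / T ^ (-(1 / 2) : ℝ)) := by
  intro X T
  have hT : 0 < T := by
    simp only [T, two1]; positivity
  have hs : t ^ (-(1 / 2) : ℝ) / T ^ (-(1 / 2) : ℝ) = |α| / √(1 + α * β * t) := by
    rw [Real.rpow_neg ht.le, Real.rpow_neg hT.le, ← Real.sqrt_eq_rpow, ← Real.sqrt_eq_rpow]
    have : √T = |α| * √t / √(1 + α * β * t) := by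
      simp only [T, two1]
      rw [Real.sqrt_div (by positivity), Real.sqrt_mul (by positivity), Real.sqrt_sq_eq_abs]
    rw [this]
    have := (Real.sqrt_pos.2 ht).ne'
    have := (Real.sqrt_pos.2 h).ne'
    field_simp
  rw [hs, mul_comm (_ / _ : ℝ) (|α| / _)]
  simp only [two1]
  rw [mul_assoc, ← Real.exp_sub, ← Real.exp_sub, ← Real.exp_add]
  congr 2
  simp only [X, T, two1, Q]
  have h' := h.ne'
  generalize hd : 1 + α * β * t = d at *
  have hb : α * β = (d - 1) / t := by field_simp; linarith
  rw [hb]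
  field_simp
  ring

/-- For `t ≠ 0`, the multiplier of `S₂^{α,β}` as a quotient. -/
theorem two2_m_eq (B α β x t : ℝ) (ht : t ≠ 0) :
    (two2 B α β).m x t =
      Real.exp (-2 * α * B * t) * (Real.exp (-(x + B * t ^ 2) ^ 2 / (2 * t)) /
        Real.exp (-(x - α - β * t + B * t ^ 2 + α) ^ 2 / (2 * t))) := by
  simp only [two2]
  rw [← Real.exp_sub, ← Real.exp_add]
  congr 1
  field_simp
  ring

end F1

/-! ### Families 2 and 4: `μ' + μ² = A x² + 4 B x + 2 C` and `μ' + μ² = A x² + 2 C + D / x²`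

Here `a = √A`, the centre is `-c` (with `c = 2 B / A` for family 2 and `c = 0` for family 4). -/

namespace F24

/-- The two groups given by the two values `σ = 1` and `σ = -1`. -/
noncomputable def inv (a c ν σ ε : ℝ) : Transf where
  dom := {p | 0 < ε + Real.exp (-σ * (2 * a * p.2))}
  X x t := (x + c) / √(1 + ε * Real.exp (σ * (2 * a * t))) - c
  T t := -σ * (Real.log (ε + Real.exp (-σ * (2 * a * t))) / (2 * a))
  m x t :=
    Real.exp (2 * a * (ν + 1 / 4 - σ / 4) * t - σ * (a / 2) * (x + c) ^ 2) /
    Real.exp (2 * a * (ν + 1 / 4 - σ / 4) *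
        (-σ * (Real.log (ε + Real.exp (-σ * (2 * a * t))) / (2 * a)))
      - σ * (a / 2) *
        ((x + c) / √(1 + ε * Real.exp (σ * (2 * a * t))) - c + c) ^ 2)

/-- Translation by `ε e^{σ a t}`, for `σ = 1` and `σ = -1`. -/
noncomputable def shift (a c σ ε : ℝ) : Transf where
  dom := Set.univ
  X x t := x - ε * Real.exp (σ * (a * t))
  T t := t
  m x t :=
    Real.exp (-σ * (a / 2) * ε * Real.exp (σ * (a * t)) * (x + c)) /
    Real.exp (σ * (a / 2) * ε * Real.exp (σ * (a * t)) * (x - ε * Real.exp (σ * (a * t)) + c))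

noncomputable def Tminus (a α β t : ℝ) : ℝ := β + 1 + α * Real.exp (-(2 * a * t))

noncomputable def Tplus (a α β t : ℝ) : ℝ := α + 1 + β * Real.exp (2 * a * t)

/-- The two-parameter symmetry `S₁^{α,β}`. -/
noncomputable def two1 (a c ν α β : ℝ) : Transf where
  dom := {p | 0 < Tminus a α β p.2 ∧ 0 < Tplus a α β p.2}
  X x t := (x + c) * √(α + β + 1) / √(Tplus a α β t * Tminus a α β t) - c
  T t := t + Real.log (Tminus a α β t / Tplus a α β t) / (2 * a)
  m x t :=
    Real.exp (-(a * (x + c) ^ 2 * ((β + 1) * Tplus a α β t - (α + 1) * Tminus a α β t)) /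
      (2 * Tplus a α β t * Tminus a α β t)) /
    (Tplus a α β t ^ (-ν) * Tminus a α β t ^ (ν + 1 / 2))

/-- The two-parameter symmetry `S₂^{α,β}` (family 2 only). -/
noncomputable def two2 (a c α β : ℝ) : Transf where
  dom := Set.univ
  X x t := x - α * Real.exp (a * t) - β * Real.exp (-(a * t))
  T t := t
  m x t :=
    Real.exp (-(a / 2) * (α * Real.exp (a * t) - β * Real.exp (-(a * t))) * (x + c)) /
    Real.exp (a / 2 * (α * Real.exp (a * t) - β * Real.exp (-(a * t))) *
      (x - α * Real.exp (a * t) - β * Real.exp (-(a * t)) + c))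

end F24

namespace F2

noncomputable def nu (A B C : ℝ) : ℝ := 1 / (2 * √A) * (2 * B ^ 2 / A - √A / 2 - C)

noncomputable def list (A B C : ℝ) : Fin 6 → ℝ → Transf :=
  ![F24.inv √A (2 * B / A) (nu A B C) 1, F24.inv √A (2 * B / A) (nu A B C) (-1),
    F24.shift √A (2 * B / A) 1, F24.shift √A (2 * B / A) (-1), timeShift, rescale]

def two (A B C : ℝ) : Set Transf :=
  {g | (∃ α β, 0 < α + β + 1 ∧ g = F24.two1 √A (2 * B / A) (nu A B C) α β) ∨
    ∃ α β, g = F24.two2 √A (2 * B / A) α β}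

end F2

namespace F4

noncomputable def nu (A C : ℝ) : ℝ := -(1 / 4) - C / (2 * √A)

noncomputable def list (A C : ℝ) : Fin 4 → ℝ → Transf :=
  ![F24.inv √A 0 (nu A C) 1, F24.inv √A 0 (nu A C) (-1), timeShift, rescale]

end F4

/-! ### Family 3: `μ' + μ² = 2 C + D / x²` -/

namespace F3

/-- The two-parameter symmetry `S₁^{α,β}`. -/
noncomputable def two1 (C α β : ℝ) : Transf where
  dom := {p | 0 < 1 + α * β * p.2}
  X x t := α * x / (1 + α * β * t)
  T t := α ^ 2 * t / (1 + α * β * t)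
  m x t := Real.exp (-(α * β * x ^ 2) / (2 * (1 + α * β * t))
    + C * t * (α ^ 2 / (1 + α * β * t) - 1)) / √(1 + α * β * t)

/-- Scaling. -/
noncomputable def scaling (C ε : ℝ) : Transf where
  dom := Set.univ
  X x _ := x * Real.exp (-ε / 2)
  T t := t * Real.exp (-ε)
  m _ t := Real.exp (C * t * (Real.exp (-ε) - 1))

/-- The four one-parameter groups; the first is `S₁^{1,ε}`. -/
noncomputable def list (C : ℝ) : Fin 4 → ℝ → Transf :=
  ![fun ε => two1 C 1 ε, scaling C, timeShift, rescale]

end F3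

end FPK

/-!
Dividing by `θ` turns the Fokker–Planck–Kolmogorov equation into the heat equation with potential,
`w_t = w_xx / 2 - V w / 2` (`IsDrift.isSolution_iff`), in which the drift no longer occurs. A
transformation `w = m(x,t) W(X,T)` preserves its solutions as soon as `X = ρ(t) x + σ(t)`,
`T' = ρ²`, `m_x / m` is affine in `x` with `ρ m_x / m = X_t`, and `m_t / m` is prescribed by the
equation (`Intertwines`, `Intertwines.isHeatSolution`). These conditions are stable under
composition and are verified for every transformation in the four lists.

*One-parameter groups.* The group law is checked on the formulas; together with the derivative at
`ε = 0` it yields the differential equation of the flow (`HasGenerator.isOneParameterGroup`).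

*Completeness of the lists.* The second prolongation of a vector field is a polynomial in the jet
variables. Comparing coefficients shows that `τ` depends on `t` only, that `ξ = τ' x / 2 + s(t)` and
that `φ` is affine in `u` (`IsInfinitesimalSymmetry.coeff_form`). For the potentials
`V = A x² + 4 B x + 2 C + D / x²` what remains is a linear system of ordinary differential equations
in `t` (`isInfinitesimalSymmetry_iff_determining`):
`τ''' = 4 A τ'`, `s'' = 3 B τ' + A s`, `k' = -τ'' / 4 - C τ' - 2 B s`, `D s = 0`.
It is solved by first integrals, and the generators of the listed groups form a basis of its
solutions (`isSymmetryList_of_basis`).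

*Symmetries with `T(0) = 0`.* At any point the values of `W`, `W_x`, `W_t` can be prescribed for a
local solution `W` (`IsDrift.exists_isHeatSolution_jet`), so that, conversely, a symmetry satisfies
the conditions above (`intertwines_of_preservesSolutions`). Equality of the mixed derivatives of
`log m` then gives differential equations for `ρ` and `σ` (`Intertwines.profile`). In terms of
`1 / ρ` they linearise: for `A = 0` the function `1 / ρ` is affine, and for `A = a²` the functions
`exp (± a T) / ρ` are combinations of `exp (± a t)`; this identifies `ρ` and `T` with those of some
`S₁^{α,β}`. The difference of two admissible `σ` is a combination of `1, T`, respectively of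
`exp (± a T)`, which is the effect of a subsequent `S₂^{α,β}`; for `D ≠ 0` necessarily `σ = 0`.
Finally `m` is determined up to a constant factor (`Intertwines.exists_eq_const_mul`). In the first
two families the symmetries `S₂^{α,β}` do not commute, and suitable compositions of them are
multiplications by arbitrary positive constants, so that only a sign remains.
-/

namespace FPK

/-! ### Smooth functions of two variables -/

/-- `F(x,t)` is smooth on the set `D` of points `(x,t)`. -/
abbrev SmoothOn₂ (D : Set (ℝ × ℝ)) (F : ℝ → ℝ → ℝ) : Prop :=
  ContDiffOn ℝ ∞ (fun p : ℝ × ℝ => F p.1 p.2) D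

/-- `∂F/∂x` for `F(x,t)`. -/
noncomputable def dx (F : ℝ → ℝ → ℝ) (x t : ℝ) : ℝ := deriv (fun y => F y t) x

/-- `∂F/∂t` for `F(x,t)`. -/
noncomputable def dt (F : ℝ → ℝ → ℝ) (x t : ℝ) : ℝ := deriv (fun s => F x s) t

section Calculus

variable {D : Set (ℝ × ℝ)} {F : ℝ → ℝ → ℝ} {x t : ℝ}

theorem SmoothOn₂.hasFDerivAt (hD : IsOpen D) (hF : SmoothOn₂ D F) (h : (x, t) ∈ D) :
    HasFDerivAt (fun p : ℝ × ℝ => F p.1 p.2)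
      (fderiv ℝ (fun p : ℝ × ℝ => F p.1 p.2) (x, t)) (x, t) :=
  ((hF.contDiffAt (hD.mem_nhds h)).differentiableAt (by simp)).hasFDerivAt

theorem hasDerivAt_inl (x t : ℝ) : HasDerivAt (fun y : ℝ => (y, t)) ((1 : ℝ), (0 : ℝ)) x :=
  (hasDerivAt_id x).prodMk (hasDerivAt_const x t)

theorem hasDerivAt_inr (x t : ℝ) : HasDerivAt (fun s : ℝ => (x, s)) ((0 : ℝ), (1 : ℝ)) t :=
  (hasDerivAt_const t x).prodMk (hasDerivAt_id t)

theorem _root_.HasFDerivAt.along_fst {G : ℝ × ℝ → ℝ} {G' : ℝ × ℝ →L[ℝ] ℝ}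
    (h : HasFDerivAt G G' (x, t)) : HasDerivAt (fun y => G (y, t)) (G' (1, 0)) x :=
  HasFDerivAt.comp_hasDerivAt x h (hasDerivAt_inl x t)

theorem _root_.HasFDerivAt.along_snd {G : ℝ × ℝ → ℝ} {G' : ℝ × ℝ →L[ℝ] ℝ}
    (h : HasFDerivAt G G' (x, t)) : HasDerivAt (fun s => G (x, s)) (G' (0, 1)) t :=
  HasFDerivAt.comp_hasDerivAt t h (hasDerivAt_inr x t)

theorem eventually_mem_inl (hD : IsOpen D) (h : (x, t) ∈ D) : ∀ᶠ y in nhds x, (y, t) ∈ D :=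
  (hasDerivAt_inl x t).continuousAt.eventually (hD.mem_nhds h)

theorem eventually_mem_inr (hD : IsOpen D) (h : (x, t) ∈ D) : ∀ᶠ s in nhds t, (x, s) ∈ D :=
  (hasDerivAt_inr x t).continuousAt.eventually (hD.mem_nhds h)

theorem SmoothOn₂.dx_eq (hD : IsOpen D) (hF : SmoothOn₂ D F) (h : (x, t) ∈ D) :
    dx F x t = fderiv ℝ (fun p : ℝ × ℝ => F p.1 p.2) (x, t) (1, 0) :=
  (hF.hasFDerivAt hD h).along_fst.deriv

theorem SmoothOn₂.dt_eq (hD : IsOpen D) (hF : SmoothOn₂ D F) (h : (x, t) ∈ D) :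
    dt F x t = fderiv ℝ (fun p : ℝ × ℝ => F p.1 p.2) (x, t) (0, 1) :=
  (hF.hasFDerivAt hD h).along_snd.deriv

theorem SmoothOn₂.hasDerivAt_dx (hD : IsOpen D) (hF : SmoothOn₂ D F) (h : (x, t) ∈ D) :
    HasDerivAt (fun y => F y t) (dx F x t) x := by
  rw [hF.dx_eq hD h]
  exact (hF.hasFDerivAt hD h).along_fst

theorem SmoothOn₂.hasDerivAt_dt (hD : IsOpen D) (hF : SmoothOn₂ D F) (h : (x, t) ∈ D) :
    HasDerivAt (fun s => F x s) (dt F x t) t := by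
  rw [hF.dt_eq hD h]
  exact (hF.hasFDerivAt hD h).along_snd

theorem SmoothOn₂.smooth_dx (hD : IsOpen D) (hF : SmoothOn₂ D F) : SmoothOn₂ D (dx F) :=
  ((hF.fderiv_of_isOpen hD (m := ∞) (by simp)).clm_apply contDiffOn_const).congr
    fun _ hp => hF.dx_eq hD hp

/-- The chain rule along a curve `(a(s), b(s))`. -/
theorem SmoothOn₂.hasDerivAt_comp (hD : IsOpen D) (hF : SmoothOn₂ D F) {a b : ℝ → ℝ}
    {a' b' s : ℝ} (ha : HasDerivAt a a' s) (hb : HasDerivAt b b' s) (h : (a s, b s) ∈ D) :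
    HasDerivAt (fun r => F (a r) (b r)) (dx F (a s) (b s) * a' + dt F (a s) (b s) * b') s := by
  have key := (hF.hasFDerivAt hD h).comp_hasDerivAt s (ha.prodMk hb)
  rw [hF.dx_eq hD h, hF.dt_eq hD h]
  refine key.congr_deriv ?_
  have : ((a', b') : ℝ × ℝ) = a' • ((1 : ℝ), (0 : ℝ)) + b' • ((0 : ℝ), (1 : ℝ)) := by simp
  rw [this, map_add, map_smul, map_smul]
  simp only [smul_eq_mul]
  ring

theorem SmoothOn₂.dx_dt_comm (hD : IsOpen D) (hF : SmoothOn₂ D F) (h : (x, t) ∈ D) :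
    dx (dt F) x t = dt (dx F) x t := by
  set G : ℝ × ℝ → ℝ := fun p => F p.1 p.2 with hG
  have hs : ContDiffAt ℝ ∞ G (x, t) := hF.contDiffAt (hD.mem_nhds h)
  have hsym : IsSymmSndFDerivAt ℝ G (x, t) :=
    hs.isSymmSndFDerivAt (by
      simp only [minSmoothness_of_isRCLikeNormedField]
      exact WithTop.coe_le_coe.2 le_top)
  have hd : HasFDerivAt (fderiv ℝ G) (fderiv ℝ (fderiv ℝ G) (x, t)) (x, t) :=
    ((hs.fderiv_right (m := ∞) (by simp)).differentiableAt (by simp)).hasFDerivAt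
  have hv : ∀ v, HasFDerivAt (fun p => fderiv ℝ G p v)
      ((ContinuousLinearMap.apply ℝ ℝ v).comp (fderiv ℝ (fderiv ℝ G) (x, t))) (x, t) := fun v =>
    (ContinuousLinearMap.apply ℝ ℝ v).hasFDerivAt.comp (x, t) hd
  have h1 : HasDerivAt (fun y => dt F y t) (fderiv ℝ (fderiv ℝ G) (x, t) (1, 0) (0, 1)) x := by
    refine HasDerivAt.congr_of_eventuallyEq
      (hv (0, 1)).along_fst ?_
    filter_upwards [eventually_mem_inl hD h] with y hy using hF.dt_eq hD hy
  have h2 : HasDerivAt (fun s => dx F x s) (fderiv ℝ (fderiv ℝ G) (x, t) (0, 1) (1, 0)) t := by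
    refine HasDerivAt.congr_of_eventuallyEq
      (hv (1, 0)).along_snd ?_
    filter_upwards [eventually_mem_inr hD h] with y hy using hF.dx_eq hD hy
  exact h1.deriv.trans ((hsym _ _).trans h2.deriv.symm)

/-- Restriction of a smooth function of `(x,t)` to a line `x = const`. -/
theorem SmoothOn₂.contDiffOn_right {I J : Set ℝ} (hF : SmoothOn₂ (I ×ˢ J) F) (hx : x ∈ I) :
    ContDiffOn ℝ ∞ (fun s => F x s) J :=
  hF.comp (f := fun s : ℝ => (x, s)) (by fun_prop) fun _ hs => ⟨hx, hs⟩

end Calculus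

theorem _root_.ContDiffOn.hasDerivAt_deriv {J : Set ℝ} {h : ℝ → ℝ} {t : ℝ} (hJ : IsOpen J)
    (hh : ContDiffOn ℝ ∞ h J) (ht : t ∈ J) : HasDerivAt h (deriv h t) t :=
  ((hh.contDiffAt (hJ.mem_nhds ht)).differentiableAt (by simp)).hasDerivAt

theorem _root_.ContDiffOn.smooth_deriv {J : Set ℝ} {h : ℝ → ℝ} (hJ : IsOpen J)
    (hh : ContDiffOn ℝ ∞ h J) : ContDiffOn ℝ ∞ (deriv h) J :=
  ((contDiffOn_infty_iff_deriv_of_isOpen hJ).1 hh).2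

theorem eq_of_hasDerivAt_zero {J : Set ℝ} {h : ℝ → ℝ} (hJ : IsOpen J) (hJ' : J.OrdConnected)
    (hh : ∀ t ∈ J, HasDerivAt h 0 t) {s t : ℝ} (hs : s ∈ J) (ht : t ∈ J) : h s = h t :=
  hJ.is_const_of_deriv_eq_zero (isPreconnected_iff_ordConnected.2 hJ')
    (fun r hr => (hh r hr).differentiableAt.differentiableWithinAt)
    (fun r hr => (hh r hr).deriv) hs ht

/-- A function equal to a second one on an open set has the same derivative there. -/
theorem hasDerivAt_congr_on {J : Set ℝ} {g h : ℝ → ℝ} {g' t : ℝ} (hJ : IsOpen J) (ht : t ∈ J)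
    (hg : HasDerivAt g g' t) (hh : ∀ s ∈ J, h s = g s) : HasDerivAt h g' t :=
  hg.congr_of_eventuallyEq (Filter.eventually_of_mem (hJ.mem_nhds ht) hh)

/-- If two functions agree on an open set, so do their derivatives. -/
theorem deriv_unique_on {J : Set ℝ} {g h : ℝ → ℝ} {g' h' t : ℝ} (hJ : IsOpen J) (ht : t ∈ J)
    (hg : HasDerivAt g g' t) (hh : HasDerivAt h h' t) (e : ∀ s ∈ J, g s = h s) : g' = h' :=
  (hasDerivAt_congr_on hJ ht hh e).unique hg |>.symm

theorem infinite_of_isOpen {I : Set ℝ} (hI : IsOpen I) (hne : I.Nonempty) : I.Infinite := by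
  obtain ⟨x, hx⟩ := hne
  exact infinite_of_mem_nhds x (hI.mem_nhds hx)

theorem coeff_eq_zero_of_infinite {S : Set ℝ} (hS : S.Infinite) {n : ℕ} (a : Fin n → ℝ)
    (h : ∀ x ∈ S, ∑ i, a i * x ^ (i : ℕ) = 0) (i : Fin n) : a i = 0 := by
  set p : Polynomial ℝ := ∑ i : Fin n, Polynomial.monomial (i : ℕ) (a i) with hp
  have hp0 : p = 0 := by
    apply Polynomial.eq_zero_of_infinite_isRoot
    refine hS.mono fun x hx => ?_
    simpa [hp, Polynomial.IsRoot, Polynomial.eval_finsetSum] using h x hx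
  have : p.coeff i = a i := by
    simp [hp, Polynomial.finsetSum_coeff, Polynomial.coeff_monomial, Fin.val_inj]
  rw [← this, hp0, Polynomial.coeff_zero]

theorem linear_coeffs_eq_zero {S : Set ℝ} (hS : S.Infinite) {a b : ℝ}
    (h : ∀ x ∈ S, a * x + b = 0) : a = 0 ∧ b = 0 := by
  have := coeff_eq_zero_of_infinite hS ![b, a] fun x hx => by
    simp [Fin.sum_univ_succ]; linarith [h x hx]
  exact ⟨this 1, this 0⟩

/-- The functions `x²`, `x`, `1`, `x⁻³` are linearly independent on every infinite set. -/
theorem laurent_coeffs_eq_zero {S : Set ℝ} (hS : S.Infinite) {a b c d : ℝ}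
    (h : ∀ x ∈ S, a * x ^ 2 + b * x + c + d / x ^ 3 = 0) : a = 0 ∧ b = 0 ∧ c = 0 ∧ d = 0 := by
  have := coeff_eq_zero_of_infinite (hS.sdiff (Set.finite_singleton (0 : ℝ)))
    ![d, 0, 0, c, b, a] fun x hx => by
      have hx0 : x ≠ 0 := hx.2
      have := h x hx.1
      field_simp at this
      simp [Fin.sum_univ_succ]
      linarith
  exact ⟨this 5, this 4, this 3, this 0⟩

/-- A difference of translates of `x⁻³` is affine on an infinite set only if it vanishes. -/
theorem shift_eq_zero_of_affine {S : Set ℝ} (hS : S.Infinite) {k l d s : ℝ} (hd : d ≠ 0)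
    (h : ∀ x ∈ S, x ≠ 0 ∧ x + s ≠ 0 ∧ k * x + l = d / x ^ 3 - d / (x + s) ^ 3) : s = 0 := by
  have := coeff_eq_zero_of_infinite hS
    ![-d * s ^ 3, -3 * d * s ^ 2, -3 * d * s, l * s ^ 3, 3 * l * s ^ 2 + k * s ^ 3,
      3 * l * s + 3 * k * s ^ 2, l + 3 * k * s, k] fun x hx => by
      obtain ⟨h1, h2, h3⟩ := h x hx
      field_simp at h3
      simp [Fin.sum_univ_succ]
      linarith
  have h2 : -3 * d * s = 0 := this 2
  simpa [hd] using h2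

/-- Smooth functions on an interval have smooth antiderivatives, normalised at a given point. -/
theorem exists_antideriv {a b x₀ : ℝ} (hx : x₀ ∈ Set.Ioo a b) {h : ℝ → ℝ}
    (hh : ContDiffOn ℝ ∞ h (Set.Ioo a b)) :
    ∃ H : ℝ → ℝ, H x₀ = 0 ∧ ContDiffOn ℝ ∞ H (Set.Ioo a b) ∧
      ∀ x ∈ Set.Ioo a b, HasDerivAt H (h x) x := by
  have hd : ∀ x ∈ Set.Ioo a b, HasDerivAt (fun u => ∫ y in x₀..u, h y) (h x) x := by
    intro x hx'
    have hc := hh.continuousOn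
    apply intervalIntegral.integral_hasDerivAt_right
    · apply ContinuousOn.intervalIntegrable
      exact hc.mono (Set.ordConnected_Ioo.uIcc_subset hx hx')
    · exact hc.stronglyMeasurableAtFilter isOpen_Ioo x hx'
    · exact hc.continuousAt (isOpen_Ioo.mem_nhds hx')
  refine ⟨fun u => ∫ y in x₀..u, h y, by simp, ?_, hd⟩
  rw [contDiffOn_infty_iff_deriv_of_isOpen isOpen_Ioo]
  exact ⟨fun x hx' => (hd x hx').differentiableAt.differentiableWithinAt,
    hh.congr fun x hx' => (hd x hx').deriv⟩

/-! ### Reduction to a heat equation with potential -/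

/-- `w` is a smooth solution of `w_t = w_xx / 2 - V w / 2` on the (open) set `O`. -/
def IsHeatSolution (V : ℝ → ℝ) (O : Set (ℝ × ℝ)) (w : ℝ → ℝ → ℝ) : Prop :=
  SmoothOn₂ O w ∧ ∀ x t, (x, t) ∈ O → dt w x t = 1 / 2 * dx (dx w) x t - 1 / 2 * V x * w x t

section Drift

variable {V : ℝ → ℝ} {E : Set ℝ} {μ θ : ℝ → ℝ}

theorem IsDrift.hasDerivAt_mu (h : IsDrift V E μ θ) (hE : IsOpen E) {x : ℝ} (hx : x ∈ E) :
    HasDerivAt μ (V x - μ x ^ 2) x := by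
  have := h.1.hasDerivAt_deriv hE hx
  rwa [show V x - μ x ^ 2 = deriv μ x by linarith [h.2.1 x hx]]

theorem IsDrift.theta_ne (h : IsDrift V E μ θ) {x : ℝ} (hx : x ∈ E) : θ x ≠ 0 := (h.2.2 x hx).1

theorem IsDrift.hasDerivAt_theta (h : IsDrift V E μ θ) {x : ℝ} (hx : x ∈ E) :
    HasDerivAt θ (μ x * θ x) x := (h.2.2 x hx).2

theorem IsDrift.smooth_theta (h : IsDrift V E μ θ) (hE : IsOpen E) : ContDiffOn ℝ ∞ θ E := by
  have hd : DifferentiableOn ℝ θ E := fun x hx =>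
    (h.hasDerivAt_theta hx).differentiableAt.differentiableWithinAt
  rw [contDiffOn_infty]
  intro n
  induction n with
  | zero => exact contDiffOn_zero.2 hd.continuousOn
  | succ k ih =>
    have : ((k + 1 : ℕ) : WithTop ℕ∞) = (k : WithTop ℕ∞) + 1 := by norm_cast
    rw [this, contDiffOn_succ_iff_deriv_of_isOpen hE]
    refine ⟨hd, by simp, ?_⟩
    exact ((contDiffOn_infty.1 h.1 k).mul ih).congr fun x hx => (h.hasDerivAt_theta hx).deriv

/-- The substitution `u = θ w` turns the equation into the heat equation with potential `V`. -/
theorem IsDrift.isSolution_iff (h : IsDrift V E μ θ) (hE : IsOpen E) {O : Set (ℝ × ℝ)}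
    (hO : IsOpen O) (hOE : O ⊆ E ×ˢ Set.univ) {u w : ℝ → ℝ → ℝ}
    (huw : ∀ x t, (x, t) ∈ O → u x t = θ x * w x t) :
    IsSolution μ O u ↔ IsHeatSolution V O w := by
  have hE' : ∀ {x t}, (x, t) ∈ O → x ∈ E := fun hp => (hOE hp).1
  have hθ : ContDiffOn ℝ ∞ (fun p : ℝ × ℝ => θ p.1) O :=
    (h.smooth_theta hE).comp contDiffOn_fst fun p hp => hE' hp
  have hsm : SmoothOn₂ O u ↔ SmoothOn₂ O w := by
    constructor
    · intro hu
      refine (hu.div hθ fun p hp => h.theta_ne (hE' hp)).congr ?_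
      intro p hp
      have := h.theta_ne (hE' hp)
      rw [Pi.div_apply, huw _ _ hp]
      field_simp
    · intro hw
      exact (hθ.mul hw).congr fun p hp => huw _ _ hp
  unfold IsSolution IsHeatSolution
  change (SmoothOn₂ O u ∧ _) ↔ _
  rw [hsm]
  refine and_congr_right fun hw => ?_
  refine forall_congr' fun x => forall_congr' fun t => forall_congr' fun hp => ?_
  have d1 : ∀ y, (y, t) ∈ O → HasDerivAt (fun y => u y t)
      (μ y * θ y * w y t + θ y * dx w y t) y := fun y hy =>
    ((h.hasDerivAt_theta (hE' hy)).mul (hw.hasDerivAt_dx hO hy)).congr_of_eventuallyEq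
      ((eventually_mem_inl hO hy).mono fun z hz => huw z t hz)
  have hx := hE' hp
  have d2 : deriv (deriv fun y => u y t) x =
      θ x * (dx (dx w) x t + 2 * μ x * dx w x t + V x * w x t) := by
    have e := (((h.hasDerivAt_mu hE hx).mul (h.hasDerivAt_theta hx)).mul
      (hw.hasDerivAt_dx hO hp)).add
      ((h.hasDerivAt_theta hx).mul ((hw.smooth_dx hO).hasDerivAt_dx hO hp))
    rw [Filter.EventuallyEq.deriv_eq
      ((eventually_mem_inl hO hp).mono fun z hz => (d1 z hz).deriv)]
    refine (HasDerivAt.deriv e).trans ?_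
    simp only [Pi.mul_apply]
    ring
  have d3 : deriv (fun s => u x s) t = θ x * dt w x t :=
    (((hw.hasDerivAt_dt hO hp).const_mul (θ x)).congr_of_eventuallyEq
      ((eventually_mem_inr hO hp).mono fun z hz => huw x z hz)).deriv
  rw [d2, d3, (d1 x hp).deriv, huw x t hp, (h.hasDerivAt_mu hE hx).deriv]
  rw [← mul_right_inj' (h.theta_ne hx) (b := dt w x t)]
  constructor <;> intro e <;> rw [e] <;> ring

end Drift

/-! ### Transformations of the heat equation with potential -/

/-- `w(x,t) = m(x,t) W(X(x,t), T(t))` with `X(x,t) = ρ(t) x + σ(t)` satisfies the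
determining equations for turning solutions of the heat equation with potential `V` into
solutions. The logarithmic derivative of `m` in `x` is `a(t) x + b(t)`. -/
structure Intertwines (V : ℝ → ℝ) (D : Set (ℝ × ℝ)) (X : ℝ → ℝ → ℝ) (T : ℝ → ℝ)
    (m : ℝ → ℝ → ℝ) (ρ σ a b : ℝ → ℝ) : Prop where
  X_eq : ∀ {x t}, (x, t) ∈ D → X x t = ρ t * x + σ t
  X_t : ∀ {x t}, (x, t) ∈ D → HasDerivAt (fun s => X x s) (ρ t * (a t * x + b t)) t
  T_t : ∀ {x t}, (x, t) ∈ D → HasDerivAt T (ρ t ^ 2) t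
  m_x : ∀ {x t}, (x, t) ∈ D → HasDerivAt (fun y => m y t) ((a t * x + b t) * m x t) x
  m_t : ∀ {x t}, (x, t) ∈ D → HasDerivAt (fun s => m x s)
    ((1 / 2 * (a t + (a t * x + b t) ^ 2) - 1 / 2 * V x + 1 / 2 * V (X x t) * ρ t ^ 2) * m x t) t

theorem Intertwines.X_x {V : ℝ → ℝ} {D : Set (ℝ × ℝ)} {X : ℝ → ℝ → ℝ} {T : ℝ → ℝ}
    {m : ℝ → ℝ → ℝ} {ρ σ a b : ℝ → ℝ} (h : Intertwines V D X T m ρ σ a b) (hD : IsOpen D)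
    {x t : ℝ} (hp : (x, t) ∈ D) : HasDerivAt (fun y => X y t) (ρ t) x := by
  have : HasDerivAt (fun y => ρ t * y + σ t) (ρ t) x := by
    simpa using ((hasDerivAt_id x).const_mul (ρ t)).add_const (σ t)
  exact this.congr_of_eventuallyEq ((eventually_mem_inl hD hp).mono fun y hy => h.X_eq hy)

theorem Intertwines.isHeatSolution {V : ℝ → ℝ} {D O R : Set (ℝ × ℝ)} {X : ℝ → ℝ → ℝ} {T : ℝ → ℝ}
    {m W : ℝ → ℝ → ℝ} {ρ σ a b : ℝ → ℝ} (h : Intertwines V D X T m ρ σ a b) (hD : IsOpen D)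
    (hX : SmoothOn₂ D X) (hT : ContDiffOn ℝ ∞ (fun p : ℝ × ℝ => T p.2) D) (hm : SmoothOn₂ D m)
    (hR : IsOpen R) (hRD : R ⊆ D) (hO : IsOpen O) (hRO : ∀ x t, (x, t) ∈ R → (X x t, T t) ∈ O)
    (hW : IsHeatSolution V O W) : IsHeatSolution V R fun x t => m x t * W (X x t) (T t) := by
  obtain ⟨hW, hWe⟩ := hW
  have hs : SmoothOn₂ R fun x t => m x t * W (X x t) (T t) := by
    refine (hm.mono hRD).mul ?_
    exact hW.comp (f := fun p : ℝ × ℝ => (X p.1 p.2, T p.2))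
      ((hX.mono hRD).prodMk (hT.mono hRD)) fun p hp => hRO _ _ hp
  refine ⟨hs, fun x t hp => ?_⟩
  have hp' := hRD hp
  have d1 : ∀ y, (y, t) ∈ R → HasDerivAt (fun y => m y t * W (X y t) (T t))
      ((a t * y + b t) * m y t * W (X y t) (T t) + m y t * (dx W (X y t) (T t) * ρ t)) y := by
    intro y hy
    have := (h.m_x (hRD hy)).mul (hW.hasDerivAt_comp hO (h.X_x hD (hRD hy))
      (hasDerivAt_const y (T t)) (hRO y t hy))
    simp only [mul_zero, add_zero] at this
    exact this
  have d2 : dx (dx fun x t => m x t * W (X x t) (T t)) x t =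
      (a t * m x t + (a t * x + b t) ^ 2 * m x t) * W (X x t) (T t) +
        2 * ((a t * x + b t) * m x t * (dx W (X x t) (T t) * ρ t)) +
        m x t * (dx (dx W) (X x t) (T t) * ρ t ^ 2) := by
    have hl : HasDerivAt (fun y => a t * y + b t) (a t) x := by
      simpa using ((hasDerivAt_id x).const_mul (a t)).add_const (b t)
    have e := ((hl.mul (h.m_x hp')).mul (hW.hasDerivAt_comp hO (h.X_x hD hp')
      (hasDerivAt_const x (T t)) (hRO x t hp))).add ((h.m_x hp').mul
      (((hW.smooth_dx hO).hasDerivAt_comp hO (h.X_x hD hp')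
        (hasDerivAt_const x (T t)) (hRO x t hp)).mul_const (ρ t)))
    have ee : (fun y => dx (fun x t => m x t * W (X x t) (T t)) y t) =ᶠ[nhds x] fun y =>
        (a t * y + b t) * m y t * W (X y t) (T t) + m y t * (dx W (X y t) (T t) * ρ t) :=
      (eventually_mem_inl hR hp).mono fun z hz => (d1 z hz).deriv
    rw [dx, ee.deriv_eq]
    refine (HasDerivAt.deriv e).trans ?_
    simp only [Pi.mul_apply]
    ring
  have d3 := (h.m_t hp').mul (hW.hasDerivAt_comp hO (h.X_t hp') (h.T_t hp') (hRO x t hp))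
  rw [d2, dt]
  refine (HasDerivAt.deriv d3).trans ?_
  rw [hWe _ _ (hRO x t hp)]
  ring

/-- A transformation of the whole plane that satisfies the determining equations on its domain. -/
structure Transf.IsHeatSymmetry (V : ℝ → ℝ) (g : Transf) : Prop where
  isOpen : IsOpen g.dom
  smooth_X : SmoothOn₂ g.dom g.X
  smooth_T : ContDiffOn ℝ ∞ (fun p : ℝ × ℝ => g.T p.2) g.dom
  smooth_m : SmoothOn₂ g.dom g.m
  m_pos : ∀ x t, (x, t) ∈ g.dom → 0 < g.m x t
  intertwines : ∃ ρ σ a b, Intertwines V g.dom g.X g.T g.m ρ σ a b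

namespace Transf

theorem isOpen_region {g : Transf} {E : Set ℝ} (hd : IsOpen g.dom) (hX : SmoothOn₂ g.dom g.X)
    (hE : IsOpen E) : IsOpen (g.region E) := by
  have h1 : IsOpen (g.dom ∩ (fun p : ℝ × ℝ => g.X p.1 p.2) ⁻¹' E) :=
    hX.continuousOn.isOpen_inter_preimage hd hE
  have h2 : IsOpen {p : ℝ × ℝ | p.1 ∈ E} := hE.preimage continuous_fst
  have : g.region E = (g.dom ∩ (fun p : ℝ × ℝ => g.X p.1 p.2) ⁻¹' E) ∩ {p : ℝ × ℝ | p.1 ∈ E} := by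
    ext p; simp [region]; tauto
  rw [this]
  exact h1.inter h2

theorem IsHeatSymmetry.isSymmetry {V : ℝ → ℝ} {E : Set ℝ} {μ θ : ℝ → ℝ} {g : Transf}
    (hg : g.IsHeatSymmetry V) (h : IsDrift V E μ θ) (hE : IsOpen E) : g.IsSymmetry μ θ E := by
  intro O hO hOE U hU
  obtain ⟨ρ, σ, a, b, hi⟩ := hg.intertwines
  have hR : IsOpen (g.region E ∩ {p | (g.X p.1 p.2, g.T p.2) ∈ O}) := by
    have hr := isOpen_region hg.isOpen hg.smooth_X hE
    have hc : ContinuousOn (fun p : ℝ × ℝ => (g.X p.1 p.2, g.T p.2)) (g.region E) :=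
      (hg.smooth_X.continuousOn.prodMk hg.smooth_T.continuousOn).mono fun p hp => hp.1
    exact hc.isOpen_inter_preimage hr hO
  have hW : IsHeatSolution V O fun x t => U x t / θ x := by
    refine (h.isSolution_iff hE hO hOE fun x t hp => ?_).1 hU
    have := h.theta_ne (hOE hp).1
    field_simp
  refine (h.isSolution_iff hE hR (fun p hp => ⟨hp.1.2.1, trivial⟩) ?_).2
    (hi.isHeatSolution hg.isOpen hg.smooth_X hg.smooth_T hg.smooth_m hR (fun p hp => hp.1.1) hO
      (fun x t hp => hp.2) hW)
  intro x t hp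
  simp only [mult]
  ring

theorem IsHeatSymmetry.comp {V : ℝ → ℝ} {g₁ g₂ : Transf} (h₁ : g₁.IsHeatSymmetry V)
    (h₂ : g₂.IsHeatSymmetry V) : (g₁.comp g₂).IsHeatSymmetry V := by
  have hD : (g₁.comp g₂).dom =
      g₁.dom ∩ (fun p : ℝ × ℝ => (g₁.X p.1 p.2, g₁.T p.2)) ⁻¹' g₂.dom := rfl
  have hsm : ContDiffOn ℝ ∞ (fun p : ℝ × ℝ => (g₁.X p.1 p.2, g₁.T p.2)) (g₁.comp g₂).dom :=
    (h₁.smooth_X.prodMk h₁.smooth_T).mono fun p hp => hp.1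
  have hmaps : Set.MapsTo (fun p : ℝ × ℝ => (g₁.X p.1 p.2, g₁.T p.2)) (g₁.comp g₂).dom g₂.dom :=
    fun p hp => hp.2
  obtain ⟨ρ₁, σ₁, a₁, b₁, i₁⟩ := h₁.intertwines
  obtain ⟨ρ₂, σ₂, a₂, b₂, i₂⟩ := h₂.intertwines
  refine ⟨?_, ?_, ?_, ?_, ?_, ?_⟩
  · rw [hD]
    exact (h₁.smooth_X.continuousOn.prodMk h₁.smooth_T.continuousOn).isOpen_inter_preimage
      h₁.isOpen h₂.isOpen
  · exact h₂.smooth_X.comp hsm hmaps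
  · exact h₂.smooth_T.comp hsm hmaps
  · exact (h₁.smooth_m.mono fun p hp => hp.1).mul (h₂.smooth_m.comp hsm hmaps)
  · exact fun x t hp => mul_pos (h₁.m_pos x t hp.1) (h₂.m_pos _ _ hp.2)
  · refine ⟨fun t => ρ₂ (g₁.T t) * ρ₁ t, fun t => ρ₂ (g₁.T t) * σ₁ t + σ₂ (g₁.T t),
      fun t => a₁ t + ρ₁ t ^ 2 * a₂ (g₁.T t),
      fun t => b₁ t + ρ₁ t * (a₂ (g₁.T t) * σ₁ t + b₂ (g₁.T t)), ?_, ?_, ?_, ?_, ?_⟩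
    · intro x t hp
      simp only [Transf.comp]
      rw [i₂.X_eq hp.2, i₁.X_eq hp.1]
      ring
    · intro x t hp
      refine (h₂.smooth_X.hasDerivAt_comp h₂.isOpen (i₁.X_t hp.1) (i₁.T_t hp.1)
        hp.2).congr_deriv ?_
      rw [dx, dt, (i₂.X_x h₂.isOpen hp.2).deriv, (i₂.X_t hp.2).deriv, i₁.X_eq hp.1]
      ring
    · intro x t hp
      refine ((i₂.T_t hp.2).comp t (i₁.T_t hp.1)).congr_deriv ?_
      ring
    · intro x t hp
      refine ((i₁.m_x hp.1).mul (h₂.smooth_m.hasDerivAt_comp h₂.isOpen (i₁.X_x h₁.isOpen hp.1)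
        (hasDerivAt_const x (g₁.T t)) hp.2)).congr_deriv ?_
      rw [dx, (i₂.m_x hp.2).deriv, i₁.X_eq hp.1]
      simp only [Transf.comp, i₁.X_eq hp.1]
      ring
    · intro x t hp
      refine ((i₁.m_t hp.1).mul (h₂.smooth_m.hasDerivAt_comp h₂.isOpen (i₁.X_t hp.1)
        (i₁.T_t hp.1) hp.2)).congr_deriv ?_
      rw [dx, dt, (i₂.m_x hp.2).deriv, (i₂.m_t hp.2).deriv]
      simp only [Transf.comp]
      rw [i₁.X_eq hp.1]
      ring

end Transf

/-! ### The explicit transformations satisfy the determining equations -/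

/-- The determining equations for a multiplier `m = exp L`, in terms of `L`. -/
theorem Intertwines.of_exp {V : ℝ → ℝ} {D : Set (ℝ × ℝ)} {X : ℝ → ℝ → ℝ} {T : ℝ → ℝ}
    {m L : ℝ → ℝ → ℝ} {ρ σ a b : ℝ → ℝ} (hD : IsOpen D)
    (X_eq : ∀ {x t}, (x, t) ∈ D → X x t = ρ t * x + σ t)
    (X_t : ∀ {x t}, (x, t) ∈ D → HasDerivAt (fun s => X x s) (ρ t * (a t * x + b t)) t)
    (T_t : ∀ {x t}, (x, t) ∈ D → HasDerivAt T (ρ t ^ 2) t)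
    (hm : ∀ x t, (x, t) ∈ D → m x t = Real.exp (L x t))
    (L_x : ∀ {x t}, (x, t) ∈ D → HasDerivAt (fun y => L y t) (a t * x + b t) x)
    (L_t : ∀ {x t}, (x, t) ∈ D → HasDerivAt (fun s => L x s)
      (1 / 2 * (a t + (a t * x + b t) ^ 2) - 1 / 2 * V x + 1 / 2 * V (X x t) * ρ t ^ 2) t) :
    Intertwines V D X T m ρ σ a b where
  X_eq := X_eq
  X_t := X_t
  T_t := T_t
  m_x {x t} hp := by
    have := (L_x hp).exp.congr_of_eventuallyEq
      ((eventually_mem_inl hD hp).mono fun y hy => hm y t hy)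
    rwa [← hm x t hp, mul_comm] at this
  m_t {x t} hp := by
    have := (L_t hp).exp.congr_of_eventuallyEq
      ((eventually_mem_inr hD hp).mono fun y hy => hm x y hy)
    rwa [← hm x t hp, mul_comm] at this

/-- Homotheties with centre `-c` and slope `ρ`, for a potential that is a quadratic polynomial in
`x + c` plus an inverse square. With `h = -ρ'/ρ`, the determining equations reduce to
`h' + h² = A - A ρ⁴`, which is the Ermakov equation `r'' = A r - A / r³` for `r = 1 / ρ`. -/
theorem Intertwines.of_riccati {V : ℝ → ℝ} {D : Set (ℝ × ℝ)} {X : ℝ → ℝ → ℝ} {T : ℝ → ℝ}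
    {m : ℝ → ℝ → ℝ} {ρ h l : ℝ → ℝ} {A c C d : ℝ} (hD : IsOpen D)
    (hV : ∀ x, V x = A * (x + c) ^ 2 + 2 * C + d / (x + c) ^ 2)
    (hρ0 : ∀ {x t}, (x, t) ∈ D → ρ t ≠ 0)
    (hρ : ∀ {x t}, (x, t) ∈ D → HasDerivAt ρ (-h t * ρ t) t)
    (hh : ∀ {x t}, (x, t) ∈ D → HasDerivAt h (A - A * ρ t ^ 4 - h t ^ 2) t)
    (hT : ∀ {x t}, (x, t) ∈ D → HasDerivAt T (ρ t ^ 2) t)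
    (hl : ∀ {x t}, (x, t) ∈ D → HasDerivAt l (-h t / 2 + C * (ρ t ^ 2 - 1)) t)
    (hX : ∀ x t, X x t = ρ t * (x + c) - c)
    (hm : ∀ x t, (x, t) ∈ D → m x t = Real.exp (l t - h t / 2 * (x + c) ^ 2)) :
    Intertwines V D X T m ρ (fun t => ρ t * c - c) (fun t => -h t) fun t => -h t * c := by
  refine Intertwines.of_exp hD ?_ ?_ hT hm ?_ ?_
  · intro x t _
    rw [hX]
    ring
  · intro x t hp
    simp only [hX]
    refine (((hρ hp).mul_const (x + c)).sub_const c).congr_deriv ?_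
    ring
  · intro x t _
    refine ((((hasDerivAt_id x).add_const c).pow 2).const_mul (h t / 2)).const_sub (l t)
      |>.congr_deriv ?_
    simp
    ring
  · intro x t hp
    refine ((hl hp).sub (((hh hp).div_const 2).mul_const ((x + c) ^ 2))).congr_deriv ?_
    have h0 := hρ0 hp
    have hd : d / (ρ t * (x + c)) ^ 2 * ρ t ^ 2 = d / (x + c) ^ 2 := by
      rw [mul_pow]
      field_simp
    rw [hV, hV, hX]
    simp only [sub_add_cancel]
    linear_combination (-1 / 2 : ℝ) * hd

theorem hasDerivAt_div_sqrt {R : ℝ → ℝ} {R' t : ℝ} (k : ℝ) (hR : HasDerivAt R R' t)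
    (h : 0 < R t) :
    HasDerivAt (fun s => k / √(R s)) (-(R' / (2 * R t)) * (k / √(R t))) t := by
  have hs := Real.sqrt_pos.2 h
  refine ((hasDerivAt_const t k).div (hR.sqrt h.ne') hs.ne').congr_deriv ?_
  have := Real.sq_sqrt h.le
  generalize √(R t) = q at *
  rw [← this]
  field_simp
  simp

namespace Transf

theorem IsHeatSymmetry.const_mul {V : ℝ → ℝ} {g g' : Transf} (hg : g.IsHeatSymmetry V) {k : ℝ}
    (hk : 0 < k) (hd : g'.dom = g.dom) (hX : g'.X = g.X) (hT : g'.T = g.T)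
    (hm : ∀ x t, (x, t) ∈ g.dom → g'.m x t = k * g.m x t) : g'.IsHeatSymmetry V := by
  obtain ⟨dom', X', T', m'⟩ := g'
  obtain ⟨dom, X, T, m⟩ := g
  simp only at hd hX hT hm
  subst hd hX hT
  obtain ⟨ρ, σ, a, b, hi⟩ := hg.intertwines
  refine ⟨hg.isOpen, hg.smooth_X, hg.smooth_T,
    (contDiffOn_const.mul hg.smooth_m).congr fun p hp => hm _ _ hp, fun x t hp => ?_,
    ρ, σ, a, b, hi.X_eq, hi.X_t, hi.T_t, fun {x t} hp => ?_, fun {x t} hp => ?_⟩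
  · simp only [hm x t hp]
    exact mul_pos hk (hg.m_pos x t hp)
  · refine (((hi.m_x hp).const_mul k).congr_of_eventuallyEq
      ((eventually_mem_inl hg.isOpen hp).mono fun y hy => hm y t hy)).congr_deriv ?_
    simp only [hm x t hp]
    ring
  · refine (((hi.m_t hp).const_mul k).congr_of_eventuallyEq
      ((eventually_mem_inr hg.isOpen hp).mono fun y hy => hm x y hy)).congr_deriv ?_
    simp only [hm x t hp]
    ring

end Transf

theorem timeShift_isHeatSymmetry (V : ℝ → ℝ) (ε : ℝ) : (timeShift ε).IsHeatSymmetry V := by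
  refine ⟨isOpen_univ, contDiffOn_fst, by simp only [timeShift]; fun_prop, contDiffOn_const,
    fun _ _ _ => one_pos, fun _ => 1, fun _ => 0, fun _ => 0, fun _ => 0,
    Intertwines.of_exp (L := fun _ _ => 0) isOpen_univ ?_ ?_ ?_ ?_ ?_ ?_⟩ <;> intro x t _
  · simp [timeShift]
  · simpa [timeShift] using hasDerivAt_const t x
  · simpa [timeShift] using (hasDerivAt_id t).add_const ε
  · simp [timeShift]
  · simpa using hasDerivAt_const x (0 : ℝ)
  · simpa [timeShift] using hasDerivAt_const t (0 : ℝ)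

theorem rescale_isHeatSymmetry (V : ℝ → ℝ) (ε : ℝ) : (rescale ε).IsHeatSymmetry V := by
  refine ⟨isOpen_univ, contDiffOn_fst, contDiffOn_snd, contDiffOn_const,
    fun _ _ _ => Real.exp_pos ε, fun _ => 1, fun _ => 0, fun _ => 0, fun _ => 0,
    Intertwines.of_exp (L := fun _ _ => ε) isOpen_univ ?_ ?_ ?_ ?_ ?_ ?_⟩ <;> intro x t _
  · simp [rescale]
  · simpa [rescale] using hasDerivAt_const t x
  · simpa [rescale] using hasDerivAt_id' t
  · simp [rescale]
  · simpa using hasDerivAt_const x ε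
  · simpa [rescale] using hasDerivAt_const t ε

theorem hasDerivAt_one_add_mul (k t : ℝ) : HasDerivAt (fun s => 1 + k * s) k t := by
  simpa using ((hasDerivAt_id t).const_mul k).const_add 1

theorem isOpen_one_add_mul_pos (k : ℝ) : IsOpen {p : ℝ × ℝ | 0 < 1 + k * p.2} :=
  isOpen_lt continuous_const (by fun_prop)

theorem F3.two1_isHeatSymmetry (C D : ℝ) {α : ℝ} (hα : 0 < α) (β : ℝ) :
    (F3.two1 C α β).IsHeatSymmetry fun x => 2 * C + D / x ^ 2 := by
  have hne : ∀ p ∈ (F3.two1 C α β).dom, (1 + α * β * p.2) ≠ 0 := fun p hp => ne_of_gt hp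
  have hne' : ∀ p ∈ (F3.two1 C α β).dom, √(1 + α * β * p.2) ≠ 0 := fun p hp =>
    (Real.sqrt_pos.2 hp).ne'
  have hsq : ContDiffOn ℝ ∞ (fun p : ℝ × ℝ => √(1 + α * β * p.2)) (F3.two1 C α β).dom :=
    ContDiffOn.sqrt (by fun_prop) hne
  have hO : IsOpen (F3.two1 C α β).dom := isOpen_one_add_mul_pos _
  refine ⟨hO, ?_, ?_, ?_, ?_, ?_⟩
  · exact ContDiffOn.div (by fun_prop) (by fun_prop) hne
  · exact ContDiffOn.div (by fun_prop) (by fun_prop) hne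
  · refine ContDiffOn.div (ContDiffOn.exp (ContDiffOn.add ?_ ?_)) hsq hne'
    · refine ContDiffOn.div (by fun_prop) (by fun_prop) fun p hp => ?_
      have := hne p hp
      positivity
    · exact ContDiffOn.mul (by fun_prop)
        ((ContDiffOn.div (by fun_prop) (by fun_prop) hne).sub contDiffOn_const)
  · intro x t hp
    exact div_pos (Real.exp_pos _) (Real.sqrt_pos.2 hp)
  · refine ⟨_, _, _, _, Intertwines.of_riccati (A := 0) (c := 0) (C := C) (d := D)
      (ρ := fun t => α / (1 + α * β * t)) (h := fun t => α * β / (1 + α * β * t))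
      (l := fun t => C * (α ^ 2 * t / (1 + α * β * t) - t) - Real.log (1 + α * β * t) / 2)
      hO (fun x => by simp) ?_ ?_ ?_ ?_ ?_ ?_ ?_⟩
    · intro x t hp
      exact (div_pos hα hp).ne'
    · intro x t hp
      have h0 := hne _ hp
      refine ((hasDerivAt_const t α).div (hasDerivAt_one_add_mul _ t) h0).congr_deriv ?_
      field_simp
      ring
    · intro x t hp
      have h0 := hne _ hp
      refine ((hasDerivAt_const t (α * β)).div (hasDerivAt_one_add_mul _ t) h0).congr_deriv ?_
      field_simp
      ring
    · intro x t hp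
      have h0 := hne _ hp
      refine (((hasDerivAt_id t).const_mul (α ^ 2)).div
        (hasDerivAt_one_add_mul _ t) h0).congr_deriv ?_
      simp only [id]
      field_simp
      ring
    · intro x t hp
      have h0 := hne _ hp
      refine ((((((hasDerivAt_id t).const_mul (α ^ 2)).div
        (hasDerivAt_one_add_mul _ t) h0).sub (hasDerivAt_id t)).const_mul C).sub
        (((hasDerivAt_one_add_mul _ t).log h0).div_const 2)).congr_deriv ?_
      simp only [id]
      field_simp
      ring
    · intro x t
      simp only [F3.two1]
      ring
    · intro x t hp
      have hp' : 0 < 1 + α * β * t := hp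
      simp only [F3.two1]
      rw [Real.sqrt_eq_rpow, Real.rpow_def_of_pos hp', ← Real.exp_sub]
      congr 1
      field_simp
      ring

theorem F3.scaling_isHeatSymmetry (C D ε : ℝ) :
    (F3.scaling C ε).IsHeatSymmetry fun x => 2 * C + D / x ^ 2 := by
  have hsq : Real.exp (-ε / 2) ^ 2 = Real.exp (-ε) := by
    rw [← Real.exp_nat_mul]
    congr 1
    push_cast
    ring
  refine (F3.two1_isHeatSymmetry C D (Real.exp_pos (-ε / 2)) 0).const_mul one_pos ?_ ?_ ?_ ?_
  · simp [F3.two1, F3.scaling]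
  · funext x t
    simp [F3.two1, F3.scaling, mul_comm]
  · funext t
    simp [F3.two1, F3.scaling, hsq, mul_comm]
  · intro x t _
    simp [F3.two1, F3.scaling, hsq]

theorem F1.two1_isHeatSymmetry (B C : ℝ) {α : ℝ} (hα : α ≠ 0) (β : ℝ) :
    (F1.two1 B C α β).IsHeatSymmetry fun x => 4 * B * x + 2 * C := by
  have hne : ∀ p ∈ (F1.two1 B C α β).dom, (1 + α * β * p.2) ≠ 0 := fun p hp => ne_of_gt hp
  have hne' : ∀ p ∈ (F1.two1 B C α β).dom, √(1 + α * β * p.2) ≠ 0 := fun p hp =>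
    (Real.sqrt_pos.2 hp).ne'
  have hsq : ContDiffOn ℝ ∞ (fun p : ℝ × ℝ => √(1 + α * β * p.2)) (F1.two1 B C α β).dom :=
    ContDiffOn.sqrt (by fun_prop) hne
  have hO : IsOpen (F1.two1 B C α β).dom := isOpen_one_add_mul_pos _
  have hX : SmoothOn₂ (F1.two1 B C α β).dom (F1.two1 B C α β).X :=
    (ContDiffOn.div (by fun_prop) (by fun_prop) hne).add
      (ContDiffOn.div (by fun_prop) (by fun_prop) fun p hp => pow_ne_zero 2 (hne p hp))
  have hT : ContDiffOn ℝ ∞ (fun p : ℝ × ℝ => (F1.two1 B C α β).T p.2) (F1.two1 B C α β).dom :=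
    ContDiffOn.div (by fun_prop) (by fun_prop) hne
  have hQ : ContDiff ℝ ∞ fun p : ℝ × ℝ => F1.Q B C p.1 p.2 := by
    simp only [F1.Q]
    fun_prop
  refine ⟨hO, hX, hT, ?_, ?_, ?_⟩
  · refine ((contDiffOn_const.div hsq hne').mul (ContDiffOn.exp ?_)).mul
      (ContDiffOn.div (ContDiffOn.exp hQ.contDiffOn) (ContDiffOn.exp ?_)
        fun p _ => (Real.exp_pos _).ne')
    · refine ContDiffOn.div (by fun_prop) (by fun_prop) fun p hp => ?_
      have := hne p hp
      positivity
    · exact hQ.comp_contDiffOn (hX.prodMk hT)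
  · intro x t hp
    have := Real.sqrt_pos.2 (show 0 < 1 + α * β * t from hp)
    simp only [F1.two1]
    positivity
  · have dX : ∀ {x t}, 0 < 1 + α * β * t → HasDerivAt (fun s =>
        α * (x - B * s ^ 2) / (1 + α * β * s) + B * α ^ 4 * s ^ 2 / (1 + α * β * s) ^ 2)
        (-2 * α * B * t / (1 + α * β * t) - α ^ 2 * β * (x - B * t ^ 2) / (1 + α * β * t) ^ 2 +
          2 * B * α ^ 4 * t / (1 + α * β * t) ^ 3) t := by
      intro x t hp
      have h0 := hp.ne'
      have h1 := hasDerivAt_one_add_mul (α * β) t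
      refine ((((((hasDerivAt_id t).pow 2).const_mul B).const_sub x).const_mul α).div h1 h0).add
        ((((hasDerivAt_id t).pow 2).const_mul (B * α ^ 4)).div (h1.pow 2)
          (pow_ne_zero 2 h0)) |>.congr_deriv ?_
      simp only [id, Pi.pow_apply]
      field_simp
      ring
    have dT : ∀ {t}, 0 < 1 + α * β * t → HasDerivAt (fun s => α ^ 2 * s / (1 + α * β * s))
        ((α / (1 + α * β * t)) ^ 2) t := by
      intro t hp
      have h0 := hp.ne'
      refine (((hasDerivAt_id t).const_mul (α ^ 2)).div
        (hasDerivAt_one_add_mul _ t) h0).congr_deriv ?_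
      simp only [id]
      field_simp
      ring
    have hQc : ∀ {X T : ℝ → ℝ} {X' T' s : ℝ}, HasDerivAt X X' s → HasDerivAt T T' s →
        HasDerivAt (fun s => F1.Q B C (X s) (T s)) (-2 * B * T s * X' +
          (-2 * B * X s + 2 * B ^ 2 * T s ^ 2 - C) * T') s := by
      intro X T X' T' s hX hT
      refine ((((hX.const_mul (-2 * B)).mul hT).add (((hT.pow 3).const_mul (2 * B ^ 2)).div_const
        3)).sub (hT.const_mul C)).congr_deriv ?_
      push_cast
      ring
    refine ⟨fun t => α / (1 + α * β * t),
      fun t => -α * B * t ^ 2 / (1 + α * β * t) + B * α ^ 4 * t ^ 2 / (1 + α * β * t) ^ 2,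
      fun t => -(α * β) / (1 + α * β * t),
      fun t => α * β * B * t ^ 2 / (1 + α * β * t) - 2 * B * t
        + 2 * B * α ^ 3 * t / (1 + α * β * t) ^ 2,
      Intertwines.of_exp (L := fun x t => Real.log |α| - Real.log (1 + α * β * t) / 2 -
        α * β * (x - B * t ^ 2) ^ 2 / (2 * (1 + α * β * t)) + F1.Q B C x t -
        F1.Q B C ((F1.two1 B C α β).X x t) ((F1.two1 B C α β).T t)) hO ?_ ?_ ?_ ?_ ?_ ?_⟩
    · intro x t hp
      simp only [F1.two1]
      ring
    · intro x t hp
      have h0 : 1 + α * β * t ≠ 0 := hne _ hp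
      simp only [F1.two1]
      refine (dX hp).congr_deriv ?_
      have h1 : 1 + α * t * β ≠ 0 := by rwa [mul_right_comm]
      field_simp
      ring
    · intro x t hp
      exact dT hp
    · intro x t hp
      have hp' : 0 < 1 + α * β * t := hp
      simp only [F1.two1]
      rw [Real.sqrt_eq_rpow, Real.rpow_def_of_pos hp', ← Real.exp_sub]
      nth_rw 1 [← Real.exp_log (abs_pos.2 hα)]
      rw [← Real.exp_sub, ← Real.exp_add, ← Real.exp_add]
      congr 1
      ring
    · intro x t hp
      have h0 := hne _ hp
      have hXx : HasDerivAt (fun y => (F1.two1 B C α β).X y t) (α / (1 + α * β * t)) x := by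
        simp only [F1.two1]
        refine ((((hasDerivAt_id x).sub_const (B * t ^ 2)).const_mul α).div_const _).add_const _
          |>.congr_deriv ?_
        ring
      refine ((((((hasDerivAt_id x).sub_const (B * t ^ 2)).pow 2).const_mul
        (α * β)).div_const (2 * (1 + α * β * t))).const_sub
        (Real.log |α| - Real.log (1 + α * β * t) / 2)).add
        (hQc (hasDerivAt_id x) (hasDerivAt_const x t)) |>.sub
        (hQc hXx (hasDerivAt_const x ((F1.two1 B C α β).T t))) |>.congr_deriv ?_
      simp only [F1.two1, id] at h0 ⊢
      field_simp
      ring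
    · intro x t hp
      have h0 := hne _ hp
      have h1 := hasDerivAt_one_add_mul (α * β) t
      refine (((h1.log h0).div_const 2).const_sub (Real.log |α|)).sub
        (((((((hasDerivAt_id t).pow 2).const_mul B).const_sub x).pow 2).const_mul
          (α * β)).div (h1.const_mul 2) (mul_ne_zero two_ne_zero h0)) |>.add
        (hQc (hasDerivAt_const t x) (hasDerivAt_id t)) |>.sub
        (hQc (dX (x := x) hp) (dT hp)) |>.congr_deriv ?_
      simp only [F1.two1, id, Pi.pow_apply] at h0 ⊢
      field_simp
      ring

theorem F1.two2_isHeatSymmetry (B C α β : ℝ) :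
    (F1.two2 B α β).IsHeatSymmetry fun x => 4 * B * x + 2 * C := by
  refine ⟨isOpen_univ, by simp only [F1.two2, SmoothOn₂]; fun_prop, contDiffOn_snd,
    by simp only [F1.two2, SmoothOn₂]; fun_prop, fun x t _ => Real.exp_pos _, fun _ => 1,
    fun t => -α - β * t, fun _ => 0, fun _ => -β,
    Intertwines.of_exp (L := fun x t => -2 * α * B * t - β * (x + B * t ^ 2) + β ^ 2 * t / 2)
      isOpen_univ ?_ ?_ ?_ ?_ ?_ ?_⟩ <;> intro x t _
  · simp only [F1.two2]
    ring
  · refine (((hasDerivAt_id t).const_mul β).const_sub (x - α)).congr_deriv ?_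
    ring
  · simpa [F1.two2] using hasDerivAt_id' t
  · rfl
  · refine ((((hasDerivAt_id x).add_const (B * t ^ 2)).const_mul β).const_sub _).add_const _
      |>.congr_deriv ?_
    ring
  · refine (((hasDerivAt_id t).const_mul (-2 * α * B)).sub
      ((((hasDerivAt_id t).pow 2).const_mul B).const_add x |>.const_mul β)).add
      (((hasDerivAt_id t).const_mul (β ^ 2)).div_const 2) |>.congr_deriv ?_
    simp only [F1.two2, id]
    push_cast
    ring

theorem F1.spaceShift_eq (B ε : ℝ) : F1.spaceShift B ε = F1.two2 B ε 0 := by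
  simp only [F1.spaceShift, F1.two2, Transf.mk.injEq, true_and]
  refine ⟨by simp, ?_⟩
  funext x t
  rw [← Real.exp_sub]
  congr 1
  ring

theorem F1.scaling_isHeatSymmetry (B C ε : ℝ) :
    (F1.scaling B C ε).IsHeatSymmetry fun x => 4 * B * x + 2 * C := by
  have h2 : Real.exp (-ε) = Real.exp (-ε / 2) ^ 2 := by
    rw [← Real.exp_nat_mul]
    congr 1
    push_cast
    ring
  have h4 : Real.exp (-2 * ε) = Real.exp (-ε / 2) ^ 4 := by
    rw [← Real.exp_nat_mul]
    congr 1
    push_cast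
    ring
  have h0 := Real.exp_pos (-ε / 2)
  refine (F1.two1_isHeatSymmetry B C h0.ne' 0).const_mul (inv_pos.2 (abs_pos.2 h0.ne')) ?_ ?_ ?_ ?_
  · simp [F1.two1, F1.scaling]
  · funext x t
    simp only [F1.two1, F1.scaling, h4]
    ring
  · funext t
    simp only [F1.two1, F1.scaling, h2]
    ring
  · intro x t _
    have : |Real.exp (-ε / 2)| ≠ 0 := by positivity
    simp only [F1.two1, F1.scaling, h2, h4, mul_zero, zero_mul, add_zero, Real.sqrt_one, div_one,
      one_pow, neg_zero, zero_div, Real.exp_zero, mul_one]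
    rw [inv_mul_cancel_left₀ this]
    ring_nf

/-! ### The explicit transformations for a positive quadratic term -/

section F24

variable {V : ℝ → ℝ} {a c ν d : ℝ}

theorem hasDerivAt_exp_mul (k t : ℝ) :
    HasDerivAt (fun s => Real.exp (k * s)) (k * Real.exp (k * t)) t := by
  simpa [mul_comm] using ((hasDerivAt_id t).const_mul k).exp

theorem F24.one_add_pos {a σ ε t : ℝ} (h : 0 < ε + Real.exp (-σ * (2 * a * t))) :
    0 < 1 + ε * Real.exp (σ * (2 * a * t)) := by
  have e : Real.exp (-σ * (2 * a * t)) * Real.exp (σ * (2 * a * t)) = 1 := by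
    rw [← Real.exp_add]
    simp
  nlinarith [Real.exp_pos (σ * (2 * a * t)), mul_pos h (Real.exp_pos (σ * (2 * a * t)))]

theorem F24.inv_isHeatSymmetry (ha : 0 < a)
    (hV : ∀ x, V x = a ^ 2 * (x + c) ^ 2 + 2 * (-2 * a * (ν + 1 / 4)) + d / (x + c) ^ 2)
    {σ : ℝ} (hσ : σ ^ 2 = 1) (ε : ℝ) : (F24.inv a c ν σ ε).IsHeatSymmetry V := by
  have hO : IsOpen (F24.inv a c ν σ ε).dom := isOpen_lt continuous_const (by fun_prop)
  have hpos : ∀ p ∈ (F24.inv a c ν σ ε).dom, 0 < 1 + ε * Real.exp (σ * (2 * a * p.2)) :=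
    fun p hp => F24.one_add_pos hp
  have hsq : ContDiffOn ℝ ∞ (fun p : ℝ × ℝ => √(1 + ε * Real.exp (σ * (2 * a * p.2))))
      (F24.inv a c ν σ ε).dom :=
    ContDiffOn.sqrt (by fun_prop) fun p hp => (hpos p hp).ne'
  have hne' : ∀ p ∈ (F24.inv a c ν σ ε).dom, √(1 + ε * Real.exp (σ * (2 * a * p.2))) ≠ 0 :=
    fun p hp => (Real.sqrt_pos.2 (hpos p hp)).ne'
  have hX : SmoothOn₂ (F24.inv a c ν σ ε).dom (F24.inv a c ν σ ε).X :=
    (ContDiffOn.div (by fun_prop) hsq hne').sub contDiffOn_const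
  have hT : ContDiffOn ℝ ∞ (fun p : ℝ × ℝ => (F24.inv a c ν σ ε).T p.2)
      (F24.inv a c ν σ ε).dom := by
    refine contDiffOn_const.mul ((ContDiffOn.log (by fun_prop) fun p hp => ?_).div_const _)
    exact ne_of_gt hp
  have dR : ∀ t, HasDerivAt (fun t => 1 + ε * Real.exp (σ * (2 * a * t)))
      (2 * (σ * a) * (ε * Real.exp (σ * (2 * a * t)))) t := by
    intro t
    have := ((hasDerivAt_exp_mul (σ * (2 * a)) t).const_mul ε).const_add 1
    simp only [mul_assoc] at this ⊢
    refine this.congr_deriv ?_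
    ring
  have hq : ∀ {x t}, (x, t) ∈ (F24.inv a c ν σ ε).dom →
      (1 / √(1 + ε * Real.exp (σ * (2 * a * t)))) ^ 2 =
        1 / (1 + ε * Real.exp (σ * (2 * a * t))) := by
    intro x t hp
    rw [div_pow, one_pow, Real.sq_sqrt (hpos _ hp).le]
  have dT : ∀ {x t}, (x, t) ∈ (F24.inv a c ν σ ε).dom → HasDerivAt (F24.inv a c ν σ ε).T
      ((1 / √(1 + ε * Real.exp (σ * (2 * a * t)))) ^ 2) t := by
    intro x t hp
    have hp1 : 0 < ε + Real.exp (-σ * (2 * a * t)) := hp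
    have hp2 := hpos _ hp
    have e : Real.exp (-σ * (2 * a * t)) * Real.exp (σ * (2 * a * t)) = 1 := by
      rw [← Real.exp_add]
      simp
    have d1 : HasDerivAt (fun t => ε + Real.exp (-σ * (2 * a * t)))
        (-(σ * (2 * a)) * Real.exp (-σ * (2 * a * t))) t := by
      have := (hasDerivAt_exp_mul (-σ * (2 * a)) t).const_add ε
      simp only [mul_assoc] at this ⊢
      refine this.congr_deriv ?_
      ring
    rw [hq hp]
    refine (((d1.log hp1.ne').div_const (2 * a)).const_mul (-σ)).congr_deriv ?_
    have e2 : 1 + ε * Real.exp (σ * (2 * a * t)) =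
        Real.exp (σ * (2 * a * t)) * (ε + Real.exp (-σ * (2 * a * t))) := by
      linear_combination -e
    have h1 := Real.exp_pos (σ * (2 * a * t))
    rw [e2]
    generalize Real.exp (σ * (2 * a * t)) = u at *
    generalize Real.exp (-σ * (2 * a * t)) = v at *
    field_simp
    linear_combination u * v * hσ + e
  refine ⟨hO, hX, hT, ?_, ?_, _, _, _, _, Intertwines.of_riccati (A := a ^ 2) (c := c)
    (C := -2 * a * (ν + 1 / 4)) (d := d)
    (ρ := fun t => 1 / √(1 + ε * Real.exp (σ * (2 * a * t))))
    (h := fun t => σ * a - σ * a / (1 + ε * Real.exp (σ * (2 * a * t))))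
    (l := fun t => 2 * a * (ν + 1 / 4 - σ / 4) * (t - (F24.inv a c ν σ ε).T t))
    hO hV ?_ ?_ ?_ ?_ ?_ ?_ ?_⟩
  · refine ContDiffOn.div (by fun_prop) (ContDiffOn.exp ?_) fun p _ => (Real.exp_pos _).ne'
    exact (contDiffOn_const.mul hT).sub (contDiffOn_const.mul ((hX.add contDiffOn_const).pow 2))
  · intro x t _
    exact div_pos (Real.exp_pos _) (Real.exp_pos _)
  · intro x t hp
    have := hne' _ hp
    exact one_div_ne_zero this
  · intro x t hp
    have := hpos _ hp
    refine (hasDerivAt_div_sqrt 1 (dR t) this).congr_deriv ?_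
    simp only at this
    congr 1
    generalize Real.exp (σ * (2 * a * t)) = e at *
    field_simp
    ring
  · intro x t hp
    have h0 := (hpos _ hp).ne'
    have h4 : (1 / √(1 + ε * Real.exp (σ * (2 * a * t)))) ^ 4 =
        (1 / (1 + ε * Real.exp (σ * (2 * a * t)))) ^ 2 := by
      rw [← hq hp]
      ring
    refine (((hasDerivAt_const t (σ * a)).div (dR t) h0).const_sub (σ * a)).congr_deriv ?_
    rw [h4]
    simp only at h0
    generalize Real.exp (σ * (2 * a * t)) = e at *
    field_simp
    linear_combination a ^ 2 * (2 * ε * e + ε ^ 2 * e ^ 2) * hσ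
  · intro x t hp
    exact dT hp
  · intro x t hp
    refine (((hasDerivAt_id t).sub (dT hp)).const_mul _).congr_deriv ?_
    rw [hq hp]
    ring
  · intro x t
    simp only [F24.inv]
    ring
  · intro x t hp
    have hq' := hq hp
    simp only [F24.inv]
    rw [← Real.exp_sub]
    congr 1
    rw [sub_add_cancel, div_eq_mul_one_div (x + c), mul_pow, hq']
    ring

theorem F24.two1_isHeatSymmetry (ha : 0 < a)
    (hV : ∀ x, V x = a ^ 2 * (x + c) ^ 2 + 2 * (-2 * a * (ν + 1 / 4)) + d / (x + c) ^ 2)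
    {α β : ℝ} (hαβ : 0 < α + β + 1) : (F24.two1 a c ν α β).IsHeatSymmetry V := by
  have cm : Continuous (F24.Tminus a α β) := by unfold F24.Tminus; fun_prop
  have cp : Continuous (F24.Tplus a α β) := by unfold F24.Tplus; fun_prop
  have sm : ContDiff ℝ ∞ fun p : ℝ × ℝ => F24.Tminus a α β p.2 := by unfold F24.Tminus; fun_prop
  have sp : ContDiff ℝ ∞ fun p : ℝ × ℝ => F24.Tplus a α β p.2 := by unfold F24.Tplus; fun_prop
  have hO : IsOpen (F24.two1 a c ν α β).dom :=
    (isOpen_lt continuous_const (cm.comp continuous_snd)).inter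
      (isOpen_lt continuous_const (cp.comp continuous_snd))
  have hm : ∀ p ∈ (F24.two1 a c ν α β).dom, 0 < F24.Tminus a α β p.2 := fun p hp => hp.1
  have hp : ∀ p ∈ (F24.two1 a c ν α β).dom, 0 < F24.Tplus a α β p.2 := fun p hp => hp.2
  have hR : ∀ p ∈ (F24.two1 a c ν α β).dom, 0 < F24.Tplus a α β p.2 * F24.Tminus a α β p.2 :=
    fun p h => mul_pos h.2 h.1
  have dm : ∀ t, HasDerivAt (F24.Tminus a α β) (-(2 * a) * (F24.Tminus a α β t - (β + 1))) t := by
    intro t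
    have := ((hasDerivAt_exp_mul (-(2 * a)) t).const_mul α).const_add (β + 1)
    simp only [neg_mul] at this
    refine this.congr_deriv ?_
    simp only [F24.Tminus]
    ring
  have dp : ∀ t, HasDerivAt (F24.Tplus a α β) (2 * a * (F24.Tplus a α β t - (α + 1))) t := by
    intro t
    have := ((hasDerivAt_exp_mul (2 * a) t).const_mul β).const_add (α + 1)
    refine this.congr_deriv ?_
    simp only [F24.Tplus]
    ring
  have hq : ∀ {x t}, (x, t) ∈ (F24.two1 a c ν α β).dom →
      (√(α + β + 1) / √(F24.Tplus a α β t * F24.Tminus a α β t)) ^ 2 =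
        (β + 1) / F24.Tminus a α β t + (α + 1) / F24.Tplus a α β t - 1 := by
    intro x t h
    have h1 := (hm _ h).ne'
    have h2 := (hp _ h).ne'
    rw [div_pow, Real.sq_sqrt (hR _ h).le, Real.sq_sqrt hαβ.le]
    -- The two differences are `β exp (2 a t)` and `α exp (-2 a t)`.
    have e : (F24.Tplus a α β t - (α + 1)) * (F24.Tminus a α β t - (β + 1)) = α * β := by
      have : Real.exp (2 * a * t) * Real.exp (-(2 * a * t)) = 1 := by
        rw [← Real.exp_add]
        simp
      simp only [F24.Tplus, F24.Tminus]
      linear_combination α * β * this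
    simp only at h1 h2
    field_simp
    linear_combination e
  refine ⟨hO, ?_, ?_, ?_, ?_, _, _, _, _, Intertwines.of_riccati (A := a ^ 2) (c := c)
    (C := -2 * a * (ν + 1 / 4)) (d := d)
    (ρ := fun t => √(α + β + 1) / √(F24.Tplus a α β t * F24.Tminus a α β t))
    (h := fun t => a * ((β + 1) / F24.Tminus a α β t - (α + 1) / F24.Tplus a α β t))
    (l := fun t => ν * Real.log (F24.Tplus a α β t)
      - (ν + 1 / 2) * Real.log (F24.Tminus a α β t))
    hO hV ?_ ?_ ?_ ?_ ?_ ?_ ?_⟩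
  · refine (ContDiffOn.div (by fun_prop) (ContDiffOn.sqrt (sp.mul sm).contDiffOn fun p h =>
      (hR p h).ne') fun p h => (Real.sqrt_pos.2 (hR p h)).ne').sub contDiffOn_const
  · refine contDiffOn_snd.add ((ContDiffOn.log (sm.contDiffOn.div sp.contDiffOn fun p h =>
      (hp p h).ne') fun p h => (div_pos (hm p h) (hp p h)).ne').div_const _)
  · refine ContDiffOn.div (ContDiffOn.exp (ContDiffOn.div ?_ ?_ fun p h => ?_))
      ((sp.contDiffOn.rpow_const_of_ne fun p h => (hp p h).ne').mul
        (sm.contDiffOn.rpow_const_of_ne fun p h => (hm p h).ne')) fun p h => ?_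
    · fun_prop
    · fun_prop
    · have := hm p h
      have := hp p h
      positivity
    · have := hm p h
      have := hp p h
      positivity
  · intro x t h
    have := hm _ h
    have := hp _ h
    simp only at *
    simp only [F24.two1]
    positivity
  · intro x t h
    exact (div_pos (Real.sqrt_pos.2 hαβ) (Real.sqrt_pos.2 (hR _ h))).ne'
  · intro x t h
    have h1 := (hm _ h).ne'
    have h2 := (hp _ h).ne'
    refine (hasDerivAt_div_sqrt _ ((dp t).mul (dm t)) (hR _ h)).congr_deriv ?_
    simp only [Pi.mul_apply] at h1 h2 ⊢
    congr 1
    field_simp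
    ring
  · intro x t h
    have h1 := (hm _ h).ne'
    have h2 := (hp _ h).ne'
    have h4 : (√(α + β + 1) / √(F24.Tplus a α β t * F24.Tminus a α β t)) ^ 4 =
        ((β + 1) / F24.Tminus a α β t + (α + 1) / F24.Tplus a α β t - 1) ^ 2 := by
      rw [← hq h]
      ring
    refine ((((hasDerivAt_const t (β + 1)).div (dm t) h1).sub
      ((hasDerivAt_const t (α + 1)).div (dp t) h2)).const_mul a).congr_deriv ?_
    rw [h4]
    simp only at h1 h2 ⊢
    field_simp
    ring
  · intro x t h
    have h1 := (hm _ h).ne'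
    have h2 := (hp _ h).ne'
    rw [hq h]
    refine ((hasDerivAt_id t).add (((dm t).div (dp t) h2).log (div_ne_zero h1 h2)
      |>.div_const (2 * a))).congr_deriv ?_
    simp only [Pi.div_apply] at h1 h2 ⊢
    field_simp
    ring
  · intro x t h
    have h1 := (hm _ h).ne'
    have h2 := (hp _ h).ne'
    rw [hq h]
    refine ((((dp t).log h2).const_mul ν).sub (((dm t).log h1).const_mul
      (ν + 1 / 2))).congr_deriv ?_
    simp only at h1 h2 ⊢
    field_simp
    ring
  · intro x t
    simp only [F24.two1]
    ring
  · intro x t h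
    have h1 := hm _ h
    have h2 := hp _ h
    simp only [F24.two1] at h1 h2 ⊢
    rw [Real.rpow_def_of_pos h1, Real.rpow_def_of_pos h2, ← Real.exp_add, ← Real.exp_sub]
    congr 1
    field_simp
    ring

theorem F24.two2_isHeatSymmetry {C : ℝ}
    (hV : ∀ x, V x = a ^ 2 * (x + c) ^ 2 + 2 * C) (α β : ℝ) :
    (F24.two2 a c α β).IsHeatSymmetry V := by
  set D : ℝ → ℝ := fun t => α * Real.exp (a * t) + β * Real.exp (-(a * t)) with hD
  set D' : ℝ → ℝ := fun t => a * (α * Real.exp (a * t) - β * Real.exp (-(a * t))) with hD'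
  have e2 : ∀ t, HasDerivAt (fun t => Real.exp (-(a * t))) (-a * Real.exp (-(a * t))) t := by
    intro t
    simpa using hasDerivAt_exp_mul (-a) t
  have dD : ∀ t, HasDerivAt D (D' t) t := fun t =>
    (((hasDerivAt_exp_mul a t).const_mul α).add ((e2 t).const_mul β)).congr_deriv (by
      simp only [hD']
      ring)
  have dD' : ∀ t, HasDerivAt D' (a ^ 2 * D t) t := fun t =>
    ((((hasDerivAt_exp_mul a t).const_mul α).sub ((e2 t).const_mul β)).const_mul a).congr_deriv (by
      simp only [hD]
      ring)
  refine ⟨isOpen_univ, by simp only [F24.two2, SmoothOn₂]; fun_prop, contDiffOn_snd, ?_,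
    fun x t _ => div_pos (Real.exp_pos _) (Real.exp_pos _), fun _ => 1,
    fun t => -D t, fun _ => 0, fun t => -D' t,
    Intertwines.of_exp (L := fun x t => -(1 / 2) * (D' t * (2 * (x + c) - D t)))
      isOpen_univ ?_ ?_ ?_ ?_ ?_ ?_⟩
  · refine ContDiffOn.div ?_ ?_ fun p _ => (Real.exp_pos _).ne'
    · fun_prop
    · simp only [F24.two2]
      fun_prop
  all_goals intro x t _
  · simp only [F24.two2, hD]
    ring
  · refine ((dD t).const_sub x).congr_of_eventuallyEq (Filter.Eventually.of_forall fun s => ?_)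
      |>.congr_deriv ?_
    · simp only [F24.two2, hD]
      ring
    · ring
  · simpa [F24.two2] using hasDerivAt_id' t
  · simp only [F24.two2, hD, hD']
    rw [← Real.exp_sub]
    congr 1
    ring
  · refine ((((((hasDerivAt_id x).add_const c).const_mul 2).sub_const (D t)).const_mul
      (D' t)).const_mul (-(1 / 2))).congr_deriv ?_
    ring
  · refine ((((dD' t).mul ((dD t).const_sub (2 * (x + c)))).const_mul (-(1 / 2)))).congr_deriv ?_
    have : (F24.two2 a c α β).X x t = x - D t := by
      simp only [F24.two2, hD]
      ring
    rw [this, hV, hV]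
    ring

theorem F24.shift_one_eq (a c ε : ℝ) : F24.shift a c 1 ε = F24.two2 a c ε 0 := by
  simp [F24.shift, F24.two2, mul_assoc]

theorem F24.shift_neg_one_eq (a c ε : ℝ) : F24.shift a c (-1) ε = F24.two2 a c 0 ε := by
  simp [F24.shift, F24.two2, mul_assoc]

end F24

/-! ### One-parameter groups and their generators -/

/-- `S` is a local one-parameter group acting on `(x, t)` and on the factor `m`, whose derivatives
in the group parameter at `0` are `ξ`, `τ` and `-g`. -/
structure HasGenerator (S : ℝ → Transf) (ξ : ℝ → ℝ → ℝ) (τ : ℝ → ℝ) (g : ℝ → ℝ → ℝ) : Prop where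
  interval : ∀ x t, {ε : ℝ | (x, t) ∈ (S ε).dom}.OrdConnected
  zero : (S 0).dom = Set.univ ∧ ∀ x t, (S 0).X x t = x ∧ (S 0).T t = t ∧ (S 0).m x t = 1
  add : ∀ ε δ x t, (x, t) ∈ (S ε).dom → ((S ε).X x t, (S ε).T t) ∈ (S δ).dom →
    (x, t) ∈ (S (ε + δ)).dom ∧
    (S (ε + δ)).X x t = (S δ).X ((S ε).X x t) ((S ε).T t) ∧
    (S (ε + δ)).T t = (S δ).T ((S ε).T t) ∧
    (S (ε + δ)).m x t = (S ε).m x t * (S δ).m ((S ε).X x t) ((S ε).T t)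
  near : ∀ x t, ∀ᶠ ε in nhds 0, (x, t) ∈ (S ε).dom
  deriv_X : ∀ x t, HasDerivAt (fun ε => (S ε).X x t) (ξ x t) 0
  deriv_T : ∀ t, HasDerivAt (fun ε => (S ε).T t) (τ t) 0
  deriv_m : ∀ x t, HasDerivAt (fun ε => (S ε).m x t) (-g x t) 0

namespace HasGenerator

variable {S : ℝ → Transf} {ξ : ℝ → ℝ → ℝ} {τ : ℝ → ℝ} {g : ℝ → ℝ → ℝ}
  {V : ℝ → ℝ} {E : Set ℝ} {μ θ : ℝ → ℝ}

theorem genX_eq (h : HasGenerator S ξ τ g) (x t : ℝ) : genX S x t = ξ x t := (h.deriv_X x t).deriv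

theorem genT_eq (h : HasGenerator S ξ τ g) (t : ℝ) : genT S t = τ t := (h.deriv_T t).deriv

theorem deriv_mult (h : HasGenerator S ξ τ g) (hd : IsDrift V E μ θ) {x : ℝ} (hx : x ∈ E) (t : ℝ) :
    HasDerivAt (fun ε => 1 / (S ε).mult θ x t) (μ x * ξ x t + g x t) 0 := by
  obtain ⟨h1, -, h3⟩ := h.zero.2 x t
  have hθ0 := hd.theta_ne hx
  have hθ : HasDerivAt θ (μ x * θ x) ((S 0).X x t) := by
    rw [h1]
    exact hd.hasDerivAt_theta hx
  have e : (fun ε => 1 / (S ε).mult θ x t) = fun ε =>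
      θ ((S ε).X x t) / (θ x * (S ε).m x t) := by
    funext ε
    simp only [Transf.mult]
    rw [one_div, mul_inv, inv_div, div_mul_eq_div_div, div_eq_mul_inv (θ _ / θ x)]
  rw [e]
  refine ((hθ.comp 0 (h.deriv_X x t)).div ((h.deriv_m x t).const_mul (θ x)) ?_).congr_deriv ?_
  · rw [h3]
    simpa using hθ0
  · simp only [Function.comp, h1, h3]
    field_simp
    ring

theorem genU_eq (h : HasGenerator S ξ τ g) (hd : IsDrift V E μ θ) {x : ℝ} (hx : x ∈ E) (t : ℝ) :
    genU θ S x t = μ x * ξ x t + g x t := (h.deriv_mult hd hx t).deriv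

/-- By the group law, the differential equation of the flow only has to be checked at `ε = 0`. -/
theorem isOneParameterGroup (h : HasGenerator S ξ τ g) (hd : IsDrift V E μ θ) :
    IsOneParameterGroup θ E S where
  interval := h.interval
  zero := h.zero
  add := h.add
  flow ε x t hp := by
    obtain ⟨hdom, -, hXE⟩ := hp
    simp only at hXE
    have hev : ∀ᶠ e in nhds ε, ((S ε).X x t, (S ε).T t) ∈ (S (e - ε)).dom := by
      have hc : Filter.Tendsto (fun e => e - ε) (nhds ε) (nhds 0) := by
        simpa using (continuous_sub_right ε).tendsto ε
      exact hc.eventually (h.near _ _)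
    have hadd : ∀ᶠ e in nhds ε,
        (S e).X x t = (S (e - ε)).X ((S ε).X x t) ((S ε).T t) ∧
        (S e).T t = (S (e - ε)).T ((S ε).T t) ∧
        (S e).m x t = (S ε).m x t * (S (e - ε)).m ((S ε).X x t) ((S ε).T t) := by
      filter_upwards [hev] with e he
      have := (h.add ε (e - ε) x t hdom he).2
      rwa [add_sub_cancel] at this
    have hcomp : ∀ {F : ℝ → ℝ} {F' : ℝ}, HasDerivAt F F' 0 →
        HasDerivAt (fun e => F (e - ε)) F' ε := by
      intro F F' hF
      exact HasDerivAt.comp_sub_const ε ε (by simpa using hF)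
    refine ⟨?_, ?_, fun u => ?_⟩
    · rw [h.genX_eq]
      exact (hcomp (h.deriv_X _ _)).congr_of_eventuallyEq (hadd.mono fun e he => he.1)
    · rw [h.genT_eq]
      exact (hcomp (h.deriv_T _)).congr_of_eventuallyEq (hadd.mono fun e he => he.2.1)
    · rw [h.genU_eq hd hXE]
      refine ((hcomp (h.deriv_mult hd hXE _)).mul_const
        (u / (S ε).mult θ x t)).congr_of_eventuallyEq (hadd.mono fun e he => ?_)
      simp only [Transf.mult]
      rw [he.1, he.2.2]
      have hθ := hd.theta_ne hXE
      simp only [div_eq_mul_inv, mul_inv, inv_inv, one_mul]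
      field_simp

end HasGenerator

theorem timeShift_hasGenerator :
    HasGenerator timeShift (fun _ _ => 0) (fun _ => 1) fun _ _ => 0 where
  interval x t := by simpa [timeShift] using Set.ordConnected_univ
  zero := by simp [timeShift]
  add ε δ x t _ _ := by simp [timeShift, add_assoc]
  near x t := by simp [timeShift]
  deriv_X x t := by simpa [timeShift] using hasDerivAt_const (0 : ℝ) x
  deriv_T t := by simpa [timeShift] using (hasDerivAt_id' (0 : ℝ)).const_add t
  deriv_m x t := by simpa [timeShift] using hasDerivAt_const (0 : ℝ) (1 : ℝ)

theorem rescale_hasGenerator :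
    HasGenerator rescale (fun _ _ => 0) (fun _ => 0) fun _ _ => -1 where
  interval x t := by simpa [rescale] using Set.ordConnected_univ
  zero := by simp [rescale]
  add ε δ x t _ _ := by simp [rescale, Real.exp_add]
  near x t := by simp [rescale]
  deriv_X x t := by simpa [rescale] using hasDerivAt_const (0 : ℝ) x
  deriv_T t := by simpa [rescale] using hasDerivAt_const (0 : ℝ) t
  deriv_m x t := by simpa [rescale] using Real.hasDerivAt_exp 0

theorem ordConnected_one_add_mul_pos (t : ℝ) : {ε : ℝ | 0 < 1 + ε * t}.OrdConnected := by
  have : {ε : ℝ | 0 < 1 + ε * t} = (fun ε => 1 + ε * t) ⁻¹' Set.Ioi 0 := rfl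
  rw [this]
  rcases le_total 0 t with ht | ht
  · refine Set.ordConnected_Ioi.preimage_mono fun a b hab => ?_
    have := mul_le_mul_of_nonneg_right hab ht
    change 1 + _ * t ≤ 1 + _ * t
    linarith
  · refine Set.ordConnected_Ioi.preimage_anti fun a b hab => ?_
    have := mul_le_mul_of_nonpos_right hab ht
    change 1 + _ * t ≤ 1 + _ * t
    linarith

theorem eventually_one_add_mul_pos (t : ℝ) : ∀ᶠ ε : ℝ in nhds 0, 0 < 1 + ε * t := by
  have : Continuous fun ε : ℝ => 1 + ε * t := by fun_prop
  exact this.continuousAt.eventually (lt_mem_nhds (by simp))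

/-- The group law of `t ↦ t / (1 + ε t)`: the denominators multiply, and they stay positive along
a composition. -/
theorem mul_pos_of_projective {ε δ t : ℝ} (h : 0 < 1 + ε * t)
    (h' : 0 < 1 + δ * (t / (1 + ε * t))) :
    0 < 1 + (ε + δ) * t ∧ 1 + (ε + δ) * t = (1 + ε * t) * (1 + δ * (t / (1 + ε * t))) := by
  have e : 1 + (ε + δ) * t = (1 + ε * t) * (1 + δ * (t / (1 + ε * t))) := by
    field_simp
    ring
  exact ⟨e ▸ mul_pos h h', e⟩

theorem F3.two1_hasGenerator (C : ℝ) :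
    HasGenerator (fun ε => F3.two1 C 1 ε) (fun x t => -(x * t)) (fun t => -t ^ 2)
      fun x t => x ^ 2 / 2 + t / 2 + C * t ^ 2 where
  interval x t := by simpa [F3.two1] using ordConnected_one_add_mul_pos t
  zero := by simp [F3.two1]
  near x t := by simpa [F3.two1] using eventually_one_add_mul_pos t
  add ε δ x t h h' := by
    simp only [F3.two1, one_mul, one_pow, Set.mem_ofPred_eq] at h h' ⊢
    obtain ⟨h1, h2⟩ := mul_pos_of_projective h h'
    refine ⟨h1, ?_, ?_, ?_⟩
    · rw [h2]
      field_simp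
    · rw [h2]
      field_simp
    · rw [div_mul_div_comm, ← Real.exp_add, ← Real.sqrt_mul h.le, ← h2]
      congr 2
      rw [h2]
      generalize hq : 1 + δ * (t / (1 + ε * t)) = q at *
      generalize hp : 1 + ε * t = p at *
      have e1 : ε * t = p - 1 := by linarith
      have e2 : δ * t = (q - 1) * p := by
        rw [← hq]
        field_simp
        ring
      rcases eq_or_ne t 0 with rfl | ht
      · have : p = 1 := by linarith
        have : q = 1 := by
          have := hq
          simp at this
          linarith
        subst_vars
        simp
        ring
      · obtain rfl : ε = (p - 1) / t := by field_simp; linarith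
        obtain rfl : δ = (q - 1) * p / t := by field_simp; linarith
        field_simp
        ring
  deriv_X x t := by
    have h := ((hasDerivAt_id (0 : ℝ)).mul_const t).const_add 1
    simp only [F3.two1, one_mul]
    refine ((hasDerivAt_const (0 : ℝ) x).div h (by simp)).congr_deriv ?_
    simp
  deriv_T t := by
    have h := ((hasDerivAt_id (0 : ℝ)).mul_const t).const_add 1
    simp only [F3.two1, one_mul, one_pow]
    refine ((hasDerivAt_const (0 : ℝ) t).div h (by simp)).congr_deriv ?_
    simp
    ring
  deriv_m x t := by
    have h := ((hasDerivAt_id (0 : ℝ)).mul_const t).const_add 1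
    simp only [F3.two1, one_mul, one_pow]
    refine ((((((hasDerivAt_id (0 : ℝ)).mul_const (x ^ 2)).neg.div (h.const_mul 2)
      (by simp)).add (((hasDerivAt_const (0 : ℝ) 1).div h (by simp)).sub_const 1
        |>.const_mul (C * t))).exp).div (h.sqrt (by simp)) (by simp)).congr_deriv ?_
    simp
    ring

theorem F3.scaling_hasGenerator (C : ℝ) :
    HasGenerator (F3.scaling C) (fun x _ => -(x / 2)) (fun t => -t) fun _ t => C * t where
  interval x t := by simpa [F3.scaling] using Set.ordConnected_univ
  zero := by simp [F3.scaling]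
  near x t := by simp [F3.scaling]
  add ε δ x t _ _ := by
    simp only [F3.scaling, Set.mem_univ, true_and]
    refine ⟨?_, ?_, ?_⟩
    · rw [mul_assoc, ← Real.exp_add]
      congr 2
      ring
    · rw [mul_assoc, ← Real.exp_add]
      congr 2
      ring
    · rw [← Real.exp_add, neg_add, Real.exp_add]
      congr 1
      ring
  deriv_X x t := by
    simp only [F3.scaling]
    refine (((hasDerivAt_id (0 : ℝ)).neg.div_const 2).exp.const_mul x).congr_deriv ?_
    simp
    ring
  deriv_T t := by
    simp only [F3.scaling]
    refine ((hasDerivAt_id (0 : ℝ)).neg.exp.const_mul t).congr_deriv ?_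
    simp
  deriv_m x t := by
    simp only [F3.scaling]
    refine (((hasDerivAt_id (0 : ℝ)).neg.exp.sub_const 1).const_mul (C * t)).exp.congr_deriv ?_
    simp

theorem F1.two1_hasGenerator (B C : ℝ) :
    HasGenerator (fun ε => F1.two1 B C 1 ε) (fun x t => -(x * t) - B * t ^ 3) (fun t => -t ^ 2)
      fun x t => x ^ 2 / 2 + 3 * B * x * t ^ 2 + t / 2 + B ^ 2 * t ^ 4 / 2 + C * t ^ 2 where
  interval x t := by simpa [F1.two1] using ordConnected_one_add_mul_pos t
  zero := by simp [F1.two1]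
  near x t := by simpa [F1.two1] using eventually_one_add_mul_pos t
  add ε δ x t h h' := by
    simp only [F1.two1, one_mul, one_pow, mul_one, abs_one, Set.mem_ofPred_eq] at h h' ⊢
    obtain ⟨h1, h2⟩ := mul_pos_of_projective h h'
    have hT : t / (1 + (ε + δ) * t) = t / (1 + ε * t) / (1 + δ * (t / (1 + ε * t))) := by
      rw [h2]
      field_simp
    have hX : (x - B * t ^ 2) / (1 + (ε + δ) * t) + B * t ^ 2 / (1 + (ε + δ) * t) ^ 2 =
        ((x - B * t ^ 2) / (1 + ε * t) + B * t ^ 2 / (1 + ε * t) ^ 2 -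
          B * (t / (1 + ε * t)) ^ 2) / (1 + δ * (t / (1 + ε * t))) +
        B * (t / (1 + ε * t)) ^ 2 / (1 + δ * (t / (1 + ε * t))) ^ 2 := by
      rw [h2]
      field_simp
      ring
    refine ⟨h1, hX, hT, ?_⟩
    rw [hX, hT]
    -- the factors `exp Q` telescope; what remains is the multiplier of the heat equation
    have hkey : 1 / √(1 + (ε + δ) * t) *
        Real.exp (-((ε + δ) * (x - B * t ^ 2) ^ 2) / (2 * (1 + (ε + δ) * t))) =
        1 / √(1 + ε * t) * Real.exp (-(ε * (x - B * t ^ 2) ^ 2) / (2 * (1 + ε * t))) *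
        (1 / √(1 + δ * (t / (1 + ε * t))) *
          Real.exp (-(δ * ((x - B * t ^ 2) / (1 + ε * t) + B * t ^ 2 / (1 + ε * t) ^ 2 -
            B * (t / (1 + ε * t)) ^ 2) ^ 2) / (2 * (1 + δ * (t / (1 + ε * t)))))) := by
      rw [mul_mul_mul_comm, ← Real.exp_add, div_mul_div_comm, ← Real.sqrt_mul h.le, ← h2, one_mul]
      congr 2
      have e : (x - B * t ^ 2) / (1 + ε * t) + B * t ^ 2 / (1 + ε * t) ^ 2 -
            B * (t / (1 + ε * t)) ^ 2 = (x - B * t ^ 2) / (1 + ε * t) := by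
        rw [div_pow]
        ring
      rw [e, h2]
      generalize x - B * t ^ 2 = z
      have h3 : 1 + ε * t + δ * t ≠ 0 := by
        rw [add_assoc, ← add_mul]
        exact h1.ne'
      field_simp
      ring
    rw [hkey]
    have := Real.exp_ne_zero (F1.Q B C ((x - B * t ^ 2) / (1 + ε * t) +
      B * t ^ 2 / (1 + ε * t) ^ 2) (t / (1 + ε * t)))
    field_simp
  deriv_X x t := by
    have h := ((hasDerivAt_id (0 : ℝ)).mul_const t).const_add 1
    simp only [F1.two1, one_mul, one_pow, mul_one]
    refine (((hasDerivAt_const (0 : ℝ) (x - B * t ^ 2)).div h (by simp)).add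
      ((hasDerivAt_const (0 : ℝ) (B * t ^ 2)).div (h.pow 2) (by simp))).congr_deriv ?_
    simp
    ring
  deriv_T t := by
    have h := ((hasDerivAt_id (0 : ℝ)).mul_const t).const_add 1
    simp only [F1.two1, one_mul, one_pow]
    refine ((hasDerivAt_const (0 : ℝ) t).div h (by simp)).congr_deriv ?_
    simp
    ring
  deriv_m x t := by
    have h := ((hasDerivAt_id (0 : ℝ)).mul_const t).const_add 1
    have hX := ((hasDerivAt_const (0 : ℝ) (x - B * t ^ 2)).div h (by simp)).add
      ((hasDerivAt_const (0 : ℝ) (B * t ^ 2)).div (h.pow 2) (by simp))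
    have hT := (hasDerivAt_const (0 : ℝ) t).div h (by simp)
    have hQ := (((hX.const_mul (-2 * B)).mul hT).add (((hT.pow 3).const_mul (2 * B ^ 2)).div_const
        3)).sub (hT.const_mul C)
    simp only [F1.two1, one_mul, one_pow, mul_one, abs_one, F1.Q]
    refine ((((hasDerivAt_const (0 : ℝ) 1).div (h.sqrt (by simp)) (by simp)).mul
      ((((hasDerivAt_id (0 : ℝ)).mul_const ((x - B * t ^ 2) ^ 2)).neg.div (h.const_mul 2)
      (by simp)).exp)).mul ((hasDerivAt_const (0 : ℝ) _).div hQ.exp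
        (Real.exp_ne_zero _))).congr_deriv ?_
    simp only [Pi.add_apply, Pi.sub_apply, Pi.mul_apply, Pi.div_apply, Pi.pow_apply, Pi.neg_apply,
      id, zero_mul, add_zero, neg_zero, zero_div, Real.exp_zero, Real.sqrt_one, div_one,
      one_pow, mul_one, sub_add_cancel]
    set Q := -2 * B * x * t + 2 * B ^ 2 * t ^ 3 / 3 - C * t
    have := Real.exp_ne_zero Q
    field_simp
    ring

theorem F1.scaling_hasGenerator (B C : ℝ) :
    HasGenerator (F1.scaling B C) (fun x t => -(x / 2) - 3 / 2 * B * t ^ 2) (fun t => -t)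
      fun x t => 3 * B * x * t + B ^ 2 * t ^ 3 + C * t where
  interval x t := by simpa [F1.scaling] using Set.ordConnected_univ
  zero := by simp [F1.scaling]
  near x t := by simp [F1.scaling]
  add ε δ x t _ _ := by
    have h2 : ∀ s, Real.exp (-s) = Real.exp (-s / 2) ^ 2 := fun s => by
      rw [← Real.exp_nat_mul]
      congr 1
      push_cast
      ring
    have h4 : ∀ s, Real.exp (-2 * s) = Real.exp (-s / 2) ^ 4 := fun s => by
      rw [← Real.exp_nat_mul]
      congr 1
      push_cast
      ring
    have h : Real.exp (-(ε + δ) / 2) = Real.exp (-ε / 2) * Real.exp (-δ / 2) := by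
      rw [← Real.exp_add]
      congr 1
      ring
    simp only [F1.scaling, Set.mem_univ, true_and, h2, h4, h]
    have hX : (x - B * t ^ 2) * (Real.exp (-ε / 2) * Real.exp (-δ / 2)) +
        B * t ^ 2 * (Real.exp (-ε / 2) * Real.exp (-δ / 2)) ^ 4 =
        ((x - B * t ^ 2) * Real.exp (-ε / 2) + B * t ^ 2 * Real.exp (-ε / 2) ^ 4 -
          B * (t * Real.exp (-ε / 2) ^ 2) ^ 2) * Real.exp (-δ / 2) +
        B * (t * Real.exp (-ε / 2) ^ 2) ^ 2 * Real.exp (-δ / 2) ^ 4 := by ring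
    have hT : t * (Real.exp (-ε / 2) * Real.exp (-δ / 2)) ^ 2 =
        t * Real.exp (-ε / 2) ^ 2 * Real.exp (-δ / 2) ^ 2 := by ring
    refine ⟨hX, hT, ?_⟩
    rw [hX, hT, div_mul_div_cancel₀ (Real.exp_ne_zero _)]
  deriv_X x t := by
    simp only [F1.scaling]
    refine (((hasDerivAt_id (0 : ℝ)).neg.div_const 2).exp.const_mul (x - B * t ^ 2) |>.add
      (((hasDerivAt_id (0 : ℝ)).const_mul (-2)).exp.const_mul (B * t ^ 2))).congr_deriv ?_
    simp
    ring
  deriv_T t := by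
    simp only [F1.scaling]
    refine ((hasDerivAt_id (0 : ℝ)).neg.exp.const_mul t).congr_deriv ?_
    simp
  deriv_m x t := by
    have hX := (((hasDerivAt_id (0 : ℝ)).neg.div_const 2).exp.const_mul (x - B * t ^ 2) |>.add
      (((hasDerivAt_id (0 : ℝ)).const_mul (-2)).exp.const_mul (B * t ^ 2)))
    have hT := (hasDerivAt_id (0 : ℝ)).neg.exp.const_mul t
    have hQ := (((hX.const_mul (-2 * B)).mul hT).add (((hT.pow 3).const_mul (2 * B ^ 2)).div_const
        3)).sub (hT.const_mul C)
    simp only [F1.scaling, F1.Q]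
    refine ((hasDerivAt_const (0 : ℝ) _).div hQ.exp (Real.exp_ne_zero _)).congr_deriv ?_
    simp only [Pi.add_apply, Pi.sub_apply, Pi.mul_apply, Pi.pow_apply, Pi.neg_apply,
      id, zero_mul, mul_zero, neg_zero, zero_div, Real.exp_zero, mul_one, sub_add_cancel]
    set Q := -2 * B * x * t + 2 * B ^ 2 * t ^ 3 / 3 - C * t
    have := Real.exp_ne_zero Q
    field_simp
    ring

theorem F1.two2_hasGenerator (B : ℝ) :
    HasGenerator (fun ε => F1.two2 B 0 ε) (fun _ t => -t) (fun _ => 0)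
      fun x t => x + B * t ^ 2 where
  interval x t := by simpa [F1.two2] using Set.ordConnected_univ
  zero := by simp [F1.two2]
  near x t := by simp [F1.two2]
  add ε δ x t _ _ := by
    simp only [F1.two2, Set.mem_univ, true_and]
    refine ⟨by ring, ?_⟩
    rw [← Real.exp_add]
    congr 1
    ring
  deriv_X x t := by
    simp only [F1.two2]
    refine (((hasDerivAt_id (0 : ℝ)).mul_const t).const_sub (x - 0)).congr_deriv ?_
    simp
  deriv_T t := by
    simpa [F1.two2] using hasDerivAt_const (0 : ℝ) t
  deriv_m x t := by
    simp only [F1.two2]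
    refine ((((hasDerivAt_id (0 : ℝ)).mul_const (x + B * t ^ 2)).const_sub _).add
      ((((hasDerivAt_id (0 : ℝ)).pow 2).mul_const t).div_const 2)).exp.congr_deriv ?_
    simp

theorem F1.spaceShift_hasGenerator (B : ℝ) :
    HasGenerator (F1.spaceShift B) (fun _ _ => -1) (fun _ => 0) fun _ t => 2 * B * t where
  interval x t := by simpa [F1.spaceShift] using Set.ordConnected_univ
  zero := by simp [F1.spaceShift]
  near x t := by simp [F1.spaceShift]
  add ε δ x t _ _ := by
    simp only [F1.spaceShift, Set.mem_univ, true_and]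
    refine ⟨by ring, ?_⟩
    rw [div_mul_div_cancel₀ (Real.exp_ne_zero _), sub_sub]
  deriv_X x t := by
    simp only [F1.spaceShift]
    exact (hasDerivAt_id (0 : ℝ)).const_sub x
  deriv_T t := by
    simpa [F1.spaceShift] using hasDerivAt_const (0 : ℝ) t
  deriv_m x t := by
    simp only [F1.spaceShift, ← Real.exp_sub]
    refine ((((hasDerivAt_id (0 : ℝ)).const_sub x).const_mul (-2 * B)).mul_const t).const_sub
      (-2 * B * x * t) |>.exp.congr_deriv ?_
    simp

section F24

variable {a c ν σ : ℝ}

theorem F24.inv_hasGenerator (ha : 0 < a) (hσ : σ ^ 2 = 1) :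
    HasGenerator (F24.inv a c ν σ)
      (fun x t => -((x + c) * Real.exp (σ * (2 * a * t)) / 2))
      (fun t => -σ * (Real.exp (σ * (2 * a * t)) / (2 * a)))
      (fun x t => (σ * (a / 2) * (x + c) ^ 2 - σ * (ν + 1 / 4 - σ / 4)) *
        Real.exp (σ * (2 * a * t))) := by
  have hE : ∀ t, Real.exp (-σ * (2 * a * t)) = (Real.exp (σ * (2 * a * t)))⁻¹ := fun t => by
    rw [← Real.exp_neg]
    congr 1
    ring
  have dR : ∀ t, HasDerivAt (fun ε : ℝ => 1 + ε * Real.exp (σ * (2 * a * t)))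
      (Real.exp (σ * (2 * a * t))) 0 := fun t => by
    simpa using ((hasDerivAt_id (0 : ℝ)).mul_const (Real.exp (σ * (2 * a * t)))).const_add 1
  have dX : ∀ x t, HasDerivAt (fun ε => (F24.inv a c ν σ ε).X x t)
      (-((x + c) * Real.exp (σ * (2 * a * t)) / 2)) 0 := fun x t => by
    refine ((hasDerivAt_div_sqrt (x + c) (dR t) (by simp)).sub_const c).congr_deriv ?_
    simp
    ring
  have dT : ∀ t, HasDerivAt (fun ε => (F24.inv a c ν σ ε).T t)
      (-σ * (Real.exp (σ * (2 * a * t)) / (2 * a))) 0 := fun t => by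
    refine (((((hasDerivAt_id (0 : ℝ)).add_const (Real.exp (-σ * (2 * a * t)))).log ?_).div_const
      (2 * a)).const_mul (-σ)).congr_deriv ?_
    · simp
    · simp only [id, zero_add, hE]
      field_simp
  have zX : ∀ x t, (F24.inv a c ν σ 0).X x t = x := fun x t => by simp [F24.inv]
  have zT : ∀ t, (F24.inv a c ν σ 0).T t = t := fun t => by
    simp only [F24.inv, zero_add, Real.log_exp]
    field_simp
    linear_combination t * hσ
  refine ⟨fun x t => ?_, ⟨?_, fun x t => ⟨zX x t, zT t, ?_⟩⟩, ?_, fun x t => ?_, dX, dT, ?_⟩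
  · have : {ε : ℝ | (x, t) ∈ (F24.inv a c ν σ ε).dom} =
        Set.Ioi (-Real.exp (-σ * (2 * a * t))) := by
      ext ε
      simp [F24.inv, neg_lt_iff_pos_add]
    rw [this]
    exact Set.ordConnected_Ioi
  · ext p
    simpa [F24.inv] using Real.exp_pos _
  · have h1 := zX x t
    have h2 := zT t
    simp only [F24.inv] at h1 h2 ⊢
    rw [h1, h2]
    exact div_self (Real.exp_ne_zero _)
  · intro ε δ x t h h'
    have h0 : 0 < ε + Real.exp (-σ * (2 * a * t)) := h
    have hT : Real.exp (-σ * (2 * a * (F24.inv a c ν σ ε).T t)) =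
        ε + Real.exp (-σ * (2 * a * t)) := by
      have : -σ * (2 * a * (F24.inv a c ν σ ε).T t) =
          Real.log (ε + Real.exp (-σ * (2 * a * t))) := by
        simp only [F24.inv]
        generalize Real.log (ε + Real.exp (-σ * (2 * a * t))) = l
        field_simp
        linear_combination l * hσ
      rw [this, Real.exp_log h0]
    have hT' : Real.exp (σ * (2 * a * (F24.inv a c ν σ ε).T t)) =
        (ε + Real.exp (-σ * (2 * a * t)))⁻¹ := by
      rw [← hT, hE, inv_inv]
    have hd : (x, t) ∈ (F24.inv a c ν σ (ε + δ)).dom := by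
      have h1 : 0 < δ + Real.exp (-σ * (2 * a * (F24.inv a c ν σ ε).T t)) := h'
      rw [hT] at h1
      change 0 < ε + δ + Real.exp (-σ * (2 * a * t))
      linarith
    have hX : (F24.inv a c ν σ (ε + δ)).X x t =
        (F24.inv a c ν σ δ).X ((F24.inv a c ν σ ε).X x t) ((F24.inv a c ν σ ε).T t) := by
      change (x + c) / √(1 + (ε + δ) * Real.exp (σ * (2 * a * t))) - c =
        ((x + c) / √(1 + ε * Real.exp (σ * (2 * a * t))) - c + c) /
          √(1 + δ * Real.exp (σ * (2 * a * (F24.inv a c ν σ ε).T t))) - c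
      rw [hT', sub_add_cancel, div_div, ← Real.sqrt_mul (F24.one_add_pos h).le]
      rw [hE] at h0 ⊢
      have := Real.exp_pos (σ * (2 * a * t))
      generalize Real.exp (σ * (2 * a * t)) = e at *
      congr 3
      have h0' : ε * e + 1 ≠ 0 := by
        have : ε * e + 1 = (ε + e⁻¹) * e := by field_simp
        rw [this]
        positivity
      field_simp
      ring
    have hTT : (F24.inv a c ν σ (ε + δ)).T t =
        (F24.inv a c ν σ δ).T ((F24.inv a c ν σ ε).T t) := by
      change -σ * (Real.log (ε + δ + Real.exp (-σ * (2 * a * t))) / (2 * a)) =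
        -σ * (Real.log (δ + Real.exp (-σ * (2 * a * (F24.inv a c ν σ ε).T t))) / (2 * a))
      rw [hT]
      congr 3
      ring
    refine ⟨hd, hX, hTT, ?_⟩
    have hm : ∀ η y s, (F24.inv a c ν σ η).m y s =
        Real.exp (2 * a * (ν + 1 / 4 - σ / 4) * s - σ * (a / 2) * (y + c) ^ 2) /
        Real.exp (2 * a * (ν + 1 / 4 - σ / 4) * (F24.inv a c ν σ η).T s -
          σ * (a / 2) * ((F24.inv a c ν σ η).X y s + c) ^ 2) := fun _ _ _ => rfl
    rw [hm, hm, hm, div_mul_div_cancel₀ (Real.exp_ne_zero _), hX, hTT]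
  · have : ContinuousAt (fun ε : ℝ => ε + Real.exp (-σ * (2 * a * t))) 0 := by fun_prop
    exact this.eventually (lt_mem_nhds (by simpa using Real.exp_pos _))
  · intro x t
    have hm : ∀ η, (F24.inv a c ν σ η).m x t =
        Real.exp (2 * a * (ν + 1 / 4 - σ / 4) * t - σ * (a / 2) * (x + c) ^ 2 -
        (2 * a * (ν + 1 / 4 - σ / 4) * (F24.inv a c ν σ η).T t -
          σ * (a / 2) * ((F24.inv a c ν σ η).X x t + c) ^ 2)) := fun _ => (Real.exp_sub _ _).symm
    simp only [hm]
    refine ((((dT t).const_mul _).sub (((((dX x t).add_const c).pow 2).const_mul _))).const_sub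
      _).exp.congr_deriv ?_
    simp only [zX, zT, Pi.sub_apply, Pi.pow_apply, sub_self, Real.exp_zero]
    push_cast
    field_simp
    ring

theorem F24.shift_hasGenerator :
    HasGenerator (F24.shift a c σ) (fun _ t => -Real.exp (σ * (a * t))) (fun _ => 0)
      fun x t => σ * a * Real.exp (σ * (a * t)) * (x + c) where
  interval x t := by simpa [F24.shift] using Set.ordConnected_univ
  zero := by simp [F24.shift]
  near x t := by simp [F24.shift]
  add ε δ x t _ _ := by
    simp only [F24.shift, Set.mem_univ, true_and]
    refine ⟨by ring, ?_⟩
    rw [← Real.exp_sub, ← Real.exp_sub, ← Real.exp_sub, ← Real.exp_add]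
    congr 1
    ring
  deriv_X x t := by
    simp only [F24.shift]
    refine (((hasDerivAt_id (0 : ℝ)).mul_const _).const_sub x).congr_deriv ?_
    simp
  deriv_T t := by
    simpa [F24.shift] using hasDerivAt_const (0 : ℝ) t
  deriv_m x t := by
    simp only [F24.shift, ← Real.exp_sub]
    refine ((((hasDerivAt_id (0 : ℝ)).const_mul (-σ * (a / 2))).mul_const _).mul_const (x + c)
      |>.sub ((((hasDerivAt_id (0 : ℝ)).const_mul (σ * (a / 2))).mul_const _).mul
        ((((hasDerivAt_id (0 : ℝ)).mul_const _).const_sub x).add_const c))).exp.congr_deriv ?_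
    simp
    ring

end F24

/-! ### Infinitesimal symmetries: the determining equations -/

section Infinitesimal

variable {I J : Set ℝ} {μ θ : ℝ → ℝ} {ξ τ φ : ℝ → ℝ → ℝ → ℝ}

theorem SmoothCoeff.slice {D : Set (ℝ × ℝ)} {F : ℝ → ℝ → ℝ → ℝ} (h : SmoothCoeff D F) (u : ℝ) :
    SmoothOn₂ D fun x t => F x t u :=
  ContDiffOn.comp (g := fun p : (ℝ × ℝ) × ℝ => F p.1.1 p.1.2 p.2)
    (f := fun p : ℝ × ℝ => (p, u)) h (by fun_prop) fun _ hp => ⟨hp, trivial⟩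

theorem SmoothCoeff.contDiff_u {D : Set (ℝ × ℝ)} {F : ℝ → ℝ → ℝ → ℝ} (h : SmoothCoeff D F)
    {x t : ℝ} (hp : (x, t) ∈ D) : ContDiff ℝ ∞ fun u => F x t u := by
  rw [← contDiffOn_univ]
  exact ContDiffOn.comp (g := fun p : (ℝ × ℝ) × ℝ => F p.1.1 p.1.2 p.2)
    (f := fun u : ℝ => ((x, t), u)) h (by fun_prop) fun u _ => ⟨hp, trivial⟩

/-- The coefficients of an infinitesimal symmetry: `τ` depends on `t` only, `ξ` on `(x, t)` only,
and `φ` is affine in `u`. This comes from the terms of the prolonged equation in `u_xt`,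
`u_x u_xt`, `u_x u_xx` and `u_x²`. -/
theorem IsInfinitesimalSymmetry.coeff_form (h : IsInfinitesimalSymmetry μ (I ×ˢ J) ξ τ φ)
    (hI : IsOpen I) (hI' : I.OrdConnected) (hJ : IsOpen J)
    (hξ : SmoothCoeff (I ×ˢ J) ξ) (hτ : SmoothCoeff (I ×ˢ J) τ) (hφ : SmoothCoeff (I ×ˢ J) φ)
    {x₀ : ℝ} (hx₀ : x₀ ∈ I) {x t : ℝ} (hx : x ∈ I) (ht : t ∈ J) (u : ℝ) :
    ξ x t u = ξ x t 0 ∧ τ x t u = τ x₀ t 0 ∧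
      φ x t u = (φ x t 1 - φ x t 0) * u + φ x t 0 := by
  have hD : IsOpen (I ×ˢ J) := hI.prod hJ
  have h' : ∀ x ∈ I, ∀ t ∈ J, ∀ u ux uxx uxt : ℝ, _ := fun x hx t ht u ux uxx uxt =>
    h x t ⟨hx, ht⟩ u ux (1 / 2 * uxx - μ x * ux - deriv μ x * u) uxx uxt (by ring)
  unfold prolXX prolX prolT at h'
  have e1 : ∀ x ∈ I, ∀ t ∈ J, ∀ u, pdx τ x t u = 0 := fun x hx t ht u => by
    linarith [h' x hx t ht u 0 0 0, h' x hx t ht u 0 0 1]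
  have e2 : ∀ x ∈ I, ∀ t ∈ J, ∀ u, pdu τ x t u = 0 := fun x hx t ht u => by
    linarith [h' x hx t ht u 1 0 0, h' x hx t ht u 1 0 1, e1 x hx t ht u]
  have dx0 : ∀ {F : ℝ → ℝ → ℝ → ℝ}, (∀ x ∈ I, ∀ t ∈ J, ∀ u, F x t u = 0) →
      ∀ x ∈ I, ∀ t ∈ J, ∀ u, pdx F x t u = 0 := fun hF x hx t ht u =>
    (hasDerivAt_congr_on hI hx (hasDerivAt_const x (0 : ℝ)) fun y hy => hF y hy t ht u).deriv
  have du0 : ∀ {F : ℝ → ℝ → ℝ → ℝ}, (∀ x ∈ I, ∀ t ∈ J, ∀ u, F x t u = 0) →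
      ∀ x ∈ I, ∀ t ∈ J, ∀ u, pdu F x t u = 0 := fun hF x hx t ht u =>
    (hasDerivAt_congr_on isOpen_univ trivial (hasDerivAt_const u (0 : ℝ))
      fun v _ => hF x hx t ht v).deriv
  have e3 : ∀ x ∈ I, ∀ t ∈ J, ∀ u, pdu ξ x t u = 0 := fun x hx t ht u => by
    have a1 := h' x hx t ht u 1 1 0
    have a2 := h' x hx t ht u 1 0 0
    have a3 := h' x hx t ht u 0 1 0
    have a4 := h' x hx t ht u 0 0 0
    rw [e1 x hx t ht u, e2 x hx t ht u, dx0 e1 x hx t ht u, dx0 e2 x hx t ht u,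
      du0 e2 x hx t ht u] at a1 a2 a3 a4
    linarith
  have e4 : ∀ x ∈ I, ∀ t ∈ J, ∀ u, pdu (pdu φ) x t u = 0 := fun x hx t ht u => by
    have a1 := h' x hx t ht u 1 0 0
    have a2 := h' x hx t ht u (-1) 0 0
    have a3 := h' x hx t ht u 0 0 0
    rw [e1 x hx t ht u, e2 x hx t ht u, dx0 e1 x hx t ht u, dx0 e2 x hx t ht u,
      du0 e2 x hx t ht u, e3 x hx t ht u, dx0 e3 x hx t ht u, du0 e3 x hx t ht u] at a1 a2 a3
    linarith
  have hu : ∀ {F : ℝ → ℝ → ℝ → ℝ}, SmoothCoeff (I ×ˢ J) F → ∀ v,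
      HasDerivAt (fun u => F x t u) (pdu F x t v) v := fun hF v =>
    ((hF.contDiff_u ⟨hx, ht⟩).differentiable (by simp) v).hasDerivAt
  have const_u : ∀ {F : ℝ → ℝ}, (∀ v, HasDerivAt F 0 v) → ∀ v w, F v = F w := fun hF v w =>
    eq_of_hasDerivAt_zero isOpen_univ Set.ordConnected_univ (fun r _ => hF r) trivial trivial
  refine ⟨?_, ?_, ?_⟩
  · refine const_u (F := fun u => ξ x t u) (fun v => ?_) u 0
    have := hu hξ v
    rwa [e3 x hx t ht v] at this
  · trans τ x t 0
    · refine const_u (F := fun u => τ x t u) (fun v => ?_) u 0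
      have := hu hτ v
      rwa [e2 x hx t ht v] at this
    · refine eq_of_hasDerivAt_zero (h := fun y => τ y t 0) hI hI' (fun y hy => ?_) hx hx₀
      have := (hτ.slice 0).hasDerivAt_dx hD (show (y, t) ∈ I ×ˢ J from ⟨hy, ht⟩)
      rwa [show dx (fun x t => τ x t 0) y t = 0 from e1 y hy t ht 0] at this
  · have hc := hφ.contDiff_u (show (x, t) ∈ I ×ˢ J from ⟨hx, ht⟩)
    have hd : ∀ v w, pdu φ x t v = pdu φ x t w := by
      refine const_u (F := fun u => pdu φ x t u) fun v => ?_
      have h1 : ContDiff ℝ ∞ (deriv fun u => φ x t u) := (contDiff_infty_iff_deriv.1 hc).2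
      have h2 : HasDerivAt (fun u => pdu φ x t u) (pdu (pdu φ) x t v) v :=
        (h1.differentiable (by simp) v).hasDerivAt
      rwa [e4 x hx t ht v] at h2
    have hlin : ∀ v w, φ x t v - pdu φ x t 0 * v = φ x t w - pdu φ x t 0 * w := by
      refine const_u (F := fun v => φ x t v - pdu φ x t 0 * v) fun v => ?_
      refine ((hu hφ v).sub ((hasDerivAt_id v).const_mul (pdu φ x t 0))).congr_deriv ?_
      rw [hd v 0]
      ring
    have a1 := hlin u 0
    have a2 := hlin 1 0
    simp only [mul_one, mul_zero, sub_zero] at a1 a2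
    linear_combination a1 - u * a2

/-- For a field `ξ(x,t) ∂_x + τ(t) ∂_t + (ψ(x,t) u + β(x,t)) ∂_u`, the symmetry condition splits
into the vanishing of the coefficients of `u_xx`, `u_x`, `u` and `1`. -/
theorem isInfinitesimalSymmetry_iff (hI : IsOpen I) (hJ : IsOpen J)
    {ξ₀ ψ β : ℝ → ℝ → ℝ} {τ₀ : ℝ → ℝ}
    (hξ₀ : SmoothOn₂ (I ×ˢ J) ξ₀) (hψ : SmoothOn₂ (I ×ˢ J) ψ) (hβ : SmoothOn₂ (I ×ˢ J) β)
    (hτ₀ : ContDiffOn ℝ ∞ τ₀ J)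
    (hform : ∀ x ∈ I, ∀ t ∈ J, ∀ u, ξ x t u = ξ₀ x t ∧ τ x t u = τ₀ t ∧
      φ x t u = ψ x t * u + β x t) :
    IsInfinitesimalSymmetry μ (I ×ˢ J) ξ τ φ ↔ ∀ x ∈ I, ∀ t ∈ J,
      deriv τ₀ t = 2 * dx ξ₀ x t ∧
      dx ψ x t - 1 / 2 * dx (dx ξ₀) x t - μ x * dx ξ₀ x t + dt ξ₀ x t
        - ξ₀ x t * deriv μ x = 0 ∧
      1 / 2 * dx (dx ψ) x t - μ x * dx ψ x t - dt ψ x t - deriv τ₀ t * deriv μ x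
        - ξ₀ x t * deriv (deriv μ) x = 0 ∧
      dt β x t = 1 / 2 * dx (dx β) x t - μ x * dx β x t - deriv μ x * β x t := by
  have hD : IsOpen (I ×ˢ J) := hI.prod hJ
  have cx : ∀ {F G G' : ℝ → ℝ → ℝ → ℝ},
      (∀ x ∈ I, ∀ t ∈ J, ∀ u, F x t u = G x t u) →
      (∀ x ∈ I, ∀ t ∈ J, ∀ u, HasDerivAt (fun y => G y t u) (G' x t u) x) →
      ∀ x ∈ I, ∀ t ∈ J, ∀ u, pdx F x t u = G' x t u := fun hF hG x hx t ht u =>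
    (hasDerivAt_congr_on hI hx (hG x hx t ht u) fun y hy => hF y hy t ht u).deriv
  have ct : ∀ {F G G' : ℝ → ℝ → ℝ → ℝ},
      (∀ x ∈ I, ∀ t ∈ J, ∀ u, F x t u = G x t u) →
      (∀ x ∈ I, ∀ t ∈ J, ∀ u, HasDerivAt (fun s => G x s u) (G' x t u) t) →
      ∀ x ∈ I, ∀ t ∈ J, ∀ u, pdt F x t u = G' x t u := fun hF hG x hx t ht u =>
    (hasDerivAt_congr_on hJ ht (hG x hx t ht u) fun s hs => hF x hx s hs u).deriv
  have cu : ∀ {F G G' : ℝ → ℝ → ℝ → ℝ},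
      (∀ x ∈ I, ∀ t ∈ J, ∀ u, F x t u = G x t u) →
      (∀ x ∈ I, ∀ t ∈ J, ∀ u, HasDerivAt (fun v => G x t v) (G' x t u) u) →
      ∀ x ∈ I, ∀ t ∈ J, ∀ u, pdu F x t u = G' x t u := fun hF hG x hx t ht u =>
    (hasDerivAt_congr_on isOpen_univ trivial (hG x hx t ht u) fun v _ => hF x hx t ht v).deriv
  have zx : ∀ {F : ℝ → ℝ → ℝ → ℝ}, (∀ x ∈ I, ∀ t ∈ J, ∀ u, F x t u = 0) →
      ∀ x ∈ I, ∀ t ∈ J, ∀ u, pdx F x t u = 0 := fun hF =>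
    cx (G' := fun _ _ _ => 0) hF fun x _ _ _ _ => hasDerivAt_const x (0 : ℝ)
  have zu : ∀ {F : ℝ → ℝ → ℝ → ℝ}, (∀ x ∈ I, ∀ t ∈ J, ∀ u, F x t u = 0) →
      ∀ x ∈ I, ∀ t ∈ J, ∀ u, pdu F x t u = 0 := fun hF =>
    cu (G' := fun _ _ _ => 0) hF fun _ _ _ _ u => hasDerivAt_const u (0 : ℝ)
  have ξx := cx (F := ξ) (G := fun x t _ => ξ₀ x t) (G' := fun x t _ => dx ξ₀ x t)
    (fun x hx t ht u => (hform x hx t ht u).1)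
    fun x hx t ht u => hξ₀.hasDerivAt_dx hD ⟨hx, ht⟩
  have ξxx := cx (F := pdx ξ) (G := fun x t _ => dx ξ₀ x t) (G' := fun x t _ => dx (dx ξ₀) x t)
    ξx fun x hx t ht u => (hξ₀.smooth_dx hD).hasDerivAt_dx hD ⟨hx, ht⟩
  have ξt := ct (F := ξ) (G := fun x t _ => ξ₀ x t) (G' := fun x t _ => dt ξ₀ x t)
    (fun x hx t ht u => (hform x hx t ht u).1)
    fun x hx t ht u => hξ₀.hasDerivAt_dt hD ⟨hx, ht⟩
  have ξu := cu (F := ξ) (G := fun x t _ => ξ₀ x t) (G' := fun _ _ _ => 0)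
    (fun x hx t ht u => (hform x hx t ht u).1)
    fun x hx t ht u => hasDerivAt_const u _
  have τx := cx (F := τ) (G := fun _ t _ => τ₀ t) (G' := fun _ _ _ => 0)
    (fun x hx t ht u => (hform x hx t ht u).2.1)
    fun x hx t ht u => hasDerivAt_const x _
  have τt := ct (F := τ) (G := fun _ t _ => τ₀ t) (G' := fun _ t _ => deriv τ₀ t)
    (fun x hx t ht u => (hform x hx t ht u).2.1)
    fun x hx t ht u => hτ₀.hasDerivAt_deriv hJ ht
  have τu := cu (F := τ) (G := fun _ t _ => τ₀ t) (G' := fun _ _ _ => 0)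
    (fun x hx t ht u => (hform x hx t ht u).2.1)
    fun x hx t ht u => hasDerivAt_const u _
  have φx := cx (F := φ) (G := fun x t u => ψ x t * u + β x t)
    (G' := fun x t u => dx ψ x t * u + dx β x t)
    (fun x hx t ht u => (hform x hx t ht u).2.2)
    fun x hx t ht u => ((hψ.hasDerivAt_dx hD ⟨hx, ht⟩).mul_const u).add
      (hβ.hasDerivAt_dx hD ⟨hx, ht⟩)
  have φxx := cx (F := pdx φ) (G := fun x t u => dx ψ x t * u + dx β x t)
    (G' := fun x t u => dx (dx ψ) x t * u + dx (dx β) x t) φx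
    fun x hx t ht u => (((hψ.smooth_dx hD).hasDerivAt_dx hD ⟨hx, ht⟩).mul_const u).add
      ((hβ.smooth_dx hD).hasDerivAt_dx hD ⟨hx, ht⟩)
  have φt := ct (F := φ) (G := fun x t u => ψ x t * u + β x t)
    (G' := fun x t u => dt ψ x t * u + dt β x t)
    (fun x hx t ht u => (hform x hx t ht u).2.2)
    fun x hx t ht u => ((hψ.hasDerivAt_dt hD ⟨hx, ht⟩).mul_const u).add
      (hβ.hasDerivAt_dt hD ⟨hx, ht⟩)
  have φu := cu (F := φ) (G := fun x t u => ψ x t * u + β x t) (G' := fun x t _ => ψ x t)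
    (fun x hx t ht u => (hform x hx t ht u).2.2)
    fun x hx t ht u => (((hasDerivAt_id u).const_mul (ψ x t)).add_const (β x t)).congr_deriv
      (mul_one _)
  have φxu := cx (F := pdu φ) (G := fun x t _ => ψ x t) (G' := fun x t _ => dx ψ x t) φu
    fun x hx t ht u => hψ.hasDerivAt_dx hD ⟨hx, ht⟩
  have φuu := cu (F := pdu φ) (G := fun x t _ => ψ x t) (G' := fun _ _ _ => 0) φu
    fun x hx t ht u => hasDerivAt_const u _
  have key : ∀ x ∈ I, ∀ t ∈ J, ∀ u ux ut uxx uxt : ℝ,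
      1 / 2 * uxx - μ x * ux - deriv μ x * u - ut = 0 →
      1 / 2 * prolXX ξ τ φ x t u ux ut uxx uxt - μ x * prolX ξ τ φ x t u ux ut
        - deriv μ x * φ x t u - prolT ξ τ φ x t u ux ut
        - ξ x t u * (deriv μ x * ux + deriv (deriv μ) x * u) =
      1 / 2 * (deriv τ₀ t - 2 * dx ξ₀ x t) * uxx +
      (dx ψ x t - 1 / 2 * dx (dx ξ₀) x t - μ x * dx ξ₀ x t + dt ξ₀ x t - ξ₀ x t * deriv μ x
        - μ x * (deriv τ₀ t - 2 * dx ξ₀ x t)) * ux +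
      (1 / 2 * dx (dx ψ) x t - μ x * dx ψ x t - dt ψ x t - deriv τ₀ t * deriv μ x
        - ξ₀ x t * deriv (deriv μ) x) * u +
      (1 / 2 * dx (dx β) x t - μ x * dx β x t - deriv μ x * β x t - dt β x t) := by
    intro x hx t ht u ux ut uxx uxt hv
    have hv' : ut = 1 / 2 * uxx - μ x * ux - deriv μ x * u := by linarith
    subst hv'
    unfold prolXX prolX prolT
    rw [(hform x hx t ht u).1, (hform x hx t ht u).2.2, ξx x hx t ht, ξxx x hx t ht,
      ξt x hx t ht, ξu x hx t ht, zx ξu x hx t ht, zu ξu x hx t ht, τx x hx t ht, zx τx x hx t ht,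
      τt x hx t ht, τu x hx t ht, zx τu x hx t ht, zu τu x hx t ht, φx x hx t ht, φxx x hx t ht,
      φt x hx t ht, φu x hx t ht, φxu x hx t ht, φuu x hx t ht]
    ring
  constructor
  · intro h x hx t ht
    have h' : ∀ u ux uxx : ℝ, _ := fun u ux uxx => (key x hx t ht u ux
      (1 / 2 * uxx - μ x * ux - deriv μ x * u) uxx 0 (by ring)).symm.trans
      (h x t ⟨hx, ht⟩ u ux (1 / 2 * uxx - μ x * ux - deriv μ x * u) uxx 0 (by ring))
    have a0 := h' 0 0 0
    have a1 := h' 0 0 1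
    have a2 := h' 0 1 0
    have a3 := h' 1 0 0
    have b1 : deriv τ₀ t - 2 * dx ξ₀ x t = 0 := by linarith
    rw [b1] at a2
    exact ⟨by linarith, by linarith, by linarith, by linarith⟩
  · intro h x t hp u ux ut uxx uxt hv
    obtain ⟨b1, b2, b3, b4⟩ := h x hp.1 t hp.2
    rw [key x hp.1 t hp.2 u ux ut uxx uxt hv]
    linear_combination (1 / 2 * uxx - μ x * ux) * b1 + ux * b2 + u * b3 - b4

end Infinitesimal

/-! ### Infinitesimal symmetries: reduction to ordinary differential equations -/

/-- The potentials of all four families: `V = A x² + 4 B x + 2 C + D / x²`. -/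
noncomputable def potential (A B C D x : ℝ) : ℝ := A * x ^ 2 + 4 * B * x + 2 * C + D / x ^ 2

theorem hasDerivAt_potential (A B C D : ℝ) {x : ℝ} (h : D = 0 ∨ x ≠ 0) :
    HasDerivAt (potential A B C D) (2 * A * x + 4 * B - 2 * D / x ^ 3) x := by
  have h1 : HasDerivAt (fun x : ℝ => A * x ^ 2 + 4 * B * x + 2 * C) (2 * A * x + 4 * B) x := by
    refine (((((hasDerivAt_id x).pow 2).const_mul A).add
      ((hasDerivAt_id x).const_mul (4 * B))).add_const (2 * C)).congr_deriv ?_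
    simp
    ring
  have h2 : HasDerivAt (fun x : ℝ => D / x ^ 2) (-(2 * D / x ^ 3)) x := by
    rcases h with rfl | h
    · simpa using hasDerivAt_const x (0 : ℝ)
    · refine ((hasDerivAt_const x D).div ((hasDerivAt_id x).pow 2)
        (pow_ne_zero 2 h)).congr_deriv ?_
      simp only [id, Pi.pow_apply]
      field_simp
      push_cast
      ring
  exact (h1.add h2).congr_deriv (by ring)

/-- Functions of `t` describing an infinitesimal symmetry `ξ ∂_x + τ ∂_t + (μ ξ + g) u ∂_u` with
`ξ = τ₁ x / 2 + s` and `g = -(τ₂ x² / 4 + s₁ x) + k`; here `τ₁`, `τ₂`, `s₁` are the derivatives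
`τ'`, `τ''`, `s'`. -/
structure GenData where
  τ : ℝ → ℝ
  τ₁ : ℝ → ℝ
  τ₂ : ℝ → ℝ
  s : ℝ → ℝ
  s₁ : ℝ → ℝ
  k : ℝ → ℝ

namespace GenData

/-- The coefficient of `∂_x`. -/
noncomputable def ξ (G : GenData) (x t : ℝ) : ℝ := G.τ₁ t / 2 * x + G.s t

/-- The coefficient of `u ∂_u`, less `μ ξ`. -/
noncomputable def g (G : GenData) (x t : ℝ) : ℝ := -(G.τ₂ t / 4 * x ^ 2 + G.s₁ t * x) + G.k t

/-- The determining equations, for the potential `A x² + 4 B x + 2 C + D / x²`. -/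
structure Determining (A B C D : ℝ) (J : Set ℝ) (G : GenData) : Prop where
  deriv_τ : ∀ t ∈ J, HasDerivAt G.τ (G.τ₁ t) t
  deriv_τ₁ : ∀ t ∈ J, HasDerivAt G.τ₁ (G.τ₂ t) t
  deriv_τ₂ : ∀ t ∈ J, HasDerivAt G.τ₂ (4 * A * G.τ₁ t) t
  deriv_s : ∀ t ∈ J, HasDerivAt G.s (G.s₁ t) t
  deriv_s₁ : ∀ t ∈ J, HasDerivAt G.s₁ (3 * B * G.τ₁ t + A * G.s t) t
  deriv_k : ∀ t ∈ J, HasDerivAt G.k (-(G.τ₂ t) / 4 - C * G.τ₁ t - 2 * B * G.s t) t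
  D_mul_s : ∀ t ∈ J, D * G.s t = 0

end GenData

section Determining

variable {A B C D : ℝ} {E I J : Set ℝ} {μ θ : ℝ → ℝ} {ξ₀ ψ : ℝ → ℝ → ℝ}

/-- For a field of the form described by `GenData`, the coefficient of `u` in the symmetry
condition is a Laurent polynomial in `x`. -/
theorem coeff_u_eq_laurent (hd : IsDrift (potential A B C D) E μ θ) (hE : IsOpen E)
    (hED : ∀ x ∈ E, D = 0 ∨ x ≠ 0) (hI : IsOpen I) (hIE : I ⊆ E) (hJ : IsOpen J) {G : GenData}
    {τ₃ s₂ k₁ t : ℝ} (ht : t ∈ J) (hτ₁ : HasDerivAt G.τ₁ (G.τ₂ t) t)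
    (hτ₂ : HasDerivAt G.τ₂ τ₃ t) (hs : HasDerivAt G.s (G.s₁ t) t)
    (hs₁ : HasDerivAt G.s₁ s₂ t) (hk : HasDerivAt G.k k₁ t)
    (hξ : ∀ x ∈ I, ∀ t ∈ J, ξ₀ x t = G.ξ x t)
    (hψ : ∀ x ∈ I, ∀ t ∈ J, ψ x t = μ x * G.ξ x t + G.g x t) {x : ℝ} (hx : x ∈ I) :
    dx ξ₀ x t = G.τ₁ t / 2 ∧
    dx ψ x t - 1 / 2 * dx (dx ξ₀) x t - μ x * dx ξ₀ x t + dt ξ₀ x t - ξ₀ x t * deriv μ x = 0 ∧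
    1 / 2 * dx (dx ψ) x t - μ x * dx ψ x t - dt ψ x t - G.τ₁ t * deriv μ x
        - ξ₀ x t * deriv (deriv μ) x =
      (τ₃ / 4 - A * G.τ₁ t) * x ^ 2 + (s₂ - 3 * B * G.τ₁ t - A * G.s t) * x +
        (-(G.τ₂ t) / 4 - C * G.τ₁ t - 2 * B * G.s t - k₁) + D * G.s t / x ^ 3 := by
  have hlin : ∀ (p q y : ℝ), HasDerivAt (fun y => p * y + q) p y := fun p q y => by
    simpa using ((hasDerivAt_id y).const_mul p).add_const q
  have dξ : ∀ y ∈ I, HasDerivAt (fun y => ξ₀ y t) (G.τ₁ t / 2) y := fun y hy =>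
    hasDerivAt_congr_on hI hy (hlin _ _ y) fun z hz => hξ z hz t ht
  have ξx : ∀ y ∈ I, dx ξ₀ y t = G.τ₁ t / 2 := fun y hy => (dξ y hy).deriv
  have ξxx : dx (dx ξ₀) x t = 0 :=
    (hasDerivAt_congr_on hI hx (hasDerivAt_const x (G.τ₁ t / 2)) ξx).deriv
  have dξt : HasDerivAt (fun r => G.ξ x r) (G.τ₂ t / 2 * x + G.s₁ t) t :=
    ((hτ₁.div_const 2).mul_const x).add hs
  have ξt : dt ξ₀ x t = G.τ₂ t / 2 * x + G.s₁ t :=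
    (hasDerivAt_congr_on hJ ht dξt fun r hr => hξ x hx r hr).deriv
  have hμ : ∀ y ∈ I, HasDerivAt μ (potential A B C D y - μ y ^ 2) y := fun y hy =>
    hd.hasDerivAt_mu hE (hIE hy)
  have dg : ∀ y, HasDerivAt (fun y => G.g y t) (-(G.τ₂ t / 2 * y + G.s₁ t)) y := fun y => by
    refine (((((hasDerivAt_id y).pow 2).const_mul (G.τ₂ t / 4)).add
      ((hasDerivAt_id y).const_mul (G.s₁ t))).neg.add_const (G.k t)).congr_deriv ?_
    simp
    ring
  have ψx : ∀ y ∈ I, dx ψ y t = (potential A B C D y - μ y ^ 2) * G.ξ y t +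
      μ y * (G.τ₁ t / 2) - (G.τ₂ t / 2 * y + G.s₁ t) := fun y hy =>
    (hasDerivAt_congr_on hI hy (((hμ y hy).mul (hlin (G.τ₁ t / 2) (G.s t) y)).add (dg y))
      fun z hz => hψ z hz t ht).deriv
  have hV := hasDerivAt_potential A B C D (hED x (hIE hx))
  have ψxx := (hasDerivAt_congr_on hI hx ((((hV.sub ((hμ x hx).pow 2)).mul
    (hlin (G.τ₁ t / 2) (G.s t) x)).add ((hμ x hx).mul_const (G.τ₁ t / 2))).sub
    (hlin (G.τ₂ t / 2) (G.s₁ t) x)) ψx).deriv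
  have ψt : dt ψ x t = μ x * (G.τ₂ t / 2 * x + G.s₁ t) - (τ₃ / 4 * x ^ 2 + s₂ * x) + k₁ := by
    refine (hasDerivAt_congr_on hJ ht ((dξt.const_mul (μ x)).add
      ((((hτ₂.div_const 4).mul_const (x ^ 2)).add (hs₁.mul_const x)).neg.add hk))
      fun r hr => hψ x hx r hr).deriv.trans ?_
    ring
  have μx : deriv μ x = potential A B C D x - μ x ^ 2 := (hμ x hx).deriv
  have μxx := (hasDerivAt_congr_on hI hx (hV.sub ((hμ x hx).pow 2))
    fun y hy => (hμ y hy).deriv).deriv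
  refine ⟨ξx x hx, ?_, ?_⟩
  · rw [ξxx, ξx x hx, ξt, ψx x hx, μx, hξ x hx t ht]
    ring
  · change dx (dx ψ) x t = _ at ψxx
    rw [ψxx, μxx, ψx x hx, ψt, μx, hξ x hx t ht]
    simp only [Pi.sub_apply, Pi.pow_apply, GenData.ξ]
    have hD : D / x ^ 3 * x = D / x ^ 2 := by
      rcases hED x (hIE hx) with h | h
      · simp [h]
      · field_simp
    unfold potential
    push_cast
    linear_combination (1 / 2 : ℝ) * G.τ₁ t * hD

/-- The infinitesimal symmetries correspond to the solutions of a linear system of ordinary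
differential equations in `t`. -/
theorem isInfinitesimalSymmetry_iff_determining (hd : IsDrift (potential A B C D) E μ θ)
    (hE : IsOpen E) (hED : ∀ x ∈ E, D = 0 ∨ x ≠ 0) (hI : IsOpen I) (hI' : I.OrdConnected)
    (hIn : I.Nonempty) (hIE : I ⊆ E) (hJ : IsOpen J) {ξ τ φ : ℝ → ℝ → ℝ → ℝ}
    (hξ : SmoothCoeff (I ×ˢ J) ξ) (hτ : SmoothCoeff (I ×ˢ J) τ) (hφ : SmoothCoeff (I ×ˢ J) φ) :
    IsInfinitesimalSymmetry μ (I ×ˢ J) ξ τ φ ↔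
      ∃ (G : GenData) (β : ℝ → ℝ → ℝ), G.Determining A B C D J ∧ IsSolution μ (I ×ˢ J) β ∧
        ∀ x ∈ I, ∀ t ∈ J, ∀ u, ξ x t u = G.ξ x t ∧ τ x t u = G.τ t ∧
          φ x t u = (μ x * G.ξ x t + G.g x t) * u + β x t := by
  obtain ⟨x₀, hx₀⟩ := hIn
  have hD : IsOpen (I ×ˢ J) := hI.prod hJ
  have sξ := hξ.slice 0
  have sβ := hφ.slice 0
  have sψ : SmoothOn₂ (I ×ˢ J) fun x t => φ x t 1 - φ x t 0 := (hφ.slice 1).sub sβ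
  have sτ : ContDiffOn ℝ ∞ (fun t => τ x₀ t 0) J := (hτ.slice 0).contDiffOn_right hx₀
  constructor
  · intro h
    have hform := fun x (hx : x ∈ I) t (ht : t ∈ J) =>
      h.coeff_form hI hI' hJ hξ hτ hφ hx₀ hx ht
    have hdet := (isInfinitesimalSymmetry_iff hI hJ sξ sψ sβ sτ hform).1 h
    set ξ₀ : ℝ → ℝ → ℝ := fun x t => ξ x t 0 with hξ₀
    set ψ : ℝ → ℝ → ℝ := fun x t => φ x t 1 - φ x t 0 with hψ₀
    set β : ℝ → ℝ → ℝ := fun x t => φ x t 0 with hβ₀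
    set τ₀ : ℝ → ℝ := fun t => τ x₀ t 0 with hτ₀
    have sτ₁ := sτ.smooth_deriv hJ
    have sτ₂ := sτ₁.smooth_deriv hJ
    set s : ℝ → ℝ := fun t => ξ₀ x₀ t - deriv τ₀ t / 2 * x₀ with hs₀
    have ss : ContDiffOn ℝ ∞ s J :=
      (sξ.contDiffOn_right hx₀).sub ((sτ₁.div_const 2).mul contDiffOn_const)
    have ss₁ := ss.smooth_deriv hJ
    have eξ : ∀ x ∈ I, ∀ t ∈ J, ξ₀ x t = deriv τ₀ t / 2 * x + s t := by
      intro x hx t ht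
      have := eq_of_hasDerivAt_zero (h := fun y => ξ₀ y t - deriv τ₀ t / 2 * y) hI hI'
        (fun y hy => by
          refine ((sξ.hasDerivAt_dx hD (show (y, t) ∈ I ×ˢ J from ⟨hy, ht⟩)).sub
            ((hasDerivAt_id y).const_mul _)).congr_deriv ?_
          rw [(hdet y hy t ht).1]
          ring) hx hx₀
      simp only [hs₀] at this ⊢
      linarith
    set k : ℝ → ℝ := fun t => ψ x₀ t - μ x₀ * ξ₀ x₀ t +
      (deriv (deriv τ₀) t / 4 * x₀ ^ 2 + deriv s t * x₀) with hk₀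
    have sk : ContDiffOn ℝ ∞ k J :=
      ((sψ.contDiffOn_right hx₀).sub (contDiffOn_const.mul (sξ.contDiffOn_right hx₀))).add
        (((sτ₂.div_const 4).mul contDiffOn_const).add (ss₁.mul contDiffOn_const))
    have dξt : ∀ x ∈ I, ∀ t ∈ J, dt ξ₀ x t = deriv (deriv τ₀) t / 2 * x + deriv s t := by
      intro x hx t ht
      exact (hasDerivAt_congr_on hJ ht ((((sτ₁.hasDerivAt_deriv hJ ht).div_const 2).mul_const
        x).add (ss.hasDerivAt_deriv hJ ht)) fun r hr => eξ x hx r hr).deriv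
    have dξxx : ∀ x ∈ I, ∀ t ∈ J, dx (dx ξ₀) x t = 0 := by
      intro x hx t ht
      refine (hasDerivAt_congr_on hI hx (hasDerivAt_const x (deriv τ₀ t / 2)) fun y hy => ?_).deriv
      linarith [(hdet y hy t ht).1]
    have eψ : ∀ x ∈ I, ∀ t ∈ J, ψ x t = μ x * ξ₀ x t +
        (-(deriv (deriv τ₀) t / 4 * x ^ 2 + deriv s t * x) + k t) := by
      intro x hx t ht
      have := eq_of_hasDerivAt_zero (h := fun y => ψ y t - μ y * ξ₀ y t +
          (deriv (deriv τ₀) t / 4 * y ^ 2 + deriv s t * y)) hI hI' (fun y hy => by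
        have hp : (y, t) ∈ I ×ˢ J := ⟨hy, ht⟩
        refine (((sψ.hasDerivAt_dx hD hp).sub ((hd.1.hasDerivAt_deriv hE (hIE hy)).mul
          (sξ.hasDerivAt_dx hD hp))).add ((((hasDerivAt_id y).pow 2).const_mul _).add
          ((hasDerivAt_id y).const_mul _))).congr_deriv ?_
        have h2 := (hdet y hy t ht).2.1
        rw [dξxx y hy t ht, dξt y hy t ht] at h2
        simp only [id]
        push_cast
        linear_combination h2) hx hx₀
      simp only [hk₀] at this ⊢
      linarith
    set G : GenData := ⟨τ₀, deriv τ₀, deriv (deriv τ₀), s, deriv s, k⟩ with hG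
    have hlaurent : ∀ t ∈ J, _ := fun t ht => laurent_coeffs_eq_zero
      (infinite_of_isOpen hI ⟨x₀, hx₀⟩) fun x hx =>
      (coeff_u_eq_laurent (G := G) hd hE hED hI hIE hJ ht (sτ₁.hasDerivAt_deriv hJ ht)
        (sτ₂.hasDerivAt_deriv hJ ht) (ss.hasDerivAt_deriv hJ ht) (ss₁.hasDerivAt_deriv hJ ht)
        (sk.hasDerivAt_deriv hJ ht) eξ (fun x hx t ht => by
          rw [eψ x hx t ht, eξ x hx t ht]
          rfl) hx).2.2.symm.trans (hdet x hx t ht).2.2.1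
    refine ⟨G, β, ⟨fun t ht => sτ.hasDerivAt_deriv hJ ht, fun t ht => sτ₁.hasDerivAt_deriv hJ ht,
      fun t ht => ?_, fun t ht => ss.hasDerivAt_deriv hJ ht, fun t ht => ?_, fun t ht => ?_,
      fun t ht => (hlaurent t ht).2.2.2⟩, ⟨sβ, fun x t hp => (hdet x hp.1 t hp.2).2.2.2⟩, ?_⟩
    · convert sτ₂.hasDerivAt_deriv hJ ht using 1
      linarith [(hlaurent t ht).1]
    · convert ss₁.hasDerivAt_deriv hJ ht using 1
      linarith [(hlaurent t ht).2.1]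
    · convert sk.hasDerivAt_deriv hJ ht using 1
      linarith [(hlaurent t ht).2.2.1]
    · intro x hx t ht u
      refine ⟨(hform x hx t ht u).1.trans (eξ x hx t ht), (hform x hx t ht u).2.1, ?_⟩
      rw [(hform x hx t ht u).2.2]
      change ψ x t * u + β x t = _
      rw [eψ x hx t ht, eξ x hx t ht]
      rfl
  · rintro ⟨G, β, hG, hβ, hform⟩
    have eτ : ∀ t ∈ J, τ x₀ t 0 = G.τ t := fun t ht => (hform x₀ hx₀ t ht 0).2.1
    have eψ : ∀ x ∈ I, ∀ t ∈ J, φ x t 1 - φ x t 0 = μ x * G.ξ x t + G.g x t := by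
      intro x hx t ht
      rw [(hform x hx t ht 1).2.2, (hform x hx t ht 0).2.2]
      ring
    refine (isInfinitesimalSymmetry_iff hI hJ sξ sψ hβ.1 sτ fun x hx t ht u => ?_).2 ?_
    · rw [(hform x hx t ht u).1, (hform x hx t ht u).2.1, (hform x hx t ht u).2.2, eτ t ht,
        eψ x hx t ht, (hform x hx t ht 0).1]
      exact ⟨rfl, rfl, rfl⟩
    · intro x hx t ht
      obtain ⟨h1, h2, h3⟩ := coeff_u_eq_laurent (G := G) hd hE hED hI hIE hJ ht
        (hG.deriv_τ₁ t ht) (hG.deriv_τ₂ t ht) (hG.deriv_s t ht) (hG.deriv_s₁ t ht)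
        (hG.deriv_k t ht) (fun x hx t ht => (hform x hx t ht 0).1) eψ hx
      have h4 : deriv (fun t => τ x₀ t 0) t = G.τ₁ t :=
        (hasDerivAt_congr_on hJ ht (hG.deriv_τ t ht) eτ).deriv
      refine ⟨?_, h2, ?_, hβ.2 x t ⟨hx, ht⟩⟩
      · rw [h4, h1]
        ring
      · rw [h4, h3, hG.D_mul_s t ht]
        ring

end Determining

/-! ### Complete lists of symmetries -/

namespace GenData

variable {A B C D : ℝ} {J : Set ℝ} {n : ℕ}

/-- Linear combinations. -/
noncomputable def lin (c : Fin n → ℝ) (G : Fin n → GenData) : GenData where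
  τ t := ∑ i, c i * (G i).τ t
  τ₁ t := ∑ i, c i * (G i).τ₁ t
  τ₂ t := ∑ i, c i * (G i).τ₂ t
  s t := ∑ i, c i * (G i).s t
  s₁ t := ∑ i, c i * (G i).s₁ t
  k t := ∑ i, c i * (G i).k t

theorem lin_ξ (c : Fin n → ℝ) (G : Fin n → GenData) (x t : ℝ) :
    (lin c G).ξ x t = ∑ i, c i * (G i).ξ x t := by
  simp only [ξ, lin, Finset.sum_div, Finset.sum_mul, ← Finset.sum_add_distrib]
  exact Finset.sum_congr rfl fun i _ => by ring

theorem lin_g (c : Fin n → ℝ) (G : Fin n → GenData) (x t : ℝ) :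
    (lin c G).g x t = ∑ i, c i * (G i).g x t := by
  simp only [g, lin, Finset.sum_div, Finset.sum_mul, ← Finset.sum_add_distrib,
    ← Finset.sum_neg_distrib]
  exact Finset.sum_congr rfl fun i _ => by ring

theorem Determining.lin {G : Fin n → GenData} (h : ∀ i, (G i).Determining A B C D J)
    (c : Fin n → ℝ) : (lin c G).Determining A B C D J := by
  constructor <;> intro t ht <;> simp only [GenData.lin]
  · exact HasDerivAt.fun_sum fun i _ => ((h i).deriv_τ t ht).const_mul (c i)
  · exact HasDerivAt.fun_sum fun i _ => ((h i).deriv_τ₁ t ht).const_mul (c i)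
  · refine (HasDerivAt.fun_sum fun i _ => ((h i).deriv_τ₂ t ht).const_mul (c i)).congr_deriv ?_
    simp only [Finset.mul_sum]
    exact Finset.sum_congr rfl fun i _ => by ring
  · exact HasDerivAt.fun_sum fun i _ => ((h i).deriv_s t ht).const_mul (c i)
  · refine (HasDerivAt.fun_sum fun i _ => ((h i).deriv_s₁ t ht).const_mul (c i)).congr_deriv ?_
    simp only [Finset.mul_sum, ← Finset.sum_add_distrib]
    exact Finset.sum_congr rfl fun i _ => by ring
  · refine (HasDerivAt.fun_sum fun i _ => ((h i).deriv_k t ht).const_mul (c i)).congr_deriv ?_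
    simp only [Finset.mul_sum, ← Finset.sum_neg_distrib, Finset.sum_div, ← Finset.sum_sub_distrib]
    exact Finset.sum_congr rfl fun i _ => by ring
  · simp only [Finset.mul_sum]
    refine Finset.sum_eq_zero fun i _ => ?_
    linear_combination c i * (h i).D_mul_s t ht

theorem Determining.mono {G : GenData} {J' : Set ℝ} (h : G.Determining A B C D J') (hJ : J ⊆ J') :
    G.Determining A B C D J :=
  ⟨fun t ht => h.1 t (hJ ht), fun t ht => h.2 t (hJ ht), fun t ht => h.3 t (hJ ht),
    fun t ht => h.4 t (hJ ht), fun t ht => h.5 t (hJ ht), fun t ht => h.6 t (hJ ht),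
    fun t ht => h.7 t (hJ ht)⟩

theorem Determining.ext_on {G H : GenData} (hJ : IsOpen J) (hG : G.Determining A B C D J)
    (hH : H.Determining A B C D J)
    (h : ∀ t ∈ J, G.τ t = H.τ t ∧ G.s t = H.s t ∧ G.k t = H.k t) {t : ℝ} (ht : t ∈ J) (x : ℝ) :
    G.ξ x t = H.ξ x t ∧ G.g x t = H.g x t := by
  have h1 : ∀ t ∈ J, G.τ₁ t = H.τ₁ t := fun t ht =>
    deriv_unique_on hJ ht (hG.deriv_τ t ht) (hH.deriv_τ t ht) fun r hr => (h r hr).1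
  have h2 := deriv_unique_on hJ ht (hG.deriv_τ₁ t ht) (hH.deriv_τ₁ t ht) h1
  have h3 := deriv_unique_on hJ ht (hG.deriv_s t ht) (hH.deriv_s t ht) fun r hr => (h r hr).2.1
  unfold ξ g
  rw [h1 t ht, h2, h3, (h t ht).2.1, (h t ht).2.2]
  exact ⟨rfl, rfl⟩

end GenData

theorem IsSolution.add {μ : ℝ → ℝ} {O : Set (ℝ × ℝ)} (hO : IsOpen O) {u v : ℝ → ℝ → ℝ}
    (hu : IsSolution μ O u) (hv : IsSolution μ O v) :
    IsSolution μ O fun x t => u x t + v x t := by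
  have su : SmoothOn₂ O u := hu.1
  have sv : SmoothOn₂ O v := hv.1
  refine ⟨su.add sv, fun x t hp => ?_⟩
  have d1 : ∀ y, (y, t) ∈ O → HasDerivAt (fun y => u y t + v y t) (dx u y t + dx v y t) y :=
    fun y hy => (su.hasDerivAt_dx hO hy).add (sv.hasDerivAt_dx hO hy)
  have d2 : deriv (deriv fun y => u y t + v y t) x = dx (dx u) x t + dx (dx v) x t := by
    rw [Filter.EventuallyEq.deriv_eq
      ((eventually_mem_inl hO hp).mono fun z hz => (d1 z hz).deriv)]
    exact HasDerivAt.deriv (((su.smooth_dx hO).hasDerivAt_dx hO hp).add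
      ((sv.smooth_dx hO).hasDerivAt_dx hO hp))
  have d3 : deriv (fun s => u x s + v x s) t = dt u x t + dt v x t :=
    HasDerivAt.deriv ((su.hasDerivAt_dt hO hp).add (sv.hasDerivAt_dt hO hp))
  have e1 : dt u x t = 1 / 2 * dx (dx u) x t - μ x * dx u x t - deriv μ x * u x t := hu.2 x t hp
  have e2 : dt v x t = 1 / 2 * dx (dx v) x t - μ x * dx v x t - deriv μ x * v x t := hv.2 x t hp
  rw [d2, d3, (d1 x hp).deriv, e1, e2]
  ring

/-- Groups of symmetries form a complete list as soon as their generators form a basis of the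
solutions of the determining equations, over every interval. -/
theorem isSymmetryList_of_basis {A B C D : ℝ} {E : Set ℝ} {μ θ : ℝ → ℝ} {n : ℕ}
    {S : Fin n → ℝ → Transf} {G : Fin n → GenData} (hd : IsDrift (potential A B C D) E μ θ)
    (hE : IsOpen E) (hED : ∀ x ∈ E, D = 0 ∨ x ≠ 0)
    (hgen : ∀ i, HasGenerator (S i) (G i).ξ (G i).τ (G i).g)
    (hdet : ∀ i, (G i).Determining A B C D Set.univ)
    (hsymm : ∀ i ε, (S i ε).IsHeatSymmetry (potential A B C D))
    (hspan : ∀ J : Set ℝ, IsOpen J → J.OrdConnected → J.Nonempty → ∀ H : GenData,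
      H.Determining A B C D J → ∃ c : Fin n → ℝ, ∀ t ∈ J, H.τ t = ∑ i, c i * (G i).τ t ∧
        H.s t = ∑ i, c i * (G i).s t ∧ H.k t = ∑ i, c i * (G i).k t)
    (hindep : ∀ J : Set ℝ, IsOpen J → J.Nonempty → ∀ c : Fin n → ℝ,
      (∀ t ∈ J, ∑ i, c i * (G i).τ t = 0 ∧ ∑ i, c i * (G i).s t = 0 ∧
        ∑ i, c i * (G i).k t = 0) → c = 0) :
    IsSymmetryList μ θ E S := by
  have hgX : ∀ (c : Fin n → ℝ) x t, ∑ i, c i * genX (S i) x t = (GenData.lin c G).ξ x t :=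
    fun c x t => by simp only [GenData.lin_ξ, (hgen _).genX_eq]
  have hgT : ∀ (c : Fin n → ℝ) t, ∑ i, c i * genT (S i) t = (GenData.lin c G).τ t :=
    fun c t => by simp only [GenData.lin, (hgen _).genT_eq]
  have hgU : ∀ (c : Fin n → ℝ), ∀ x ∈ E, ∀ t, ∑ i, c i * genU θ (S i) x t =
      μ x * (GenData.lin c G).ξ x t + (GenData.lin c G).g x t := fun c x hx t => by
    simp only [GenData.lin_ξ, GenData.lin_g, (hgen _).genU_eq hd hx, Finset.mul_sum,
      ← Finset.sum_add_distrib]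
    exact Finset.sum_congr rfl fun i _ => by ring
  have hlin : ∀ (c : Fin n → ℝ) (J : Set ℝ), (GenData.lin c G).Determining A B C D J :=
    fun c J => (GenData.Determining.lin hdet c).mono (Set.subset_univ J)
  refine ⟨fun i => (hgen i).isOneParameterGroup hd, fun i ε => (hsymm i ε).isSymmetry hd hE,
    fun O hO _ β U hβ hU => hβ.add hO hU, ?_, ?_⟩
  · intro I J hI hI' hIn hIE hJ hJ' hJn ξ τ φ hξ hτ hφ
    rw [isInfinitesimalSymmetry_iff_determining hd hE hED hI hI' hIn hIE hJ hξ hτ hφ]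
    constructor
    · rintro ⟨H, β, hH, hβ, hform⟩
      obtain ⟨c, hc⟩ := hspan J hJ hJ' hJn H hH
      refine ⟨c, β, hβ, fun x hx t ht u => ?_⟩
      obtain ⟨e1, e2⟩ := GenData.Determining.ext_on hJ hH (hlin c J) hc ht x
      obtain ⟨f1, f2, f3⟩ := hform x hx t ht u
      rw [f1, f2, f3, hgX, hgT, hgU c x (hIE hx), e1, e2]
      exact ⟨rfl, (hc t ht).1, rfl⟩
    · rintro ⟨c, β, hβ, hform⟩
      refine ⟨GenData.lin c G, β, hlin c J, hβ, fun x hx t ht u => ?_⟩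
      rw [← hgU c x (hIE hx), ← hgX, ← hgT]
      exact hform x hx t ht u
  · intro I J hI _ hIn hIE hJ _ hJn c hc
    obtain ⟨x, hx⟩ := hIn
    have h0 : GenData.Determining A B C D J ⟨0, 0, 0, 0, 0, 0⟩ := by
      constructor <;> intro t _ <;> simp
    have hτ : ∀ t ∈ J, (GenData.lin c G).τ t = 0 := fun t ht => by
      rw [← hgT]
      exact (hc x hx t ht).2.1
    have hτ₁ : ∀ t ∈ J, (GenData.lin c G).τ₁ t = 0 := fun t ht =>
      deriv_unique_on hJ ht ((hlin c J).deriv_τ t ht) (h0.deriv_τ t ht) hτ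
    have hτ₂ : ∀ t ∈ J, (GenData.lin c G).τ₂ t = 0 := fun t ht =>
      deriv_unique_on hJ ht ((hlin c J).deriv_τ₁ t ht) (h0.deriv_τ₁ t ht) hτ₁
    have hξ : ∀ t ∈ J, (GenData.lin c G).ξ x t = 0 := fun t ht => by
      rw [← hgX]
      exact (hc x hx t ht).1
    have hs : ∀ t ∈ J, (GenData.lin c G).s t = 0 := fun t ht => by
      have := hξ t ht
      rw [GenData.ξ, hτ₁ t ht] at this
      linarith
    have hs₁ : ∀ t ∈ J, (GenData.lin c G).s₁ t = 0 := fun t ht =>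
      deriv_unique_on hJ ht ((hlin c J).deriv_s t ht) (h0.deriv_s t ht) hs
    refine hindep J hJ hJn c fun t ht => ⟨hτ t ht, hs t ht, ?_⟩
    have := (hc x hx t ht).2.2
    rw [hgU c x (hIE hx), hξ t ht, GenData.g, hτ₂ t ht, hs₁ t ht] at this
    change (GenData.lin c G).k t = 0
    linarith

theorem exists_eq_const {J : Set ℝ} {h : ℝ → ℝ} (hJ : IsOpen J) (hJ' : J.OrdConnected)
    (hJn : J.Nonempty) (hh : ∀ t ∈ J, HasDerivAt h 0 t) : ∃ c, ∀ t ∈ J, h t = c := by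
  obtain ⟨t₀, ht₀⟩ := hJn
  exact ⟨h t₀, fun t ht => eq_of_hasDerivAt_zero hJ hJ' hh ht ht₀⟩

/-- The generator of the time translations. -/
def timeShiftData : GenData :=
  ⟨fun _ => 1, fun _ => 0, fun _ => 0, fun _ => 0, fun _ => 0, fun _ => 0⟩

/-- The generator of the multiplications by constants. -/
def rescaleData : GenData :=
  ⟨fun _ => 0, fun _ => 0, fun _ => 0, fun _ => 0, fun _ => 0, fun _ => -1⟩

theorem timeShiftData_hasGenerator :
    HasGenerator timeShift timeShiftData.ξ timeShiftData.τ timeShiftData.g := by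
  convert timeShift_hasGenerator using 1 <;> funext x <;> (try funext t) <;>
    simp [timeShiftData, GenData.ξ, GenData.g]

theorem rescaleData_hasGenerator :
    HasGenerator rescale rescaleData.ξ rescaleData.τ rescaleData.g := by
  convert rescale_hasGenerator using 1 <;> funext x <;> (try funext t) <;>
    simp [rescaleData, GenData.ξ, GenData.g]

theorem timeShiftData_determining (A B C D : ℝ) (J : Set ℝ) :
    timeShiftData.Determining A B C D J := by
  constructor <;> intro t _ <;> simp only [timeShiftData] <;>
    first | exact (hasDerivAt_const t _).congr_deriv (by simp) | simp

theorem rescaleData_determining (A B C D : ℝ) (J : Set ℝ) :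
    rescaleData.Determining A B C D J := by
  constructor <;> intro t _ <;> simp only [rescaleData] <;>
    first | exact (hasDerivAt_const t _).congr_deriv (by simp) | simp

/-- For `A = 0`, the solutions of the determining equations are polynomials in `t`. -/
theorem GenData.Determining.eq_polynomial {B C D : ℝ} {J : Set ℝ} {H : GenData} (hJ : IsOpen J)
    (hJ' : J.OrdConnected) (hJn : J.Nonempty) (h : H.Determining 0 B C D J) :
    ∃ a₀ a₁ a₂ b₀ b₁ k₀ : ℝ, ∀ t ∈ J, H.τ t = a₀ + a₁ * t + a₂ * t ^ 2 / 2 ∧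
      H.s t = b₀ + b₁ * t + 3 / 2 * B * a₁ * t ^ 2 + B * a₂ * t ^ 3 / 2 ∧
      H.k t = k₀ - a₂ * t / 4 - C * (a₁ * t + a₂ * t ^ 2 / 2)
        - 2 * B * (b₀ * t + b₁ * t ^ 2 / 2 + B * a₁ * t ^ 3 / 2 + B * a₂ * t ^ 4 / 8) := by
  have dp : ∀ (n : ℕ) (c t : ℝ), HasDerivAt (fun t => c * t ^ (n + 1))
      (c * ((n + 1) * t ^ n)) t := fun n c t => by
    simpa using (hasDerivAt_pow (n + 1) t).const_mul c
  obtain ⟨a₂, ha₂⟩ := exists_eq_const hJ hJ' hJn fun t ht =>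
    (h.deriv_τ₂ t ht).congr_deriv (by simp)
  obtain ⟨a₁, ha₁⟩ := exists_eq_const hJ hJ' hJn fun t ht =>
    ((h.deriv_τ₁ t ht).sub (dp 0 a₂ t)).congr_deriv (by simp [ha₂ t ht])
  obtain ⟨a₀, ha₀⟩ := exists_eq_const hJ hJ' hJn fun t ht =>
    ((h.deriv_τ t ht).sub ((dp 0 a₁ t).add (dp 1 (a₂ / 2) t))).congr_deriv (by
      have := ha₁ t ht
      simp only [Pi.sub_apply] at this
      push_cast
      linear_combination this)
  obtain ⟨b₁, hb₁⟩ := exists_eq_const hJ hJ' hJn fun t ht =>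
    ((h.deriv_s₁ t ht).sub ((dp 0 (3 * B * a₁) t).add (dp 1 (3 * B * a₂ / 2) t))).congr_deriv (by
      have := ha₁ t ht
      simp only [Pi.sub_apply] at this
      push_cast
      linear_combination 3 * B * this)
  obtain ⟨b₀, hb₀⟩ := exists_eq_const hJ hJ' hJn fun t ht =>
    ((h.deriv_s t ht).sub (((dp 0 b₁ t).add (dp 1 (3 / 2 * B * a₁) t)).add
      (dp 2 (B * a₂ / 2) t))).congr_deriv (by
      have := hb₁ t ht
      simp only [Pi.sub_apply, Pi.add_apply] at this
      push_cast
      linear_combination this)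
  obtain ⟨k₀, hk₀⟩ := exists_eq_const hJ hJ' hJn fun t ht =>
    ((h.deriv_k t ht).add ((((dp 0 (a₂ / 4 + C * a₁ + 2 * B * b₀) t).add
      (dp 1 (C * a₂ / 2 + B * b₁) t)).add (dp 2 (B ^ 2 * a₁) t)).add
      (dp 3 (B ^ 2 * a₂ / 4) t))).congr_deriv (by
      have h1 := ha₁ t ht
      have h2 := hb₀ t ht
      simp only [Pi.sub_apply, Pi.add_apply] at h1 h2
      rw [ha₂ t ht]
      push_cast
      linear_combination (-C) * h1 - 2 * B * h2)
  refine ⟨a₀, a₁, a₂, b₀, b₁, k₀, fun t ht => ?_⟩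
  have h1 := ha₀ t ht
  have h2 := hb₀ t ht
  have h3 := hk₀ t ht
  simp only [Pi.sub_apply, Pi.add_apply] at h1 h2 h3
  exact ⟨by linarith, by linarith, by linarith⟩

theorem hasDerivAt_of_quartic {f : ℝ → ℝ} {f' t : ℝ} (a b c d e : ℝ)
    (hf : ∀ t, f t = a + b * t + c * t ^ 2 + d * t ^ 3 + e * t ^ 4)
    (hf' : f' = b + 2 * c * t + 3 * d * t ^ 2 + 4 * e * t ^ 3) : HasDerivAt f f' t := by
  rw [funext hf, hf']
  refine (((((hasDerivAt_id t).const_mul b).const_add a).add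
    ((hasDerivAt_pow 2 t).const_mul c)).add ((hasDerivAt_pow 3 t).const_mul d)).add
    ((hasDerivAt_pow 4 t).const_mul e) |>.congr_deriv ?_
  push_cast
  ring

theorem HasGenerator.of_eq {S : ℝ → Transf} {ξ : ℝ → ℝ → ℝ} {τ : ℝ → ℝ} {g : ℝ → ℝ → ℝ}
    {G : GenData} (h : HasGenerator S ξ τ g) (hξ : ∀ x t, G.ξ x t = ξ x t) (hτ : ∀ t, G.τ t = τ t)
    (hg : ∀ x t, G.g x t = g x t) : HasGenerator S G.ξ G.τ G.g := by
  obtain rfl : G.ξ = ξ := funext₂ hξ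
  obtain rfl : G.τ = τ := funext hτ
  obtain rfl : G.g = g := funext₂ hg
  exact h

namespace F1

/-- The generator of `ε ↦ S₁^{1,ε}`. -/
noncomputable def two1Data (B C : ℝ) : GenData :=
  ⟨fun t => -t ^ 2, fun t => -2 * t, fun _ => -2, fun t => -B * t ^ 3, fun t => -3 * B * t ^ 2,
    fun t => t / 2 + B ^ 2 * t ^ 4 / 2 + C * t ^ 2⟩

/-- The generator of the scalings. -/
noncomputable def scalingData (B C : ℝ) : GenData :=
  ⟨fun t => -t, fun _ => -1, fun _ => 0, fun t => -3 / 2 * B * t ^ 2, fun t => -3 * B * t,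
    fun t => B ^ 2 * t ^ 3 + C * t⟩

/-- The generator of `ε ↦ S₂^{0,ε}`. -/
noncomputable def two2Data (B : ℝ) : GenData :=
  ⟨fun _ => 0, fun _ => 0, fun _ => 0, fun t => -t, fun _ => -1, fun t => B * t ^ 2⟩

/-- The generator of the space translations. -/
noncomputable def spaceShiftData (B : ℝ) : GenData :=
  ⟨fun _ => 0, fun _ => 0, fun _ => 0, fun _ => -1, fun _ => 0, fun t => 2 * B * t⟩

theorem two1Data_determining (B C : ℝ) : (two1Data B C).Determining 0 B C 0 Set.univ where
  deriv_τ t _ := hasDerivAt_of_quartic 0 0 (-1) 0 0 (fun t => by simp [two1Data])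
    (by simp [two1Data])
  deriv_τ₁ t _ := hasDerivAt_of_quartic 0 (-2) 0 0 0 (fun t => by simp [two1Data])
    (by simp [two1Data])
  deriv_τ₂ t _ := hasDerivAt_of_quartic (-2) 0 0 0 0 (fun t => by simp [two1Data])
    (by simp [two1Data])
  deriv_s t _ := hasDerivAt_of_quartic 0 0 0 (-B) 0 (fun t => by simp [two1Data])
    (by simp [two1Data])
  deriv_s₁ t _ := hasDerivAt_of_quartic 0 0 (-3 * B) 0 0 (fun t => by simp [two1Data])
    (by simp [two1Data]; ring)
  deriv_k t _ := hasDerivAt_of_quartic 0 (1 / 2) C 0 (B ^ 2 / 2)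
    (fun t => by simp only [two1Data]; ring) (by simp only [two1Data]; ring)
  D_mul_s t _ := zero_mul _

theorem scalingData_determining (B C : ℝ) : (scalingData B C).Determining 0 B C 0 Set.univ where
  deriv_τ t _ := hasDerivAt_of_quartic 0 (-1) 0 0 0 (fun t => by simp [scalingData])
    (by simp [scalingData])
  deriv_τ₁ t _ := hasDerivAt_of_quartic (-1) 0 0 0 0 (fun t => by simp [scalingData])
    (by simp [scalingData])
  deriv_τ₂ t _ := hasDerivAt_of_quartic 0 0 0 0 0 (fun t => by simp [scalingData])
    (by simp [scalingData])
  deriv_s t _ := hasDerivAt_of_quartic 0 0 (-3 / 2 * B) 0 0 (fun t => by simp [scalingData])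
    (by simp only [scalingData]; ring)
  deriv_s₁ t _ := hasDerivAt_of_quartic 0 (-3 * B) 0 0 0 (fun t => by simp [scalingData])
    (by simp [scalingData])
  deriv_k t _ := hasDerivAt_of_quartic 0 C 0 (B ^ 2) 0
    (fun t => by simp only [scalingData]; ring) (by simp only [scalingData]; ring)
  D_mul_s t _ := zero_mul _

theorem two2Data_determining (B C : ℝ) : (two2Data B).Determining 0 B C 0 Set.univ where
  deriv_τ t _ := hasDerivAt_const t _
  deriv_τ₁ t _ := hasDerivAt_const t _
  deriv_τ₂ t _ := (hasDerivAt_const t _).congr_deriv (by simp [two2Data])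
  deriv_s t _ := hasDerivAt_neg t
  deriv_s₁ t _ := (hasDerivAt_const t _).congr_deriv (by simp [two2Data])
  deriv_k t _ := hasDerivAt_of_quartic 0 0 B 0 0 (fun t => by simp [two2Data])
    (by simp [two2Data])
  D_mul_s t _ := zero_mul _

theorem spaceShiftData_determining (B C : ℝ) :
    (spaceShiftData B).Determining 0 B C 0 Set.univ where
  deriv_τ t _ := hasDerivAt_const t _
  deriv_τ₁ t _ := hasDerivAt_const t _
  deriv_τ₂ t _ := (hasDerivAt_const t _).congr_deriv (by simp [spaceShiftData])
  deriv_s t _ := hasDerivAt_const t _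
  deriv_s₁ t _ := (hasDerivAt_const t _).congr_deriv (by simp [spaceShiftData])
  deriv_k t _ := hasDerivAt_of_quartic 0 (2 * B) 0 0 0 (fun t => by simp [spaceShiftData])
    (by simp [spaceShiftData])
  D_mul_s t _ := zero_mul _

theorem isSymmetryList {B C : ℝ} {E : Set ℝ} {μ θ : ℝ → ℝ} (hE : IsOpen E)
    (hd : IsDrift (fun x => 4 * B * x + 2 * C) E μ θ) : IsSymmetryList μ θ E (F1.list B C) := by
  have hV : potential 0 B C 0 = fun x => 4 * B * x + 2 * C := by
    funext x
    simp [potential]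
  refine isSymmetryList_of_basis (D := 0) (G := ![two1Data B C, scalingData B C, two2Data B,
    spaceShiftData B, timeShiftData, rescaleData]) (hV ▸ hd) hE (fun _ _ => Or.inl rfl) ?_ ?_ ?_
    ?_ ?_
  · refine Fin.cases ?_ (Fin.cases ?_ (Fin.cases ?_ (Fin.cases ?_ (Fin.cases ?_ (Fin.cases ?_
      fun i => i.elim0)))))
    · exact (two1_hasGenerator B C).of_eq (G := two1Data B C)
        (fun x t => by simp only [two1Data, GenData.ξ]; ring) (fun t => rfl)
        (fun x t => by simp only [two1Data, GenData.g]; ring)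
    · exact (scaling_hasGenerator B C).of_eq (G := scalingData B C)
        (fun x t => by simp only [scalingData, GenData.ξ]; ring) (fun t => rfl)
        (fun x t => by simp only [scalingData, GenData.g]; ring)
    · exact (two2_hasGenerator B).of_eq (G := two2Data B)
        (fun x t => by simp [two2Data, GenData.ξ]) (fun t => rfl)
        (fun x t => by simp [two2Data, GenData.g])
    · exact (spaceShift_hasGenerator B).of_eq (G := spaceShiftData B)
        (fun x t => by simp [spaceShiftData, GenData.ξ]) (fun t => rfl)
        (fun x t => by simp [spaceShiftData, GenData.g])
    · exact timeShiftData_hasGenerator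
    · exact rescaleData_hasGenerator
  · exact Fin.cases (two1Data_determining B C) (Fin.cases (scalingData_determining B C)
      (Fin.cases (two2Data_determining B C) (Fin.cases (spaceShiftData_determining B C)
      (Fin.cases (timeShiftData_determining _ _ _ _ _) (Fin.cases
      (rescaleData_determining _ _ _ _ _) fun i => i.elim0)))))
  · rw [hV]
    refine Fin.cases ?_ (Fin.cases ?_ (Fin.cases ?_ (Fin.cases ?_ (Fin.cases ?_ (Fin.cases ?_
      fun i => i.elim0)))))
    · exact fun ε => two1_isHeatSymmetry B C one_ne_zero ε
    · exact F1.scaling_isHeatSymmetry B C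
    · exact F1.two2_isHeatSymmetry B C 0
    · intro ε
      change (spaceShift B ε).IsHeatSymmetry _
      rw [spaceShift_eq]
      exact two2_isHeatSymmetry B C ε 0
    · exact timeShift_isHeatSymmetry _
    · exact rescale_isHeatSymmetry _
  · intro J hJ hJ' hJn H hH
    obtain ⟨a₀, a₁, a₂, b₀, b₁, k₀, h⟩ := hH.eq_polynomial hJ hJ' hJn
    -- The six generators have `τ = -t², -t, 0, 0, 1, 0`; the coefficients are read off from the
    -- polynomials `τ`, then `s`, then `k`.
    refine ⟨![-a₂ / 2, -a₁, -b₁, -b₀, a₀, -k₀], fun t ht => ?_⟩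
    obtain ⟨h1, h2, h3⟩ := h t ht
    simp only [Fin.sum_univ_six, two1Data, scalingData, two2Data, spaceShiftData,
      timeShiftData, rescaleData]
    simp
    rw [h1, h2, h3]
    exact ⟨by ring, by ring, by ring⟩
  · intro J hJ hJn c hc
    have hinf := infinite_of_isOpen hJ hJn
    simp only [Fin.sum_univ_six, two1Data, scalingData, two2Data, spaceShiftData,
      timeShiftData, rescaleData] at hc
    simp at hc
    obtain ⟨h0, h1, h4, -⟩ := laurent_coeffs_eq_zero (d := 0) hinf fun t ht => by
      show -c 0 * t ^ 2 + -c 1 * t + c 4 + 0 / t ^ 3 = 0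
      linear_combination (hc t ht).1
    have h0' : c 0 = 0 := by linarith
    have h1' : c 1 = 0 := by linarith
    obtain ⟨h2, h3⟩ := linear_coeffs_eq_zero hinf fun t ht => by
      show -c 2 * t + -c 3 = 0
      have := (hc t ht).2.1
      rw [h0', h1'] at this
      linear_combination this
    have h2' : c 2 = 0 := by linarith
    have h3' : c 3 = 0 := by linarith
    obtain ⟨t, ht⟩ := hJn
    have h5 := (hc t ht).2.2
    rw [h0', h1', h2', h3'] at h5
    have h5' : c 5 = 0 := by linarith
    funext i
    fin_cases i <;> assumption

end F1

/-! ### The complete lists for the families with exponentials or a pole -/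

theorem exists_eq_const_mul_exp {J : Set ℝ} {h : ℝ → ℝ} {k : ℝ} (hJ : IsOpen J)
    (hJ' : J.OrdConnected) (hJn : J.Nonempty) (hh : ∀ t ∈ J, HasDerivAt h (k * h t) t) :
    ∃ p, ∀ t ∈ J, h t = p * Real.exp (k * t) := by
  obtain ⟨p, hp⟩ := exists_eq_const (h := fun t => h t * Real.exp (-k * t)) hJ hJ' hJn fun t ht =>
    ((hh t ht).mul (hasDerivAt_exp_mul (-k) t)).congr_deriv (by ring)
  refine ⟨p, fun t ht => ?_⟩
  rw [← hp t ht, mul_assoc, ← Real.exp_add]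
  simp

theorem exp_coeffs_eq_zero {J : Set ℝ} {k p q r : ℝ} (hJ : IsOpen J) (hJn : J.Nonempty)
    (hk : k ≠ 0) (h : ∀ t ∈ J, p * Real.exp (k * t) + q * Real.exp (-(k * t)) + r = 0) :
    p = 0 ∧ q = 0 ∧ r = 0 := by
  have hinf : ((fun t => Real.exp (k * t)) '' J).Infinite :=
    (infinite_of_isOpen hJ hJn).image fun s _ t _ hst =>
      mul_left_cancel₀ hk (Real.exp_injective hst)
  obtain ⟨h1, h2, h3, -⟩ := laurent_coeffs_eq_zero (a := p) (b := r) (c := q) (d := 0) hinf (by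
    rintro _ ⟨t, ht, rfl⟩
    have := h t ht
    rw [Real.exp_neg] at this
    have h0 := (Real.exp_pos (k * t)).ne'
    simp only at *
    generalize Real.exp (k * t) = y at *
    field_simp at this
    simpa using by linear_combination this)
  exact ⟨h1, h3, h2⟩

theorem GenData.Determining.exists_k_eq {A B C D : ℝ} {J : Set ℝ} {G H : GenData} (hJ : IsOpen J)
    (hJ' : J.OrdConnected) (hJn : J.Nonempty) (hG : G.Determining A B C D J)
    (hH : H.Determining A B C D J) (h : ∀ t ∈ J, H.τ t = G.τ t ∧ H.s t = G.s t) :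
    ∃ k, ∀ t ∈ J, H.k t = G.k t + k := by
  have h1 : ∀ t ∈ J, H.τ₁ t = G.τ₁ t := fun t ht =>
    deriv_unique_on hJ ht (hH.deriv_τ t ht) (hG.deriv_τ t ht) fun r hr => (h r hr).1
  have h2 : ∀ t ∈ J, H.τ₂ t = G.τ₂ t := fun t ht =>
    deriv_unique_on hJ ht (hH.deriv_τ₁ t ht) (hG.deriv_τ₁ t ht) h1
  obtain ⟨k, hk⟩ := exists_eq_const hJ hJ' hJn fun t ht =>
    ((hH.deriv_k t ht).sub (hG.deriv_k t ht)).congr_deriv (by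
      rw [h1 t ht, h2 t ht, (h t ht).2, sub_self])
  exact ⟨k, fun t ht => by rw [← hk t ht, Pi.sub_apply]; ring⟩

theorem hasDerivAt_const_mul_exp (p k t : ℝ) :
    HasDerivAt (fun t => p * Real.exp (k * t)) (p * (k * Real.exp (k * t))) t :=
  (hasDerivAt_exp_mul k t).const_mul p

namespace F3

/-- The generator of `ε ↦ S₁^{1,ε}`. -/
noncomputable def two1Data (C : ℝ) : GenData :=
  ⟨fun t => -t ^ 2, fun t => -2 * t, fun _ => -2, fun _ => 0, fun _ => 0,
    fun t => t / 2 + C * t ^ 2⟩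

/-- The generator of the scalings. -/
noncomputable def scalingData (C : ℝ) : GenData :=
  ⟨fun t => -t, fun _ => -1, fun _ => 0, fun _ => 0, fun _ => 0, fun t => C * t⟩

theorem two1Data_determining (C D : ℝ) : (two1Data C).Determining 0 0 C D Set.univ where
  deriv_τ t _ := hasDerivAt_of_quartic 0 0 (-1) 0 0 (fun t => by simp [two1Data])
    (by simp [two1Data])
  deriv_τ₁ t _ := hasDerivAt_of_quartic 0 (-2) 0 0 0 (fun t => by simp [two1Data])
    (by simp [two1Data])
  deriv_τ₂ t _ := (hasDerivAt_const t _).congr_deriv (by simp)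
  deriv_s t _ := hasDerivAt_const t _
  deriv_s₁ t _ := (hasDerivAt_const t _).congr_deriv (by simp [two1Data])
  deriv_k t _ := hasDerivAt_of_quartic 0 (1 / 2) C 0 0
    (fun t => by simp only [two1Data]; ring) (by simp only [two1Data]; ring)
  D_mul_s t _ := mul_zero _

theorem scalingData_determining (C D : ℝ) : (scalingData C).Determining 0 0 C D Set.univ where
  deriv_τ t _ := hasDerivAt_neg t
  deriv_τ₁ t _ := hasDerivAt_const t _
  deriv_τ₂ t _ := (hasDerivAt_const t _).congr_deriv (by simp)
  deriv_s t _ := hasDerivAt_const t _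
  deriv_s₁ t _ := (hasDerivAt_const t _).congr_deriv (by simp [scalingData])
  deriv_k t _ := hasDerivAt_of_quartic 0 C 0 0 0 (fun t => by simp [scalingData])
    (by simp [scalingData])
  D_mul_s t _ := mul_zero _

theorem isSymmetryList {C D : ℝ} {E : Set ℝ} {μ θ : ℝ → ℝ} (hD : D ≠ 0) (hE : IsOpen E)
    (hE0 : E ⊆ Set.Ioi 0) (hd : IsDrift (fun x => 2 * C + D / x ^ 2) E μ θ) :
    IsSymmetryList μ θ E (F3.list C) := by
  have hV : potential 0 0 C D = fun x => 2 * C + D / x ^ 2 := by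
    funext x
    simp [potential]
  refine isSymmetryList_of_basis (G := ![two1Data C, scalingData C, timeShiftData, rescaleData])
    (hV ▸ hd) hE (fun x hx => Or.inr (hE0 hx).ne') ?_ ?_ ?_ ?_ ?_
  · refine Fin.cases ?_ (Fin.cases ?_ (Fin.cases ?_ (Fin.cases ?_ fun i => i.elim0)))
    · exact (two1_hasGenerator C).of_eq (G := two1Data C)
        (fun x t => by simp only [two1Data, GenData.ξ]; ring) (fun t => rfl)
        (fun x t => by simp only [two1Data, GenData.g]; ring)
    · exact (scaling_hasGenerator C).of_eq (G := scalingData C)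
        (fun x t => by simp only [scalingData, GenData.ξ]; ring) (fun t => rfl)
        (fun x t => by simp only [scalingData, GenData.g]; ring)
    · exact timeShiftData_hasGenerator
    · exact rescaleData_hasGenerator
  · exact Fin.cases (two1Data_determining C D) (Fin.cases (scalingData_determining C D)
      (Fin.cases (timeShiftData_determining _ _ _ _ _) (Fin.cases
      (rescaleData_determining _ _ _ _ _) fun i => i.elim0)))
  · rw [hV]
    refine Fin.cases ?_ (Fin.cases ?_ (Fin.cases ?_ (Fin.cases ?_ fun i => i.elim0)))
    · exact fun ε => two1_isHeatSymmetry C D one_pos ε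
    · exact scaling_isHeatSymmetry C D
    · exact timeShift_isHeatSymmetry _
    · exact rescale_isHeatSymmetry _
  · intro J hJ hJ' hJn H hH
    obtain ⟨a₀, a₁, a₂, b₀, b₁, k₀, h⟩ := hH.eq_polynomial hJ hJ' hJn
    have hs : ∀ t ∈ J, H.s t = 0 := fun t ht =>
      (mul_eq_zero.1 (hH.D_mul_s t ht)).resolve_left hD
    refine ⟨![-a₂ / 2, -a₁, a₀, -k₀], fun t ht => ?_⟩
    obtain ⟨h1, -, h3⟩ := h t ht
    simp only [Fin.sum_univ_four, two1Data, scalingData, timeShiftData, rescaleData]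
    simp
    rw [h1, h3, hs t ht]
    exact ⟨by ring, rfl, by ring⟩
  · intro J hJ hJn c hc
    simp only [Fin.sum_univ_four, two1Data, scalingData, timeShiftData, rescaleData] at hc
    simp at hc
    obtain ⟨h0, h1, h4, -⟩ := laurent_coeffs_eq_zero (d := 0) (infinite_of_isOpen hJ hJn)
      fun t ht => by
        show -c 0 * t ^ 2 + -c 1 * t + c 2 + 0 / t ^ 3 = 0
        linear_combination (hc t ht).1
    have h0' : c 0 = 0 := by linarith
    have h1' : c 1 = 0 := by linarith
    obtain ⟨t, ht⟩ := hJn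
    have h3 := (hc t ht).2
    rw [h0', h1'] at h3
    have h3' : c 3 = 0 := by linarith
    funext i
    fin_cases i <;> assumption

end F3

namespace F24

variable {a c ν σ C D : ℝ}

/-- The generator of the groups `inv`. -/
noncomputable def invData (a c ν σ : ℝ) : GenData :=
  ⟨fun t => -σ / (2 * a) * Real.exp (2 * a * σ * t), fun t => -1 * Real.exp (2 * a * σ * t),
    fun t => -2 * a * σ * Real.exp (2 * a * σ * t), fun t => -c / 2 * Real.exp (2 * a * σ * t),
    fun t => -a * c * σ * Real.exp (2 * a * σ * t),
    fun t => (σ * (a / 2) * c ^ 2 - σ * (ν + 1 / 4 - σ / 4)) * Real.exp (2 * a * σ * t)⟩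

/-- The generator of the groups `shift`. -/
noncomputable def shiftData (a c σ : ℝ) : GenData :=
  ⟨fun _ => 0, fun _ => 0, fun _ => 0, fun t => -1 * Real.exp (a * σ * t),
    fun t => -a * σ * Real.exp (a * σ * t), fun t => a * c * σ * Real.exp (a * σ * t)⟩

theorem invData_determining (ha : 0 < a) (hσ : σ ^ 2 = 1)
    (hC : C = a ^ 2 * c ^ 2 / 2 - 2 * a * (ν + 1 / 4)) (hD : D * c = 0) :
    (invData a c ν σ).Determining (a ^ 2) (a ^ 2 * c / 2) C D Set.univ where
  deriv_τ t _ := (hasDerivAt_const_mul_exp _ _ t).congr_deriv (by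
    simp only [invData]
    generalize Real.exp _ = y
    field_simp
    linear_combination (-y) * hσ)
  deriv_τ₁ t _ := (hasDerivAt_const_mul_exp _ _ t).congr_deriv (by simp only [invData]; ring)
  deriv_τ₂ t _ := (hasDerivAt_const_mul_exp _ _ t).congr_deriv (by
    simp only [invData]
    linear_combination (-4 * a ^ 2 * Real.exp (2 * a * σ * t)) * hσ)
  deriv_s t _ := (hasDerivAt_const_mul_exp _ _ t).congr_deriv (by simp only [invData]; ring)
  deriv_s₁ t _ := (hasDerivAt_const_mul_exp _ _ t).congr_deriv (by
    simp only [invData]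
    linear_combination (-2 * a ^ 2 * c * Real.exp (2 * a * σ * t)) * hσ)
  deriv_k t _ := (hasDerivAt_const_mul_exp _ _ t).congr_deriv (by
    simp only [invData, hC]
    linear_combination (Real.exp (2 * a * σ * t)) * (a ^ 2 * c ^ 2 - 2 * a * (ν + 1 / 4)
      + a * σ / 2) * hσ)
  D_mul_s t _ := by
    simp only [invData]
    linear_combination (-1 / 2 * Real.exp (2 * a * σ * t)) * hD

theorem shiftData_determining (hσ : σ ^ 2 = 1) :
    (shiftData a c σ).Determining (a ^ 2) (a ^ 2 * c / 2) C 0 Set.univ where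
  deriv_τ t _ := hasDerivAt_const t _
  deriv_τ₁ t _ := hasDerivAt_const t _
  deriv_τ₂ t _ := (hasDerivAt_const t _).congr_deriv (by simp [shiftData])
  deriv_s t _ := (hasDerivAt_const_mul_exp _ _ t).congr_deriv (by simp only [shiftData]; ring)
  deriv_s₁ t _ := (hasDerivAt_const_mul_exp _ _ t).congr_deriv (by
    simp only [shiftData]
    linear_combination (-a ^ 2 * Real.exp (a * σ * t)) * hσ)
  deriv_k t _ := (hasDerivAt_const_mul_exp _ _ t).congr_deriv (by
    simp only [shiftData]
    linear_combination (a ^ 2 * c * Real.exp (a * σ * t)) * hσ)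
  D_mul_s t _ := zero_mul _

theorem invData_hasGenerator (ha : 0 < a) (hσ : σ ^ 2 = 1) :
    HasGenerator (inv a c ν σ) (invData a c ν σ).ξ (invData a c ν σ).τ (invData a c ν σ).g := by
  have e : ∀ t, σ * (2 * a * t) = 2 * a * σ * t := fun t => by ring
  refine (inv_hasGenerator ha hσ).of_eq (fun x t => ?_) (fun t => ?_) fun x t => ?_ <;>
    simp only [invData, GenData.ξ, GenData.g, e] <;> ring

theorem shiftData_hasGenerator :
    HasGenerator (shift a c σ) (shiftData a c σ).ξ (shiftData a c σ).τ (shiftData a c σ).g := by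
  have e : ∀ t, σ * (a * t) = a * σ * t := fun t => by ring
  refine shift_hasGenerator.of_eq (fun x t => ?_) (fun t => ?_) fun x t => ?_ <;>
    simp only [shiftData, GenData.ξ, GenData.g, e] <;> ring

/-- First integrals of the determining equations. -/
theorem exists_eq_exp {J : Set ℝ} {B : ℝ} {H : GenData} (ha : 0 < a) (hB : B = a ^ 2 * c / 2)
    (hJ : IsOpen J) (hJ' : J.OrdConnected) (hJn : J.Nonempty)
    (h : H.Determining (a ^ 2) B C D J) :
    ∃ p q r u v : ℝ, ∀ t ∈ J,
      H.τ t = p * (invData a c ν 1).τ t + q * (invData a c ν (-1)).τ t + r ∧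
      H.s t = p * (invData a c ν 1).s t + q * (invData a c ν (-1)).s t
        + u * (shiftData a c 1).s t + v * (shiftData a c (-1)).s t := by
  obtain ⟨p₀, h₀⟩ := exists_eq_const (h := fun t => H.τ₂ t - 4 * a ^ 2 * H.τ t) hJ hJ' hJn
    fun t ht => ((h.deriv_τ₂ t ht).sub ((h.deriv_τ t ht).const_mul (4 * a ^ 2))).congr_deriv
      (by ring)
  obtain ⟨p₁, h₁⟩ := exists_eq_const_mul_exp (h := fun t => H.τ₂ t + 2 * a * H.τ₁ t) (k := 2 * a)
    hJ hJ' hJn fun t ht => ((h.deriv_τ₂ t ht).add ((h.deriv_τ₁ t ht).const_mul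
      (2 * a))).congr_deriv (by ring)
  obtain ⟨p₂, h₂⟩ := exists_eq_const_mul_exp (h := fun t => H.τ₂ t - 2 * a * H.τ₁ t)
    (k := -2 * a) hJ hJ' hJn fun t ht => ((h.deriv_τ₂ t ht).sub ((h.deriv_τ₁ t ht).const_mul
      (2 * a))).congr_deriv (by ring)
  obtain ⟨q₁, h₃⟩ := exists_eq_const_mul_exp (k := a)
    (h := fun t => H.s₁ t - c / 2 * H.τ₂ t + a * (H.s t - c / 2 * H.τ₁ t)) hJ hJ' hJn fun t ht =>
      (((h.deriv_s₁ t ht).sub ((h.deriv_τ₂ t ht).const_mul (c / 2))).add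
        (((h.deriv_s t ht).sub ((h.deriv_τ₁ t ht).const_mul (c / 2))).const_mul a)).congr_deriv
        (by rw [hB]; ring)
  obtain ⟨q₂, h₄⟩ := exists_eq_const_mul_exp (k := -a)
    (h := fun t => H.s₁ t - c / 2 * H.τ₂ t - a * (H.s t - c / 2 * H.τ₁ t)) hJ hJ' hJn fun t ht =>
      (((h.deriv_s₁ t ht).sub ((h.deriv_τ₂ t ht).const_mul (c / 2))).sub
        (((h.deriv_s t ht).sub ((h.deriv_τ₁ t ht).const_mul (c / 2))).const_mul a)).congr_deriv
        (by rw [hB]; ring)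
  refine ⟨-p₁ / (4 * a), p₂ / (4 * a), -p₀ / (4 * a ^ 2), -q₁ / (2 * a), q₂ / (2 * a),
    fun t ht => ?_⟩
  have e₀ := h₀ t ht
  have e₁ := h₁ t ht
  have e₂ := h₂ t ht
  have e₃ := h₃ t ht
  have e₄ := h₄ t ht
  simp only [invData, shiftData, mul_one, mul_neg, neg_mul, one_mul] at *
  generalize Real.exp (2 * a * t) = y at *
  generalize Real.exp (-(2 * a * t)) = z at *
  generalize Real.exp (a * t) = v at *
  generalize Real.exp (-(a * t)) = w at *
  constructor
  · field_simp
    linear_combination (-2) * e₀ + e₁ + e₂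
  · field_simp
    linear_combination 4 * e₃ - 4 * e₄ + c * e₁ - c * e₂

end F24

namespace F2

variable {A B C : ℝ}

theorem mul_center (hA : 0 < A) : (√A) ^ 2 * (2 * B / A) / 2 = B := by
  rw [Real.sq_sqrt hA.le]
  field_simp

theorem nu_eq (hA : 0 < A) :
    (√A) ^ 2 * (2 * B / A) ^ 2 / 2 - 2 * √A * (nu A B C + 1 / 4) = C := by
  have h := Real.sqrt_pos.2 hA
  have h2 := Real.sq_sqrt hA.le
  unfold nu
  rw [h2]
  field_simp
  ring

theorem potential_eq (hA : 0 < A) (x : ℝ) :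
    A * x ^ 2 + 4 * B * x + 2 * C = (√A) ^ 2 * (x + 2 * B / A) ^ 2
      + 2 * (-2 * √A * (nu A B C + 1 / 4)) + 0 / (x + 2 * B / A) ^ 2 := by
  have := nu_eq (B := B) (C := C) hA
  rw [zero_div, add_zero]
  have h2 := Real.sq_sqrt hA.le
  rw [h2] at this ⊢
  have e : A * (x + 2 * B / A) ^ 2 = A * x ^ 2 + 4 * B * x + A * (2 * B / A) ^ 2 := by
    field_simp
    ring
  rw [e]
  linear_combination (-2) * this

theorem isSymmetryList {E : Set ℝ} {μ θ : ℝ → ℝ} (hA : 0 < A) (hE : IsOpen E)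
    (hd : IsDrift (fun x => A * x ^ 2 + 4 * B * x + 2 * C) E μ θ) :
    IsSymmetryList μ θ E (F2.list A B C) := by
  have hV : potential A B C 0 = fun x => A * x ^ 2 + 4 * B * x + 2 * C := by
    funext x
    simp [potential]
  have ha := Real.sqrt_pos.2 hA
  have hC := nu_eq (B := B) (C := C) hA
  have hB := mul_center (B := B) hA
  have hP := potential_eq (B := B) (C := C) hA
  have hA' := Real.sq_sqrt hA.le
  unfold F2.list
  generalize √A = a at *
  generalize 2 * B / A = c at *
  generalize nu A B C = ν at *
  have hdet : ∀ i, ((![F24.invData a c ν 1, F24.invData a c ν (-1), F24.shiftData a c 1,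
      F24.shiftData a c (-1), timeShiftData, rescaleData] : Fin 6 → GenData) i).Determining
      A B C 0 Set.univ := by
    rw [← hA', ← hB]
    exact Fin.cases (F24.invData_determining ha (by norm_num) hC.symm (zero_mul _))
      (Fin.cases (F24.invData_determining ha (by norm_num) hC.symm (zero_mul _))
      (Fin.cases (F24.shiftData_determining (by norm_num))
      (Fin.cases (F24.shiftData_determining (by norm_num))
      (Fin.cases (timeShiftData_determining _ _ _ _ _) (Fin.cases
      (rescaleData_determining _ _ _ _ _) fun i => i.elim0)))))
  refine isSymmetryList_of_basis (G := ![F24.invData a c ν 1, F24.invData a c ν (-1),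
    F24.shiftData a c 1, F24.shiftData a c (-1), timeShiftData, rescaleData]) (hV ▸ hd) hE
    (fun _ _ => Or.inl rfl) ?_ hdet ?_ ?_ ?_
  · exact Fin.cases (F24.invData_hasGenerator ha (by norm_num))
      (Fin.cases (F24.invData_hasGenerator ha (by norm_num))
      (Fin.cases F24.shiftData_hasGenerator (Fin.cases F24.shiftData_hasGenerator
      (Fin.cases timeShiftData_hasGenerator (Fin.cases rescaleData_hasGenerator
      fun i => i.elim0)))))
  · rw [hV]
    have hP' : ∀ x, A * x ^ 2 + 4 * B * x + 2 * C =
        a ^ 2 * (x + c) ^ 2 + 2 * (-2 * a * (ν + 1 / 4)) := fun x => by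
      rw [hP x, zero_div, add_zero]
    refine Fin.cases ?_ (Fin.cases ?_ (Fin.cases ?_ (Fin.cases ?_ (Fin.cases ?_ (Fin.cases ?_
      fun i => i.elim0)))))
    · exact F24.inv_isHeatSymmetry ha hP (by norm_num)
    · exact F24.inv_isHeatSymmetry ha hP (by norm_num)
    · intro ε
      change (F24.shift a c 1 ε).IsHeatSymmetry _
      rw [F24.shift_one_eq]
      exact F24.two2_isHeatSymmetry hP' ε 0
    · intro ε
      change (F24.shift a c (-1) ε).IsHeatSymmetry _
      rw [F24.shift_neg_one_eq]
      exact F24.two2_isHeatSymmetry hP' 0 ε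
    · exact timeShift_isHeatSymmetry _
    · exact rescale_isHeatSymmetry _
  · intro J hJ hJ' hJn H hH
    obtain ⟨p, q, r, u, v, h⟩ := F24.exists_eq_exp (ν := ν) ha hB.symm hJ hJ' hJn (hA'.symm ▸ hH)
    -- This combination has the same `τ` and `s`, so that `k` differs by a constant only, which the
    -- sixth generator absorbs.
    have hG := (GenData.Determining.lin hdet ![p, q, u, v, r, 0]).mono (Set.subset_univ J)
    obtain ⟨k, hk⟩ := hG.exists_k_eq hJ hJ' hJn hH fun t ht => by
      rw [(h t ht).1, (h t ht).2]
      simp [GenData.lin, Fin.sum_univ_six, timeShiftData, rescaleData, F24.invData, F24.shiftData]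
    refine ⟨![p, q, u, v, r, -k], fun t ht => ?_⟩
    rw [(h t ht).1, (h t ht).2, hk t ht]
    simp [GenData.lin, Fin.sum_univ_six, timeShiftData, rescaleData, F24.invData, F24.shiftData]
  · intro J hJ hJn c' hc
    simp only [Fin.sum_univ_six, F24.invData, F24.shiftData, timeShiftData, rescaleData] at hc
    simp at hc
    have h2a : 2 * a ≠ 0 := by positivity
    obtain ⟨h0, h1, h4⟩ := exp_coeffs_eq_zero (p := -c' 0 / (2 * a)) (q := c' 1 / (2 * a))
      (r := c' 4) hJ hJn h2a fun t ht => by linear_combination (hc t ht).1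
    have h0' : c' 0 = 0 := by simpa [ha.ne'] using h0
    have h1' : c' 1 = 0 := by simpa [ha.ne'] using h1
    obtain ⟨h2, h3, -⟩ := exp_coeffs_eq_zero (p := -c' 2) (q := -c' 3) (r := 0) hJ hJn
      ha.ne' fun t ht => by
        have := (hc t ht).2.1
        rw [h0', h1'] at this
        linear_combination this
    have h2' : c' 2 = 0 := by linarith
    have h3' : c' 3 = 0 := by linarith
    obtain ⟨t, ht⟩ := hJn
    have h5 := (hc t ht).2.2
    rw [h0', h1', h2', h3'] at h5
    have h5' : c' 5 = 0 := by linarith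
    funext i
    fin_cases i <;> assumption

end F2

namespace F4

variable {A C D : ℝ}

theorem nu_eq (hA : 0 < A) : (√A) ^ 2 * 0 ^ 2 / 2 - 2 * √A * (nu A C + 1 / 4) = C := by
  have h := Real.sqrt_pos.2 hA
  unfold nu
  field_simp
  ring

theorem potential_eq (hA : 0 < A) (x : ℝ) :
    A * x ^ 2 + 2 * C + D / x ^ 2 = (√A) ^ 2 * (x + 0) ^ 2
      + 2 * (-2 * √A * (nu A C + 1 / 4)) + D / (x + 0) ^ 2 := by
  have := nu_eq (C := C) hA
  have h2 := Real.sq_sqrt hA.le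
  rw [h2] at this ⊢
  rw [add_zero]
  linear_combination (-2) * this

theorem isSymmetryList {E : Set ℝ} {μ θ : ℝ → ℝ} (hA : 0 < A) (hD : D ≠ 0) (hE : IsOpen E)
    (hE0 : E ⊆ Set.Ioi 0) (hd : IsDrift (fun x => A * x ^ 2 + 2 * C + D / x ^ 2) E μ θ) :
    IsSymmetryList μ θ E (F4.list A C) := by
  have hV : potential A 0 C D = fun x => A * x ^ 2 + 2 * C + D / x ^ 2 := by
    funext x
    simp [potential]
  have ha := Real.sqrt_pos.2 hA
  have hC := nu_eq (C := C) hA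
  have hP := potential_eq (C := C) (D := D) hA
  have hA' := Real.sq_sqrt hA.le
  unfold F4.list
  generalize √A = a at *
  generalize nu A C = ν at *
  have hB : a ^ 2 * 0 / 2 = 0 := by simp
  have hdet : ∀ i, ((![F24.invData a 0 ν 1, F24.invData a 0 ν (-1), timeShiftData,
      rescaleData] : Fin 4 → GenData) i).Determining A 0 C D Set.univ := by
    have h : ∀ σ : ℝ, σ ^ 2 = 1 → (F24.invData a 0 ν σ).Determining A 0 C D Set.univ :=
      fun σ hσ => by
        have := F24.invData_determining (D := D) ha hσ hC.symm (mul_zero _)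
        rwa [hB, hA'] at this
    exact Fin.cases (h 1 (by norm_num)) (Fin.cases (h (-1) (by norm_num))
      (Fin.cases (timeShiftData_determining _ _ _ _ _) (Fin.cases
      (rescaleData_determining _ _ _ _ _) fun i => i.elim0)))
  refine isSymmetryList_of_basis (G := ![F24.invData a 0 ν 1, F24.invData a 0 ν (-1),
    timeShiftData, rescaleData]) (hV ▸ hd) hE (fun x hx => Or.inr (hE0 hx).ne') ?_ hdet ?_ ?_ ?_
  · exact Fin.cases (F24.invData_hasGenerator ha (by norm_num))
      (Fin.cases (F24.invData_hasGenerator ha (by norm_num))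
      (Fin.cases timeShiftData_hasGenerator (Fin.cases rescaleData_hasGenerator
      fun i => i.elim0)))
  · rw [hV]
    exact Fin.cases (F24.inv_isHeatSymmetry ha hP (by norm_num))
      (Fin.cases (F24.inv_isHeatSymmetry ha hP (by norm_num))
      (Fin.cases (timeShift_isHeatSymmetry _) (Fin.cases (rescale_isHeatSymmetry _)
      fun i => i.elim0)))
  · intro J hJ hJ' hJn H hH
    obtain ⟨p, q, r, u, v, h⟩ := F24.exists_eq_exp (ν := ν) ha hB.symm hJ hJ' hJn (hA'.symm ▸ hH)
    have hs : ∀ t ∈ J, H.s t = 0 := fun t ht =>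
      (mul_eq_zero.1 (hH.D_mul_s t ht)).resolve_left hD
    have hG := (GenData.Determining.lin hdet ![p, q, r, 0]).mono (Set.subset_univ J)
    obtain ⟨k, hk⟩ := hG.exists_k_eq hJ hJ' hJn hH fun t ht => by
      rw [(h t ht).1, hs t ht]
      simp [GenData.lin, Fin.sum_univ_four, timeShiftData, rescaleData, F24.invData]
    refine ⟨![p, q, r, -k], fun t ht => ?_⟩
    rw [(h t ht).1, hs t ht, hk t ht]
    simp [GenData.lin, Fin.sum_univ_four, timeShiftData, rescaleData, F24.invData]
  · intro J hJ hJn c' hc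
    simp only [Fin.sum_univ_four, F24.invData, timeShiftData, rescaleData] at hc
    simp at hc
    have h2a : 2 * a ≠ 0 := by positivity
    obtain ⟨h0, h1, h4⟩ := exp_coeffs_eq_zero (p := -c' 0 / (2 * a)) (q := c' 1 / (2 * a))
      (r := c' 2) hJ hJn h2a fun t ht => by linear_combination (hc t ht).1
    have h0' : c' 0 = 0 := by simpa [ha.ne'] using h0
    have h1' : c' 1 = 0 := by simpa [ha.ne'] using h1
    obtain ⟨t, ht⟩ := hJn
    have h3 := (hc t ht).2
    rw [h0', h1'] at h3
    have h3' : c' 3 = 0 := by linarith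
    funext i
    fin_cases i <;> assumption

end F4

/-! ### Smooth symmetries satisfy the determining equations -/

section Jet

variable {V : ℝ → ℝ} {E S : Set ℝ} {μ θ G L : ℝ → ℝ} {p : ℝ}

/-- Solutions of the heat equation that are affine in `t`, by variation of constants. -/
theorem IsDrift.isHeatSolution_affine (h : IsDrift V E μ θ) (hE : IsOpen E) (hS : IsOpen S)
    (hSE : S ⊆ E) (T₀ : ℝ) (sG : ContDiffOn ℝ ∞ G S)
    (hG : ∀ x ∈ S, HasDerivAt G (L x / θ x ^ 2) x)
    (hL : ∀ x ∈ S, HasDerivAt L (2 * p * θ x ^ 2) x) :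
    IsHeatSolution V (S ×ˢ Set.univ) (fun x t => θ x * (p * (t - T₀) + G x)) ∧
    ∀ x ∈ S, ∀ t, dx (fun x t => θ x * (p * (t - T₀) + G x)) x t =
      μ x * (θ x * (p * (t - T₀) + G x)) + L x / θ x := by
  have hθ0 : ∀ x ∈ S, θ x ≠ 0 := fun x hx => h.theta_ne (hSE hx)
  have d1 : ∀ x ∈ S, ∀ t, HasDerivAt (fun x => θ x * (p * (t - T₀) + G x))
      (μ x * (θ x * (p * (t - T₀) + G x)) + L x / θ x) x := fun x hx t => by
    refine ((h.hasDerivAt_theta (hSE hx)).mul ((hG x hx).const_add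
      (p * (t - T₀)))).congr_deriv ?_
    have := hθ0 x hx
    field_simp
  refine ⟨⟨?_, ?_⟩, fun x hx t => (d1 x hx t).deriv⟩
  · refine ContDiffOn.mul (((h.smooth_theta hE).mono hSE).comp contDiffOn_fst fun q hq => hq.1)
      (ContDiffOn.add ?_ (sG.comp contDiffOn_fst fun q hq => hq.1))
    exact (contDiff_const.mul (contDiff_snd.sub contDiff_const)).contDiffOn
  · rintro x t ⟨hx, -⟩
    have d2 : dx (dx fun x t => θ x * (p * (t - T₀) + G x)) x t =
        V x * (θ x * (p * (t - T₀) + G x)) + 2 * p * θ x := by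
      refine HasDerivAt.deriv (hasDerivAt_congr_on hS hx ?_ fun y hy => (d1 y hy t).deriv)
      refine (((h.hasDerivAt_mu hE (hSE hx)).mul (d1 x hx t)).add ((hL x hx).div
        (h.hasDerivAt_theta (hSE hx)) (hθ0 x hx))).congr_deriv ?_
      have := hθ0 x hx
      field_simp
      ring
    have d3 : dt (fun x t => θ x * (p * (t - T₀) + G x)) x t = θ x * p := by
      refine HasDerivAt.deriv (((((hasDerivAt_id t).sub_const T₀).const_mul p).add_const
        (G x)).const_mul (θ x) |>.congr_deriv ?_)
      ring
    rw [d2, d3]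
    ring

/-- The values of a solution and of its two first derivatives at a point are arbitrary. -/
theorem IsDrift.exists_isHeatSolution_jet (h : IsDrift V E μ θ) (hE : IsOpen E) {X₀ : ℝ}
    (hX : X₀ ∈ E) (T₀ q₀ q₁ q₂ : ℝ) :
    ∃ S : Set ℝ, IsOpen S ∧ S ⊆ E ∧ X₀ ∈ S ∧ ∃ W, IsHeatSolution V (S ×ˢ Set.univ) W ∧
      W X₀ T₀ = q₀ ∧ dx W X₀ T₀ = q₁ ∧ dt W X₀ T₀ = q₂ := by
  obtain ⟨a, b, hab, hS⟩ := mem_nhds_iff_exists_Ioo_subset.1 (hE.mem_nhds hX)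
  have sθ : ContDiffOn ℝ ∞ θ (Set.Ioo a b) := (h.smooth_theta hE).mono hS
  have hθ : ∀ x ∈ Set.Ioo a b, θ x ^ 2 ≠ 0 := fun x hx => pow_ne_zero 2 (h.theta_ne (hS hx))
  have hθ0 := h.theta_ne hX
  obtain ⟨K, hK0, sK, hK⟩ := exists_antideriv hab
    (contDiffOn_const (c := 2 * (q₂ / θ X₀)) |>.mul (sθ.pow 2))
  have sL : ContDiffOn ℝ ∞ (fun x => K x + θ X₀ * (q₁ - μ X₀ * q₀)) (Set.Ioo a b) :=
    sK.add contDiffOn_const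
  obtain ⟨H, hH0, sH, hH⟩ := exists_antideriv hab (sL.div (sθ.pow 2) hθ)
  obtain ⟨h1, h2⟩ := h.isHeatSolution_affine (p := q₂ / θ X₀) hE isOpen_Ioo hS T₀
    (G := fun x => H x + q₀ / θ X₀) (L := fun x => K x + θ X₀ * (q₁ - μ X₀ * q₀))
    (sH.add contDiffOn_const) (fun x hx => (hH x hx).add_const _)
    (fun x hx => (hK x hx).add_const _)
  refine ⟨_, isOpen_Ioo, hS, hab, _, h1, ?_, ?_, ?_⟩
  · simp [hH0]
    field_simp
  · rw [h2 X₀ hab, hH0, hK0]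
    field_simp
    ring
  · refine HasDerivAt.deriv (((((hasDerivAt_id T₀).sub_const T₀).const_mul _).add_const
        _).const_mul _ |>.congr_deriv ?_)
    field_simp

end Jet

section Preserves

variable {V : ℝ → ℝ} {E I J : Set ℝ} {D O : Set (ℝ × ℝ)} {μ θ : ℝ → ℝ} {X m W : ℝ → ℝ → ℝ}
  {T : ℝ → ℝ}

/-- The equation for `m W(X,T)` as a linear relation between `W`, `W_x` and `W_t`. -/
theorem IsHeatSolution.jet_relation (hD : IsOpen D) (sX : SmoothOn₂ D X)
    (sT : SmoothOn₂ D fun _ t => T t) (sm : SmoothOn₂ D m) (hO : IsOpen O)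
    (hW : IsHeatSolution V O W)
    (hP : IsHeatSolution V (D ∩ {p | (X p.1 p.2, T p.2) ∈ O}) fun x t => m x t * W (X x t) (T t))
    {x t : ℝ} (hp : (x, t) ∈ D) (hpO : (X x t, T t) ∈ O) :
    (dt m x t - 1 / 2 * dx (dx m) x t + 1 / 2 * V x * m x t
        - 1 / 2 * m x t * V (X x t) * dx X x t ^ 2) * W (X x t) (T t)
      + (m x t * dt X x t - dx m x t * dx X x t - 1 / 2 * m x t * dx (dx X) x t) *
        dx W (X x t) (T t)
      + m x t * (deriv T t - dx X x t ^ 2) * dt W (X x t) (T t) = 0 := by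
  obtain ⟨sW, hWe⟩ := hW
  set R : Set (ℝ × ℝ) := D ∩ {p | (X p.1 p.2, T p.2) ∈ O} with hRdef
  have hR : IsOpen R := (sX.continuousOn.prodMk sT.continuousOn).isOpen_inter_preimage hD hO
  have hpR : (x, t) ∈ R := ⟨hp, hpO⟩
  have d1 : ∀ y, (y, t) ∈ R → HasDerivAt (fun y => m y t * W (X y t) (T t))
      (dx m y t * W (X y t) (T t) + m y t * (dx W (X y t) (T t) * dx X y t)) y := by
    intro y hy
    have := (sm.hasDerivAt_dx hD hy.1).mul (sW.hasDerivAt_comp hO (sX.hasDerivAt_dx hD hy.1)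
      (hasDerivAt_const y (T t)) hy.2)
    simp only [mul_zero, add_zero] at this
    exact this
  have d2 : dx (dx fun x t => m x t * W (X x t) (T t)) x t =
      dx (dx m) x t * W (X x t) (T t) + 2 * (dx m x t * (dx W (X x t) (T t) * dx X x t)) +
        m x t * (dx (dx W) (X x t) (T t) * dx X x t ^ 2
          + dx W (X x t) (T t) * dx (dx X) x t) := by
    have e := (((sm.smooth_dx hD).hasDerivAt_dx hD hp).mul
      (sW.hasDerivAt_comp hO (sX.hasDerivAt_dx hD hp) (hasDerivAt_const x (T t)) hpO)).add
      ((sm.hasDerivAt_dx hD hp).mul (((sW.smooth_dx hO).hasDerivAt_comp hO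
        (sX.hasDerivAt_dx hD hp) (hasDerivAt_const x (T t)) hpO).mul
        ((sX.smooth_dx hD).hasDerivAt_dx hD hp)))
    have ee : (fun y => dx (fun x t => m x t * W (X x t) (T t)) y t) =ᶠ[nhds x] fun y =>
        dx m y t * W (X y t) (T t) + m y t * (dx W (X y t) (T t) * dx X y t) :=
      (eventually_mem_inl hR hpR).mono fun z hz => (d1 z hz).deriv
    rw [dx, ee.deriv_eq]
    refine (HasDerivAt.deriv e).trans ?_
    simp only [Pi.mul_apply]
    ring
  have d3 : dt (fun x t => m x t * W (X x t) (T t)) x t = dt m x t * W (X x t) (T t) +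
      m x t * (dx W (X x t) (T t) * dt X x t + dt W (X x t) (T t) * deriv T t) :=
    HasDerivAt.deriv ((sm.hasDerivAt_dt hD hp).mul (sW.hasDerivAt_comp hO
      (sX.hasDerivAt_dt hD hp) (sT.hasDerivAt_dt hD hp) hpO))
  have e := hP.2 x t hpR
  rw [d2, d3] at e
  have e' := hWe _ _ hpO
  linear_combination e - m x t * dx X x t ^ 2 * e'

/-- A transformation that preserves solutions satisfies the determining equations. -/
theorem determining_of_preservesSolutions (h : IsDrift V E μ θ) (hE : IsOpen E) (hI : IsOpen I)
    (hIE : I ⊆ E) (hJ : IsOpen J) {f : ℝ → ℝ → ℝ} (sf : SmoothOn₂ (I ×ˢ J) f)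
    (sX : SmoothOn₂ (I ×ˢ J) X) (sT : ContDiffOn ℝ ∞ T J) (hXE : ∀ x ∈ I, ∀ t ∈ J, X x t ∈ E)
    (hf : ∀ x ∈ I, ∀ t ∈ J, f x t ≠ 0) (hpres : PreservesSolutions μ E (I ×ˢ J) f X T)
    (hm : m = fun x t => f x t * θ (X x t) / θ x) :
    SmoothOn₂ (I ×ˢ J) m ∧ (∀ x ∈ I, ∀ t ∈ J, m x t ≠ 0) ∧ ∀ x ∈ I, ∀ t ∈ J,
      deriv T t = dx X x t ^ 2 ∧
      m x t * dt X x t = dx m x t * dx X x t + 1 / 2 * m x t * dx (dx X) x t ∧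
      dt m x t = 1 / 2 * dx (dx m) x t - 1 / 2 * V x * m x t
        + 1 / 2 * m x t * V (X x t) * dx X x t ^ 2 := by
  have hD : IsOpen (I ×ˢ J) := hI.prod hJ
  have sθ := h.smooth_theta hE
  have sm : SmoothOn₂ (I ×ˢ J) m := by
    rw [hm]
    exact (sf.mul (sθ.comp sX fun p hp => hXE _ hp.1 _ hp.2)).div
      (sθ.comp contDiffOn_fst fun p hp => hIE hp.1) fun p hp => h.theta_ne (hIE hp.1)
  have hm0 : ∀ x ∈ I, ∀ t ∈ J, m x t ≠ 0 := fun x hx t ht => by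
    rw [hm]
    exact div_ne_zero (mul_ne_zero (hf x hx t ht) (h.theta_ne (hXE x hx t ht)))
      (h.theta_ne (hIE hx))
  have sT' : SmoothOn₂ (I ×ˢ J) fun _ t => T t := sT.comp contDiffOn_snd fun p hp => hp.2
  refine ⟨sm, hm0, fun x hx t ht => ?_⟩
  -- The equation for `m W(X,T)`, after elimination of `W_xx`, is linear in the values `q₀`, `q₁`,
  -- `q₂` of `W`, `W_x`, `W_t` at `(X,T)`. As these are arbitrary, its coefficients vanish.
  have key : ∀ q₀ q₁ q₂ : ℝ,
      (dt m x t - 1 / 2 * dx (dx m) x t + 1 / 2 * V x * m x t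
        - 1 / 2 * m x t * V (X x t) * dx X x t ^ 2) * q₀
      + (m x t * dt X x t - dx m x t * dx X x t - 1 / 2 * m x t * dx (dx X) x t) * q₁
      + m x t * (deriv T t - dx X x t ^ 2) * q₂ = 0 := by
    intro q₀ q₁ q₂
    obtain ⟨S, hS, hSE, hxS, W, hW, rfl, rfl, rfl⟩ :=
      h.exists_isHeatSolution_jet hE (hXE x hx t ht) (T t) q₀ q₁ q₂
    have hO : IsOpen (S ×ˢ (Set.univ : Set ℝ)) := hS.prod isOpen_univ
    have hOE : S ×ˢ (Set.univ : Set ℝ) ⊆ E ×ˢ Set.univ := Set.prod_mono hSE subset_rfl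
    have hU := (h.isSolution_iff hE hO hOE (u := fun x t => θ x * W x t) (w := W)
      fun _ _ _ => rfl).2 hW
    have hP := hpres _ hO hOE _ hU
    have hR : IsOpen (I ×ˢ J ∩ {p | (X p.1 p.2, T p.2) ∈ S ×ˢ (Set.univ : Set ℝ)}) :=
      (sX.continuousOn.prodMk sT'.continuousOn).isOpen_inter_preimage hD hO
    have hP' := (h.isSolution_iff hE hR (w := fun x t => m x t * W (X x t) (T t))
      (fun p hp => ⟨hIE hp.1.1, trivial⟩) fun y s hp => by
        have := h.theta_ne (hIE hp.1.1)
        rw [hm]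
        field_simp).1 hP
    exact IsHeatSolution.jet_relation hD sX sT' sm hO hW hP' ⟨hx, ht⟩ ⟨hxS, trivial⟩
  have k₀ := key 1 0 0
  have k₁ := key 0 1 0
  have k₂ := key 0 0 1
  refine ⟨?_, by linarith, by linarith⟩
  have : m x t * (deriv T t - dx X x t ^ 2) = 0 := by linarith
  linarith [(mul_eq_zero.1 this).resolve_left (hm0 x hx t ht)]

/-- A smooth, nondegenerate symmetry is affine in `x`, and its multiplier is the exponential of a
quadratic polynomial in `x`. -/
theorem intertwines_of_preservesSolutions (h : IsDrift V E μ θ) (hE : IsOpen E) (hI : IsOpen I)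
    (hI' : I.OrdConnected) (hIn : I.Nonempty)
    (hIE : I ⊆ E) (hJ : IsOpen J) {f : ℝ → ℝ → ℝ} (sf : SmoothOn₂ (I ×ˢ J) f)
    (sX : SmoothOn₂ (I ×ˢ J) X) (sT : ContDiffOn ℝ ∞ T J) (hXE : ∀ x ∈ I, ∀ t ∈ J, X x t ∈ E)
    (hf : ∀ x ∈ I, ∀ t ∈ J, f x t ≠ 0) (hX : ∀ x ∈ I, ∀ t ∈ J, dx X x t ≠ 0)
    (hpres : PreservesSolutions μ E (I ×ˢ J) f X T)
    (hm : m = fun x t => f x t * θ (X x t) / θ x) :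
    SmoothOn₂ (I ×ˢ J) m ∧ (∀ x ∈ I, ∀ t ∈ J, m x t ≠ 0) ∧
      ∃ ρ σ a b, (∀ t ∈ J, ρ t ≠ 0) ∧ Intertwines V (I ×ˢ J) X T m ρ σ a b := by
  obtain ⟨sm, hm0, hdet⟩ := determining_of_preservesSolutions h hE hI hIE hJ sf sX sT hXE hf
    hpres hm
  have hD : IsOpen (I ×ˢ J) := hI.prod hJ
  refine ⟨sm, hm0, ?_⟩
  obtain ⟨x₀, hx₀⟩ := hIn
  have hXxx : ∀ x ∈ I, ∀ t ∈ J, dx (dx X) x t = 0 := fun x hx t ht => by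
    have e : HasDerivAt (fun y => dx X y t ^ 2) 0 x :=
      hasDerivAt_congr_on hI hx (hasDerivAt_const x (deriv T t))
        fun y hy => ((hdet y hy t ht).1).symm
    have e' := ((sX.smooth_dx hD).hasDerivAt_dx hD (show (x, t) ∈ I ×ˢ J from ⟨hx, ht⟩)).pow 2
    have := e'.unique e
    simpa [hX x hx t ht] using this
  have hρ : ∀ x ∈ I, ∀ t ∈ J, dx X x t = dx X x₀ t := fun x hx t ht =>
    eq_of_hasDerivAt_zero hI hI' (h := fun x => dx X x t) (fun y hy =>
      ((sX.smooth_dx hD).hasDerivAt_dx hD (show (y, t) ∈ I ×ˢ J from ⟨hy, ht⟩)).congr_deriv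
        (hXxx y hy t ht)) hx hx₀
  set ρ : ℝ → ℝ := fun t => dx X x₀ t with hρdef
  set σ : ℝ → ℝ := fun t => X x₀ t - dx X x₀ t * x₀ with hσdef
  have hXeq : ∀ x ∈ I, ∀ t ∈ J, X x t = ρ t * x + σ t := fun x hx t ht => by
    have := eq_of_hasDerivAt_zero hI hI' (h := fun x => X x t - ρ t * x) (fun y hy =>
      ((sX.hasDerivAt_dx hD (show (y, t) ∈ I ×ˢ J from ⟨hy, ht⟩)).sub
        ((hasDerivAt_id y).const_mul (ρ t))).congr_deriv
        (by rw [hρ y hy t ht, mul_one, sub_self])) hx hx₀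
    simp only [hσdef]
    linarith
  have hρt : ∀ t ∈ J, HasDerivAt ρ (dt (dx X) x₀ t) t := fun t ht =>
    (sX.smooth_dx hD).hasDerivAt_dt hD (show (x₀, t) ∈ I ×ˢ J from ⟨hx₀, ht⟩)
  have hσt : ∀ t ∈ J, HasDerivAt σ (dt X x₀ t - dt (dx X) x₀ t * x₀) t := fun t ht =>
    (sX.hasDerivAt_dt hD (show (x₀, t) ∈ I ×ˢ J from ⟨hx₀, ht⟩)).sub ((hρt t ht).mul_const x₀)
  have hρ0 : ∀ t ∈ J, ρ t ≠ 0 := fun t ht => hX x₀ hx₀ t ht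
  have hXt : ∀ x ∈ I, ∀ t ∈ J, dt X x t =
      dt (dx X) x₀ t * x + (dt X x₀ t - dt (dx X) x₀ t * x₀) := fun x hx t ht =>
    HasDerivAt.deriv (hasDerivAt_congr_on hJ ht (((hρt t ht).mul_const x).add (hσt t ht))
      fun s hs => hXeq x hx s hs)
  set a : ℝ → ℝ := fun t => dt (dx X) x₀ t / ρ t with hadef
  set b : ℝ → ℝ := fun t => (dt X x₀ t - dt (dx X) x₀ t * x₀) / ρ t with hbdef
  have hXt' : ∀ x ∈ I, ∀ t ∈ J, dt X x t = ρ t * (a t * x + b t) := fun x hx t ht => by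
    have := hρ0 t ht
    rw [hXt x hx t ht]
    simp only [hadef, hbdef]
    field_simp
  have hmx : ∀ x ∈ I, ∀ t ∈ J, dx m x t = (a t * x + b t) * m x t := fun x hx t ht => by
    have e := (hdet x hx t ht).2.1
    rw [hXxx x hx t ht, hρ x hx t ht, hXt' x hx t ht] at e
    refine mul_right_cancel₀ (hρ0 t ht) ?_
    linear_combination (-1 : ℝ) * e
  have hmxx : ∀ x ∈ I, ∀ t ∈ J, dx (dx m) x t = (a t + (a t * x + b t) ^ 2) * m x t :=
    fun x hx t ht => by
      have e := (((hasDerivAt_id x).const_mul (a t)).add_const (b t)).mul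
        (sm.hasDerivAt_dx hD (show (x, t) ∈ I ×ˢ J from ⟨hx, ht⟩))
      refine (HasDerivAt.deriv (hasDerivAt_congr_on hI hx e fun y hy => hmx y hy t ht)).trans ?_
      rw [hmx x hx t ht]
      simp only [id]
      ring
  refine ⟨ρ, σ, a, b, hρ0, fun hp => hXeq _ hp.1 _ hp.2, fun hp => ?_, fun {x t} hp => ?_,
    fun hp => ?_, fun {x t} hp => ?_⟩
  · exact (sX.hasDerivAt_dt hD hp).congr_deriv (hXt' _ hp.1 _ hp.2)
  · exact (sT.hasDerivAt_deriv hJ hp.2).congr_deriv (hdet x₀ hx₀ t hp.2).1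
  · exact (sm.hasDerivAt_dx hD hp).congr_deriv (hmx _ hp.1 _ hp.2)
  · refine (sm.hasDerivAt_dt hD hp).congr_deriv ?_
    rw [(hdet _ hp.1 _ hp.2).2.2, hmxx _ hp.1 _ hp.2, hρ x hp.1 t hp.2]
    ring

end Preserves

/-! ### The compatibility conditions of the determining equations -/

theorem Intertwines.mono {V : ℝ → ℝ} {D D' : Set (ℝ × ℝ)} {X : ℝ → ℝ → ℝ} {T : ℝ → ℝ}
    {m : ℝ → ℝ → ℝ} {ρ σ a b : ℝ → ℝ} (h : Intertwines V D X T m ρ σ a b) (hD : D' ⊆ D) :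
    Intertwines V D' X T m ρ σ a b :=
  ⟨fun hp => h.1 (hD hp), fun hp => h.2 (hD hp), fun hp => h.3 (hD hp), fun hp => h.4 (hD hp),
    fun hp => h.5 (hD hp)⟩

/-- The ordinary differential equations for the coefficients of `X = ρ(t) x + σ(t)`. -/
structure Profile (A B : ℝ) (J : Set ℝ) (ρ σ : ℝ → ℝ) : Prop where
  smooth_ρ : ContDiffOn ℝ ∞ ρ J
  smooth_σ : ContDiffOn ℝ ∞ σ J
  ne_zero : ∀ t ∈ J, ρ t ≠ 0
  eq_ρ : ∀ t ∈ J, deriv (deriv ρ) t * ρ t - 2 * deriv ρ t ^ 2 = A * ρ t ^ 2 * (ρ t ^ 4 - 1)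
  eq_σ : ∀ t ∈ J, deriv (deriv σ) t * ρ t - 2 * deriv ρ t * deriv σ t =
    ρ t ^ 2 * (ρ t ^ 3 * (A * σ t + 2 * B) - 2 * B)

section Compatibility

variable {A B C D : ℝ} {I J : Set ℝ} {X m : ℝ → ℝ → ℝ} {T ρ σ a b : ℝ → ℝ}

theorem Intertwines.smooth_profile {V : ℝ → ℝ} (h : Intertwines V (I ×ˢ J) X T m ρ σ a b)
    (hI : IsOpen I) (hIn : I.Nonempty) (hJ : IsOpen J) (sX : SmoothOn₂ (I ×ˢ J) X) :
    ContDiffOn ℝ ∞ ρ J ∧ ContDiffOn ℝ ∞ σ J ∧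
      ∀ t ∈ J, deriv ρ t = ρ t * a t ∧ deriv σ t = ρ t * b t := by
  have hD : IsOpen (I ×ˢ J) := hI.prod hJ
  obtain ⟨x₀, hx₀⟩ := hIn
  have sρ : ContDiffOn ℝ ∞ ρ J := ((sX.smooth_dx hD).contDiffOn_right hx₀).congr fun t ht =>
    ((h.X_x hD (show (x₀, t) ∈ I ×ˢ J from ⟨hx₀, ht⟩)).deriv).symm
  have sσ : ContDiffOn ℝ ∞ σ J := ((sX.contDiffOn_right hx₀).sub (sρ.mul
    (contDiffOn_const (c := x₀)))).congr fun t ht => by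
      have := h.X_eq (show (x₀, t) ∈ I ×ˢ J from ⟨hx₀, ht⟩)
      change σ t = X x₀ t - ρ t * x₀
      linarith
  refine ⟨sρ, sσ, fun t ht => ?_⟩
  have := linear_coeffs_eq_zero (infinite_of_isOpen hI ⟨x₀, hx₀⟩) (a := deriv ρ t - ρ t * a t)
    (b := deriv σ t - ρ t * b t) fun x hx => by
      have e := deriv_unique_on hJ ht (((sρ.hasDerivAt_deriv hJ ht).mul_const x).add
        (sσ.hasDerivAt_deriv hJ ht)) (h.X_t (show (x, t) ∈ I ×ˢ J from ⟨hx, ht⟩))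
        fun s hs => (h.X_eq (show (x, s) ∈ I ×ˢ J from ⟨hx, hs⟩)).symm
      linarith
  exact ⟨by linarith [this.1], by linarith [this.2]⟩

/-- Equality of the mixed second derivatives of the multiplier. -/
theorem Intertwines.profile (h : Intertwines (potential A B C D) (I ×ˢ J) X T m ρ σ a b)
    (hI : IsOpen I) (hIn : I.Nonempty) (hJ : IsOpen J) (sX : SmoothOn₂ (I ×ˢ J) X)
    (sm : SmoothOn₂ (I ×ˢ J) m) (hρ : ∀ t ∈ J, ρ t ≠ 0) (hm : ∀ x ∈ I, ∀ t ∈ J, m x t ≠ 0)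
    (hD0 : D = 0 ∨ (∀ x ∈ I, x ≠ 0) ∧ ∀ x ∈ I, ∀ t ∈ J, X x t ≠ 0) :
    Profile A B J ρ σ ∧ ∀ t ∈ J, D * σ t = 0 := by
  have hD : IsOpen (I ×ˢ J) := hI.prod hJ
  have hinf := infinite_of_isOpen hI hIn
  obtain ⟨sρ, sσ, hab⟩ := h.smooth_profile hI hIn hJ sX
  have ea : ∀ t ∈ J, a t = deriv ρ t / ρ t := fun t ht => by
    have := hρ t ht
    rw [(hab t ht).1]
    field_simp
  have eb : ∀ t ∈ J, b t = deriv σ t / ρ t := fun t ht => by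
    have := hρ t ht
    rw [(hab t ht).2]
    field_simp
  have dρ := fun t ht => sρ.hasDerivAt_deriv hJ (t := t) ht
  have dρ' := fun t ht => (sρ.smooth_deriv hJ).hasDerivAt_deriv hJ (t := t) ht
  have dσ' := fun t ht => (sσ.smooth_deriv hJ).hasDerivAt_deriv hJ (t := t) ht
  have da := fun t ht => hasDerivAt_congr_on hJ ht ((dρ' t ht).div (dρ t ht) (hρ t ht)) ea
  have db := fun t ht => hasDerivAt_congr_on hJ ht ((dσ' t ht).div (dρ t ht) (hρ t ht)) eb
  have key : ∀ x ∈ I, ∀ t ∈ J,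
      (deriv (deriv ρ) t * ρ t - 2 * deriv ρ t ^ 2) / ρ t ^ 2 * x
        + (deriv (deriv σ) t * ρ t - 2 * deriv ρ t * deriv σ t) / ρ t ^ 2 =
      -(1 / 2) * (2 * A * x + 4 * B - 2 * D / x ^ 3)
        + 1 / 2 * (2 * A * X x t + 4 * B - 2 * D / X x t ^ 3) * ρ t ^ 3 := by
    intro x hx t ht
    have hp : (x, t) ∈ I ×ˢ J := ⟨hx, ht⟩
    have V1 := hasDerivAt_potential A B C D (x := x) (hD0.imp_right fun h => h.1 x hx)
    have V2 := hasDerivAt_potential A B C D (x := X x t) (hD0.imp_right fun h => h.2 x hx t ht)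
    have hl : HasDerivAt (fun y => a t * y + b t) (a t) x := by
      simpa using ((hasDerivAt_id x).const_mul (a t)).add_const (b t)
    set v₁ := 2 * A * x + 4 * B - 2 * D / x ^ 3
    set v₂ := 2 * A * X x t + 4 * B - 2 * D / X x t ^ 3
    set q := 1 / 2 * (a t + (a t * x + b t) ^ 2) - 1 / 2 * potential A B C D x
      + 1 / 2 * potential A B C D (X x t) * ρ t ^ 2
    have e1 : dx (dt m) x t = (a t * (a t * x + b t) - 1 / 2 * v₁ + 1 / 2 * v₂ * ρ t ^ 3) * m x t
        + q * ((a t * x + b t) * m x t) := by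
      refine HasDerivAt.deriv ((hasDerivAt_congr_on hI hx
        ((((((hl.pow 2).const_add (a t)).const_mul (1 / 2)).sub (V1.const_mul (1 / 2))).add
        (((V2.comp x (h.X_x hD hp)).const_mul (1 / 2)).mul_const (ρ t ^ 2))).mul (h.m_x hp))
        fun y hy => (h.m_t (show (y, t) ∈ I ×ˢ J from ⟨hy, ht⟩)).deriv).congr_deriv ?_)
      simp only [Pi.add_apply, Pi.sub_apply, Pi.pow_apply, Function.comp_apply]
      push_cast
      ring
    have e2 : dt (dx m) x t = ((deriv (deriv ρ) t * ρ t - deriv ρ t * deriv ρ t) / ρ t ^ 2 * x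
        + (deriv (deriv σ) t * ρ t - deriv σ t * deriv ρ t) / ρ t ^ 2) * m x t
        + (a t * x + b t) * (q * m x t) :=
      HasDerivAt.deriv (hasDerivAt_congr_on hJ ht
        ((((da t ht).mul_const x).add (db t ht)).mul (h.m_t hp))
        fun s hs => (h.m_x (show (x, s) ∈ I ×ˢ J from ⟨hx, hs⟩)).deriv)
    have e := e1.symm.trans ((sm.dx_dt_comm hD hp).trans e2)
    have e3 := mul_right_cancel₀ (hm x hx t ht) (show
      (a t * (a t * x + b t) - 1 / 2 * v₁ + 1 / 2 * v₂ * ρ t ^ 3) * m x t =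
        ((deriv (deriv ρ) t * ρ t - deriv ρ t * deriv ρ t) / ρ t ^ 2 * x
        + (deriv (deriv σ) t * ρ t - deriv σ t * deriv ρ t) / ρ t ^ 2) * m x t by
          linear_combination e)
    rw [ea t ht, eb t ht] at e3
    have hρ' := hρ t ht
    field_simp at e3 ⊢
    linear_combination (-1 : ℝ) * e3
  have coeff : ∀ t ∈ J,
      (deriv (deriv ρ) t * ρ t - 2 * deriv ρ t ^ 2) / ρ t ^ 2 + A - A * ρ t ^ 4 = 0 ∧
      (deriv (deriv σ) t * ρ t - 2 * deriv ρ t * deriv σ t) / ρ t ^ 2 + 2 * B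
        - ρ t ^ 3 * (A * σ t + 2 * B) = 0 ∧ D * σ t = 0 := by
    intro t ht
    have hρ' := hρ t ht
    have hX : ∀ x ∈ I, X x t = ρ t * x + σ t := fun x hx => h.X_eq ⟨hx, ht⟩
    have key' := fun x hx => key x hx t ht
    generalize (deriv (deriv ρ) t * ρ t - 2 * deriv ρ t ^ 2) / ρ t ^ 2 = k at *
    generalize (deriv (deriv σ) t * ρ t - 2 * deriv ρ t * deriv σ t) / ρ t ^ 2 = l at *
    have hDσ : D * σ t = 0 := by
      rcases eq_or_ne D 0 with hD | hD
      · rw [hD, zero_mul]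
      obtain ⟨h1, h2⟩ := hD0.resolve_left hD
      have hs := shift_eq_zero_of_affine hinf (k := k + A - A * ρ t ^ 4)
        (l := l + 2 * B - ρ t ^ 3 * (A * σ t + 2 * B)) (s := σ t / ρ t) hD fun x hx => by
          have h3 : x + σ t / ρ t = X x t / ρ t := by
            rw [hX x hx]
            field_simp
          refine ⟨h1 x hx, ?_, ?_⟩
          · rw [h3]
            exact div_ne_zero (h2 x hx t ht) hρ'
          · have e := key' x hx
            have e' : D / (X x t / ρ t) ^ 3 = D / X x t ^ 3 * ρ t ^ 3 := by
              have := h2 x hx t ht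
              field_simp
            rw [h3, e']
            linear_combination e + (A * ρ t ^ 3) * hX x hx
      rw [(div_eq_zero_iff.1 hs).resolve_right hρ', mul_zero]
    obtain ⟨h1, h2⟩ := linear_coeffs_eq_zero hinf (a := k + A - A * ρ t ^ 4)
      (b := l + 2 * B - ρ t ^ 3 * (A * σ t + 2 * B)) fun x hx => by
        have e := key' x hx
        have e' : D / x ^ 3 = D / X x t ^ 3 * ρ t ^ 3 := by
          rcases eq_or_ne D 0 with hD | hD
          · simp [hD]
          · have hx0 := (hD0.resolve_left hD).1 x hx
            rw [hX x hx, (mul_eq_zero.1 hDσ).resolve_left hD, add_zero]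
            field_simp
        linear_combination e + (A * ρ t ^ 3) * hX x hx + e'
    exact ⟨h1, h2, hDσ⟩
  refine ⟨⟨sρ, sσ, hρ, fun t ht => ?_, fun t ht => ?_⟩, fun t ht => (coeff t ht).2.2⟩
  · have := (coeff t ht).1
    have hρ' := hρ t ht
    field_simp at this
    linear_combination this
  · have := (coeff t ht).2.1
    have hρ' := hρ t ht
    field_simp at this
    linear_combination this

end Compatibility

/-! ### Solution of the compatibility conditions -/

theorem mul_pos_of_ne_zero {J : Set ℝ} {h : ℝ → ℝ} (hJ : J.OrdConnected) (hc : ContinuousOn h J)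
    (h0 : ∀ t ∈ J, h t ≠ 0) {s t : ℝ} (hs : s ∈ J) (ht : t ∈ J) : 0 < h s * h t := by
  have key : ∀ u ∈ J, ∀ v ∈ J, h u < 0 → ¬ 0 < h v := fun u hu v hv h1 h2 => by
    obtain ⟨r, hr, hr0⟩ := (isPreconnected_iff_ordConnected.2 hJ).intermediate_value hu hv hc
      ⟨h1.le, h2.le⟩
    exact h0 r hr hr0
  rcases (h0 s hs).lt_or_gt with h1 | h1 <;> rcases (h0 t ht).lt_or_gt with h2 | h2
  · exact mul_pos_of_neg_of_neg h1 h2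
  · exact absurd h2 (key s hs t ht h1)
  · exact absurd h1 (key t ht s hs h2)
  · exact mul_pos h1 h2

/-- With respect to the time `S`, where `S' = s`, the function `h₁` is the derivative of `h`, and `h`
solves `h'' = a² h`. -/
theorem exists_eq_exp_add_exp {J : Set ℝ} {h h₁ S : ℝ → ℝ} {a : ℝ} (hJ : IsOpen J)
    (hJ' : J.OrdConnected) (hJn : J.Nonempty) (ha : a ≠ 0) {s : ℝ → ℝ}
    (hS : ∀ t ∈ J, HasDerivAt S (s t) t)
    (hh : ∀ t ∈ J, HasDerivAt h (s t * h₁ t) t)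
    (hh₁ : ∀ t ∈ J, HasDerivAt h₁ (s t * (a ^ 2 * h t)) t) :
    ∃ p q, ∀ t ∈ J, h t = p * Real.exp (a * S t) + q * Real.exp (-(a * S t)) ∧
      h₁ t = a * p * Real.exp (a * S t) - a * q * Real.exp (-(a * S t)) := by
  obtain ⟨p, hp⟩ := exists_eq_const hJ hJ' hJn fun t ht =>
    (((hh₁ t ht).add ((hh t ht).const_mul a)).mul (((hS t ht).const_mul a).neg.exp)).congr_deriv
      (by
        simp only [Pi.add_apply]
        ring)
  obtain ⟨q, hq⟩ := exists_eq_const hJ hJ' hJn fun t ht =>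
    (((hh₁ t ht).sub ((hh t ht).const_mul a)).mul (((hS t ht).const_mul a).exp)).congr_deriv
      (by
        simp only [Pi.sub_apply]
        ring)
  refine ⟨p / (2 * a), -q / (2 * a), fun t ht => ?_⟩
  have e1 := hp t ht
  have e2 := hq t ht
  simp only [Pi.add_apply, Pi.sub_apply, Pi.mul_apply] at e1 e2
  have h1 : Real.exp (-(a * S t)) = (Real.exp (a * S t))⁻¹ := Real.exp_neg _
  have h2 := (Real.exp_pos (a * S t)).ne'
  change (h₁ t + a * h t) * Real.exp (-(a * S t)) = p at e1
  rw [h1] at e1 ⊢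
  generalize Real.exp (a * S t) = y at *
  field_simp at e1
  constructor
  · field_simp
    linear_combination y * e1 - e2
  · field_simp
    linear_combination y * e1 + e2

section Solve

variable {A B a : ℝ} {J : Set ℝ} {T ρ σ σ' ρ' : ℝ → ℝ}

/-- The equation for `1 / ρ`. -/
theorem Profile.hasDerivAt_inv (h : Profile A B J ρ σ) (hJ : IsOpen J) {t : ℝ} (ht : t ∈ J) :
    HasDerivAt (fun t => (ρ t)⁻¹) (-deriv ρ t / ρ t ^ 2) t ∧
    HasDerivAt (fun t => -deriv ρ t / ρ t ^ 2) (A * (ρ t)⁻¹ - A * ρ t ^ 3) t := by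
  have h0 := h.ne_zero t ht
  have d := h.smooth_ρ.hasDerivAt_deriv hJ ht
  refine ⟨d.inv h0, (((h.smooth_ρ.smooth_deriv hJ).hasDerivAt_deriv hJ ht).neg.div (d.pow 2)
    (pow_ne_zero 2 h0)).congr_deriv ?_⟩
  have e := h.eq_ρ t ht
  simp only [Pi.pow_apply, Pi.neg_apply]
  field_simp
  push_cast
  linear_combination (-ρ t) * e

/-- The equation for the difference of two solutions `σ`. -/
theorem Profile.hasDerivAt_sub (h : Profile A B J ρ σ) (h' : Profile A B J ρ' σ') (hJ : IsOpen J)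
    (hρ : ∀ t ∈ J, ρ' t = ρ t) {t : ℝ} (ht : t ∈ J) :
    HasDerivAt (fun t => σ t - σ' t) (ρ t ^ 2 * ((deriv σ t - deriv σ' t) / ρ t ^ 2)) t ∧
    HasDerivAt (fun t => (deriv σ t - deriv σ' t) / ρ t ^ 2)
      (ρ t ^ 2 * (A * (σ t - σ' t))) t := by
  have h0 := h.ne_zero t ht
  have d := h.smooth_ρ.hasDerivAt_deriv hJ ht
  have e : deriv ρ' t = deriv ρ t :=
    deriv_unique_on hJ ht (h'.smooth_ρ.hasDerivAt_deriv hJ ht) d hρ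
  constructor
  · refine ((h.smooth_σ.hasDerivAt_deriv hJ ht).sub
      (h'.smooth_σ.hasDerivAt_deriv hJ ht)).congr_deriv ?_
    field_simp
  · refine ((((h.smooth_σ.smooth_deriv hJ).hasDerivAt_deriv hJ ht).sub
      ((h'.smooth_σ.smooth_deriv hJ).hasDerivAt_deriv hJ ht)).div (d.pow 2)
      (pow_ne_zero 2 h0)).congr_deriv ?_
    have e1 := h.eq_σ t ht
    have e2 := h'.eq_σ t ht
    rw [e, hρ t ht] at e2
    simp only [Pi.pow_apply, Pi.sub_apply]
    field_simp
    push_cast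
    linear_combination ρ t * (e1 - e2)

/-- For `A = 0`, the function `1 / ρ` is affine. -/
theorem Profile.exists_eq_div (h : Profile 0 B J ρ σ) (hJ : IsOpen J) (hJ' : J.OrdConnected)
    (h0 : 0 ∈ J) (hT : ∀ t ∈ J, HasDerivAt T (ρ t ^ 2) t) (hT0 : T 0 = 0) :
    ∃ β, ∀ t ∈ J, 0 < 1 + ρ 0 * β * t ∧ ρ t = ρ 0 / (1 + ρ 0 * β * t) ∧
      T t = ρ 0 ^ 2 * t / (1 + ρ 0 * β * t) := by
  obtain ⟨β, hβ⟩ := exists_eq_const hJ hJ' ⟨0, h0⟩ fun t ht =>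
    (h.hasDerivAt_inv hJ ht).2.congr_deriv (by ring)
  have hr : ∀ t ∈ J, (ρ t)⁻¹ = (ρ 0)⁻¹ + β * t := fun t ht => by
    have := eq_of_hasDerivAt_zero hJ hJ' (h := fun t => (ρ t)⁻¹ - β * t) (fun t ht =>
      ((h.hasDerivAt_inv hJ ht).1.sub ((hasDerivAt_id t).const_mul β)).congr_deriv
        (by rw [hβ t ht]; ring)) ht h0
    linarith
  have hρ0 := h.ne_zero 0 h0
  have hd : ∀ t ∈ J, 1 + ρ 0 * β * t = ρ 0 / ρ t := fun t ht => by
    rw [div_eq_mul_inv, hr t ht]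
    field_simp
  have hTt : ∀ t ∈ J, T t = ρ 0 * ρ t * t := fun t ht => by
    have := eq_of_hasDerivAt_zero hJ hJ' (h := fun t => T t - ρ 0 * ρ t * t) (fun t ht =>
      ((hT t ht).sub ((((h.smooth_ρ.hasDerivAt_deriv hJ ht).const_mul (ρ 0)).mul
        (hasDerivAt_id t)))).congr_deriv (by
          have e1 : -deriv ρ t / ρ t ^ 2 = β := hβ t ht
          have e2 := hr t ht
          have := h.ne_zero t ht
          simp only [id]
          field_simp at e1 e2
          linear_combination (-ρ t) * e2 + ρ 0 * t * e1)) ht h0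
    rw [hT0] at this
    linarith
  refine ⟨β, fun t ht => ?_⟩
  have := h.ne_zero t ht
  rw [hd t ht, hTt t ht]
  refine ⟨?_, by field_simp, by field_simp⟩
  have hp := mul_pos_of_ne_zero hJ' h.smooth_ρ.continuousOn h.ne_zero h0 ht
  have e : ρ 0 / ρ t = ρ 0 * ρ t / ρ t ^ 2 := by field_simp
  rw [e]
  positivity

theorem Profile.exists_sub_eq (h : Profile 0 B J ρ σ) (h' : Profile 0 B J ρ' σ') (hJ : IsOpen J)
    (hJ' : J.OrdConnected) (hJn : J.Nonempty) (hρ : ∀ t ∈ J, ρ' t = ρ t)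
    (hT : ∀ t ∈ J, HasDerivAt T (ρ t ^ 2) t) :
    ∃ k₁ k₂, ∀ t ∈ J, σ t = σ' t + k₁ + k₂ * T t := by
  obtain ⟨k₂, hk₂⟩ := exists_eq_const hJ hJ' hJn fun t ht =>
    (h.hasDerivAt_sub h' hJ hρ ht).2.congr_deriv (by ring)
  obtain ⟨k₁, hk₁⟩ := exists_eq_const hJ hJ' hJn fun t ht =>
    ((h.hasDerivAt_sub h' hJ hρ ht).1.sub ((hT t ht).const_mul k₂)).congr_deriv
      (by rw [hk₂ t ht]; ring)
  refine ⟨k₁, k₂, fun t ht => ?_⟩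
  have := hk₁ t ht
  simp only [Pi.sub_apply] at this
  linarith

theorem Profile.exists_sub_eq_exp (h : Profile (a ^ 2) B J ρ σ) (h' : Profile (a ^ 2) B J ρ' σ')
    (ha : a ≠ 0) (hJ : IsOpen J) (hJ' : J.OrdConnected) (hJn : J.Nonempty)
    (hρ : ∀ t ∈ J, ρ' t = ρ t) (hT : ∀ t ∈ J, HasDerivAt T (ρ t ^ 2) t) :
    ∃ k₁ k₂, ∀ t ∈ J, σ t = σ' t + k₁ * Real.exp (a * T t) + k₂ * Real.exp (-(a * T t)) := by
  obtain ⟨p, q, hpq⟩ := exists_eq_exp_add_exp hJ hJ' hJn ha hT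
    (fun t ht => (h.hasDerivAt_sub h' hJ hρ ht).1) fun t ht => (h.hasDerivAt_sub h' hJ hρ ht).2
  exact ⟨p, q, fun t ht => by linarith [(hpq t ht).1]⟩

/-- For `A = a²`, the functions `exp (± a T) / ρ` are combinations of `exp (± a t)`. -/
theorem Profile.exists_inv_mul_exp_eq (h : Profile (a ^ 2) B J ρ σ) (ha : a ≠ 0) (hJ : IsOpen J)
    (hJ' : J.OrdConnected) (h0 : 0 ∈ J) (hT : ∀ t ∈ J, HasDerivAt T (ρ t ^ 2) t) (hT0 : T 0 = 0) :
    ∃ p q, p + q = (ρ 0)⁻¹ ∧ a * p - a * q = -deriv ρ 0 / ρ 0 ^ 2 + a * ρ 0 ∧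
      ∀ t ∈ J, (ρ t)⁻¹ * Real.exp (a * T t) =
        p * Real.exp (a * t) + q * Real.exp (-(a * t)) := by
  obtain ⟨p, q, hpq⟩ := exists_eq_exp_add_exp (h := fun t => (ρ t)⁻¹ * Real.exp (a * T t))
    (h₁ := fun t => (-deriv ρ t / ρ t ^ 2 + a * ρ t) * Real.exp (a * T t)) (S := id) hJ hJ'
    ⟨0, h0⟩ ha (fun t _ => hasDerivAt_id t) (fun t ht => by
      refine ((h.hasDerivAt_inv hJ ht).1.mul ((hT t ht).const_mul a).exp).congr_deriv ?_
      have := h.ne_zero t ht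
      field_simp) fun t ht => by
      refine (((h.hasDerivAt_inv hJ ht).2.add ((h.smooth_ρ.hasDerivAt_deriv hJ ht).const_mul
        a)).mul ((hT t ht).const_mul a).exp).congr_deriv ?_
      have := h.ne_zero t ht
      simp only [Pi.add_apply]
      field_simp
      ring
  have := hpq 0 h0
  simp [hT0] at this
  exact ⟨p, q, this.1.symm, this.2.symm, fun t ht => by simpa using (hpq t ht).1⟩

end Solve

/-- The solution `ρ` of the compatibility conditions with `A = a²`, in terms of two parameters. -/
theorem Profile.exists_eq_two1 {a B : ℝ} {J : Set ℝ} {T ρ σ : ℝ → ℝ}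
    (h : Profile (a ^ 2) B J ρ σ) (ha : 0 < a) (hJ : IsOpen J) (hJ' : J.OrdConnected)
    (h0 : 0 ∈ J) (hT : ∀ t ∈ J, HasDerivAt T (ρ t ^ 2) t) (hT0 : T 0 = 0) :
    ∃ α β, 0 < α + β + 1 ∧ ∀ t ∈ J, 0 < F24.Tminus a α β t ∧ 0 < F24.Tplus a α β t ∧
      √(α + β + 1) / √(F24.Tplus a α β t * F24.Tminus a α β t) = |ρ t| ∧
      T t = t + Real.log (F24.Tminus a α β t / F24.Tplus a α β t) / (2 * a) := by
  obtain ⟨p, q, e1, e2, e3⟩ := h.exists_inv_mul_exp_eq ha.ne' hJ hJ' h0 hT hT0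
  obtain ⟨p', q', f1, f2, f3⟩ := Profile.exists_inv_mul_exp_eq (a := -a) (by simpa using h)
    (neg_ne_zero.2 ha.ne') hJ hJ' h0 hT hT0
  -- `q` and `q'` are the coefficients of `exp (-a t)` in `exp (a T) / ρ` and of `exp (a t)` in
  -- `exp (-a T) / ρ`; multiplied by `K = 1 / ρ(0)` they are the parameters `α` and `β`.
  have hρ0 := h.ne_zero 0 h0
  set K := (ρ 0)⁻¹ with hK
  have hKρ : K * ρ 0 = 1 := inv_mul_cancel₀ hρ0
  have hK0 : K ≠ 0 := inv_ne_zero hρ0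
  have hqq : q + q' = K - ρ 0 := by
    have : 2 * a * (q + q') = 2 * a * (K - ρ 0) := by linear_combination a * e1 + a * f1 - e2 + f2
    exact mul_left_cancel₀ (by positivity) this
  have hsum : q * K + q' * K + 1 = K ^ 2 := by linear_combination K * hqq - hKρ
  have hm : ∀ t ∈ J, F24.Tminus a (q * K) (q' * K) t =
      K * (ρ t)⁻¹ * Real.exp (a * T t - a * t) := fun t ht => by
    have e := e3 t ht
    have := (Real.exp_pos (a * t)).ne'
    rw [Real.exp_neg] at e
    rw [F24.Tminus, Real.exp_sub, show -(2 * a * t) = -(a * t) + -(a * t) by ring, Real.exp_add,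
      Real.exp_neg]
    generalize Real.exp (a * t) = y at *
    generalize Real.exp (a * T t) = z at *
    generalize (ρ t)⁻¹ = r at *
    field_simp at e ⊢
    linear_combination y ^ 2 * hsum - y ^ 2 * K * e1 - K * e
  have hp : ∀ t ∈ J, F24.Tplus a (q * K) (q' * K) t =
      K * (ρ t)⁻¹ * Real.exp (a * t - a * T t) := fun t ht => by
    have e := f3 t ht
    have := (Real.exp_pos (a * t)).ne'
    have := (Real.exp_pos (a * T t)).ne'
    rw [neg_mul, neg_mul, neg_neg, Real.exp_neg, Real.exp_neg] at e
    rw [F24.Tplus, Real.exp_sub, show 2 * a * t = a * t + a * t by ring, Real.exp_add]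
    generalize Real.exp (a * t) = y at *
    generalize Real.exp (a * T t) = z at *
    generalize (ρ t)⁻¹ = r at *
    field_simp at e ⊢
    linear_combination z * hsum - z * K * f1 - K * e
  refine ⟨q * K, q' * K, hsum ▸ by positivity, fun t ht => ?_⟩
  have hρt := h.ne_zero t ht
  have hpos : 0 < K * (ρ t)⁻¹ := by
    rw [hK, ← mul_inv]
    exact inv_pos.2 (mul_pos_of_ne_zero hJ' h.smooth_ρ.continuousOn h.ne_zero h0 ht)
  rw [hm t ht, hp t ht]
  refine ⟨by positivity, by positivity, ?_, ?_⟩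
  · have e : K * (ρ t)⁻¹ * Real.exp (a * t - a * T t) *
        (K * (ρ t)⁻¹ * Real.exp (a * T t - a * t)) = (K * (ρ t)⁻¹) ^ 2 := by
      rw [mul_mul_mul_comm, ← Real.exp_add]
      simp [sq]
    rw [e, hsum, Real.sqrt_sq_eq_abs, Real.sqrt_sq_eq_abs, abs_mul, abs_inv (ρ t)]
    have h1 := abs_pos.2 hρt
    have h2 := abs_pos.2 hK0
    rw [div_eq_iff (by positivity)]
    generalize |ρ t| = u at *
    generalize |K| = v at *
    field_simp
  · rw [mul_div_mul_left _ _ hpos.ne', ← Real.exp_sub, Real.log_exp]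
    field_simp
    ring

/-- The determining equations fix the multiplier up to a constant. -/
theorem Intertwines.exists_eq_const_mul {V : ℝ → ℝ} {I J : Set ℝ} {X m X' m' : ℝ → ℝ → ℝ}
    {T T' ρ σ a b ρ' σ' a' b' : ℝ → ℝ} (h : Intertwines V (I ×ˢ J) X T m ρ σ a b)
    (h' : Intertwines V (I ×ˢ J) X' T' m' ρ' σ' a' b') (hI : IsOpen I) (hI' : I.OrdConnected)
    (hIn : I.Nonempty) (hJ : IsOpen J) (hJ' : J.OrdConnected) (hJn : J.Nonempty)
    (hρ : ∀ t ∈ J, ρ t ≠ 0) (hm : ∀ x ∈ I, ∀ t ∈ J, m x t ≠ 0)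
    (hm' : ∀ x ∈ I, ∀ t ∈ J, 0 < m' x t)
    (hX : ∀ x ∈ I, ∀ t ∈ J, X x t = X' x t) :
    ∃ s κ : ℝ, (s = 1 ∨ s = -1) ∧ ∀ x ∈ I, ∀ t ∈ J, m x t = s * (m' x t * Real.exp κ) := by
  have hD : IsOpen (I ×ˢ J) := hI.prod hJ
  -- `X` determines `ρ`, `a` and `b`, hence the logarithmic derivatives of `m`.
  have hab : ∀ t ∈ J, a t = a' t ∧ b t = b' t ∧ ρ t = ρ' t := fun t ht => by
    obtain ⟨x₀, hx₀⟩ := hIn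
    have e : ρ t = ρ' t := deriv_unique_on hI hx₀ (h.X_x hD (show (x₀, t) ∈ I ×ˢ J from ⟨hx₀, ht⟩))
      (h'.X_x hD (show (x₀, t) ∈ I ×ˢ J from ⟨hx₀, ht⟩)) fun y hy => hX y hy t ht
    have := linear_coeffs_eq_zero (infinite_of_isOpen hI ⟨x₀, hx₀⟩) (a := a t - a' t)
      (b := b t - b' t) fun x hx => by
        have e2 := deriv_unique_on hJ ht (h.X_t (show (x, t) ∈ I ×ˢ J from ⟨hx, ht⟩))
          (h'.X_t (show (x, t) ∈ I ×ˢ J from ⟨hx, ht⟩)) fun s hs => hX x hx s hs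
        rw [← e] at e2
        linear_combination mul_left_cancel₀ (hρ t ht) e2
    exact ⟨by linarith [this.1], by linarith [this.2], e⟩
  have q1 : ∀ x ∈ I, ∀ t ∈ J, HasDerivAt (fun y => m y t / m' y t) 0 x := fun x hx t ht => by
    have hp : (x, t) ∈ I ×ˢ J := ⟨hx, ht⟩
    refine ((h.m_x hp).div (h'.m_x hp) (hm' x hx t ht).ne').congr_deriv ?_
    rw [(hab t ht).1, (hab t ht).2.1]
    simp only [div_eq_zero_iff]
    left
    ring
  have q2 : ∀ x ∈ I, ∀ t ∈ J, HasDerivAt (fun s => m x s / m' x s) 0 t := fun x hx t ht => by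
    have hp : (x, t) ∈ I ×ˢ J := ⟨hx, ht⟩
    refine ((h.m_t hp).div (h'.m_t hp) (hm' x hx t ht).ne').congr_deriv ?_
    rw [(hab t ht).1, (hab t ht).2.1, (hab t ht).2.2, hX x hx t ht]
    simp only [div_eq_zero_iff]
    left
    ring
  obtain ⟨x₀, hx₀⟩ := hIn
  obtain ⟨t₀, ht₀⟩ := hJn
  set k := m x₀ t₀ / m' x₀ t₀ with hk
  have hk0 : k ≠ 0 := div_ne_zero (hm x₀ hx₀ t₀ ht₀) (hm' x₀ hx₀ t₀ ht₀).ne'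
  have hmk : ∀ x ∈ I, ∀ t ∈ J, m x t = k * m' x t := fun x hx t ht => by
    have e1 := eq_of_hasDerivAt_zero hI hI' (fun y hy => q1 y hy t ht) hx hx₀
    have e2 := eq_of_hasDerivAt_zero hJ hJ' (fun s hs => q2 x₀ hx₀ s hs) ht ht₀
    rw [hk, ← e2, ← e1]
    have := (hm' x hx t ht).ne'
    field_simp
  rcases hk0.lt_or_gt with h1 | h1
  · refine ⟨-1, Real.log (-k), Or.inr rfl, fun x hx t ht => ?_⟩
    rw [Real.exp_log (by linarith), hmk x hx t ht]
    ring
  · refine ⟨1, Real.log k, Or.inl rfl, fun x hx t ht => ?_⟩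
    rw [Real.exp_log h1, hmk x hx t ht]
    ring

/-! ### The symmetries that fix `t = 0`: families with a pole -/

namespace F3

theorem converse {C D : ℝ} {E I J : Set ℝ} {μ θ T : ℝ → ℝ} {f X : ℝ → ℝ → ℝ} (hD : D ≠ 0)
    (hE : IsOpen E) (hE0 : E ⊆ Set.Ioi 0) (hd : IsDrift (fun x => 2 * C + D / x ^ 2) E μ θ)
    (hs : IsLieSymmetryFixingZero μ E I J f X T) :
    ∃ α β k : ℝ, 0 < α ∧ k ≠ 0 ∧ I ×ˢ J ⊆ (F3.two1 C α β).dom ∧ ∀ x ∈ I, ∀ t ∈ J,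
      X x t = (F3.two1 C α β).X x t ∧ T t = (F3.two1 C α β).T t ∧
      f x t = k * (F3.two1 C α β).mult θ x t := by
  have hV : (fun x => 2 * C + D / x ^ 2) = potential 0 0 C D := by
    funext x
    simp [potential]
  obtain ⟨sm, hm0, ρ, σ, a, b, hρ, hi⟩ := intertwines_of_preservesSolutions hd hE hs.openI hs.ordI
    hs.nonemptyI hs.subI hs.openJ hs.smooth_f hs.smooth_X hs.smooth_T hs.maps hs.f_ne hs.X_ne
    hs.preserves rfl
  have hi' := hi
  rw [hV] at hi'
  obtain ⟨x₀, hx₀⟩ := hs.nonemptyI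
  obtain ⟨hprof, hσ⟩ := hi'.profile hs.openI hs.nonemptyI hs.openJ hs.smooth_X sm hρ hm0
    (Or.inr ⟨fun x hx => (hE0 (hs.subI hx)).ne', fun x hx t ht => (hE0 (hs.maps x hx t ht)).ne'⟩)
  have hT : ∀ t ∈ J, HasDerivAt T (ρ t ^ 2) t := fun t ht =>
    hi.T_t (show (x₀, t) ∈ I ×ˢ J from ⟨hx₀, ht⟩)
  obtain ⟨β, hβ⟩ := hprof.exists_eq_div hs.openJ hs.ordJ hs.zero_mem hT hs.T_zero
  -- A pole of the potential must be mapped to a pole: `σ = 0`.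
  have hXρ : ∀ x ∈ I, ∀ t ∈ J, X x t = ρ t * x := fun x hx t ht => by
    rw [hi.X_eq (show (x, t) ∈ I ×ˢ J from ⟨hx, ht⟩),
      (mul_eq_zero.1 (hσ t ht)).resolve_left hD, add_zero]
  have hα : 0 < ρ 0 := by
    have h1 : 0 < X x₀ 0 := hE0 (hs.maps x₀ hx₀ 0 hs.zero_mem)
    rw [hXρ x₀ hx₀ 0 hs.zero_mem] at h1
    exact pos_of_mul_pos_left h1 (hE0 (hs.subI hx₀)).le
  have hg := two1_isHeatSymmetry C D hα β
  obtain ⟨ρ', σ', a', b', hgi⟩ := hg.intertwines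
  have hdom : I ×ˢ J ⊆ (F3.two1 C (ρ 0) β).dom := fun p hp => (hβ p.2 hp.2).1
  have hXg : ∀ x ∈ I, ∀ t ∈ J, X x t = (F3.two1 C (ρ 0) β).X x t := fun x hx t ht => by
    rw [hXρ x hx t ht, (hβ t ht).2.1, two1, div_mul_eq_mul_div]
  obtain ⟨s, κ, hs1, hκ⟩ := hi.exists_eq_const_mul (hgi.mono hdom) hs.openI hs.ordI hs.nonemptyI
    hs.openJ hs.ordJ ⟨0, hs.zero_mem⟩ hρ hm0 (fun x hx t ht => hg.m_pos x t (hdom ⟨hx, ht⟩)) hXg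
  refine ⟨ρ 0, β, s * Real.exp κ, hα, ?_, hdom, fun x hx t ht => ⟨hXg x hx t ht, (hβ t ht).2.2, ?_⟩⟩
  · rcases hs1 with rfl | rfl <;> simp [(Real.exp_pos κ).ne']
  · have h1 := hκ x hx t ht
    have h2 := hd.theta_ne (hs.subI hx)
    have h3 := hd.theta_ne (hs.maps x hx t ht)
    rw [Transf.mult, ← hXg x hx t ht]
    field_simp at h1 ⊢
    linear_combination h1

end F3

namespace F4

theorem converse {A C D : ℝ} {E I J : Set ℝ} {μ θ T : ℝ → ℝ} {f X : ℝ → ℝ → ℝ} (hA : 0 < A)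
    (hD : D ≠ 0) (hE : IsOpen E) (hE0 : E ⊆ Set.Ioi 0)
    (hd : IsDrift (fun x => A * x ^ 2 + 2 * C + D / x ^ 2) E μ θ)
    (hs : IsLieSymmetryFixingZero μ E I J f X T) :
    ∃ α β k : ℝ, 0 < α + β + 1 ∧ k ≠ 0 ∧ I ×ˢ J ⊆ (F24.two1 √A 0 (nu A C) α β).dom ∧
      ∀ x ∈ I, ∀ t ∈ J, X x t = (F24.two1 √A 0 (nu A C) α β).X x t ∧
        T t = (F24.two1 √A 0 (nu A C) α β).T t ∧
        f x t = k * (F24.two1 √A 0 (nu A C) α β).mult θ x t := by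
  have hV : (fun x => A * x ^ 2 + 2 * C + D / x ^ 2) = potential ((√A) ^ 2) 0 C D := by
    funext x
    simp [potential, Real.sq_sqrt hA.le]
  have ha := Real.sqrt_pos.2 hA
  obtain ⟨sm, hm0, ρ, σ, a, b, hρ, hi⟩ := intertwines_of_preservesSolutions hd hE hs.openI hs.ordI
    hs.nonemptyI hs.subI hs.openJ hs.smooth_f hs.smooth_X hs.smooth_T hs.maps hs.f_ne hs.X_ne
    hs.preserves rfl
  have hi' := hi
  rw [hV] at hi'
  obtain ⟨x₀, hx₀⟩ := hs.nonemptyI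
  obtain ⟨hprof, hσ⟩ := hi'.profile hs.openI hs.nonemptyI hs.openJ hs.smooth_X sm hρ hm0
    (Or.inr ⟨fun x hx => (hE0 (hs.subI hx)).ne', fun x hx t ht => (hE0 (hs.maps x hx t ht)).ne'⟩)
  have hT : ∀ t ∈ J, HasDerivAt T (ρ t ^ 2) t := fun t ht =>
    hi.T_t (show (x₀, t) ∈ I ×ˢ J from ⟨hx₀, ht⟩)
  obtain ⟨α, β, hαβ, hp⟩ := hprof.exists_eq_two1 ha hs.openJ hs.ordJ hs.zero_mem hT hs.T_zero
  have hXρ : ∀ x ∈ I, ∀ t ∈ J, X x t = ρ t * x := fun x hx t ht => by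
    rw [hi.X_eq (show (x, t) ∈ I ×ˢ J from ⟨hx, ht⟩),
      (mul_eq_zero.1 (hσ t ht)).resolve_left hD, add_zero]
  have hρ0 : ∀ t ∈ J, 0 < ρ t := fun t ht => by
    have h1 : 0 < X x₀ t := hE0 (hs.maps x₀ hx₀ t ht)
    rw [hXρ x₀ hx₀ t ht] at h1
    exact pos_of_mul_pos_left h1 (hE0 (hs.subI hx₀)).le
  have hg : (F24.two1 √A 0 (nu A C) α β).IsHeatSymmetry _ :=
    F24.two1_isHeatSymmetry ha (potential_eq (C := C) (D := D) hA) hαβ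
  obtain ⟨ρ', σ', a', b', hgi⟩ := hg.intertwines
  have hdom : I ×ˢ J ⊆ (F24.two1 √A 0 (nu A C) α β).dom := fun p hq =>
    ⟨(hp p.2 hq.2).1, (hp p.2 hq.2).2.1⟩
  have hXg : ∀ x ∈ I, ∀ t ∈ J, X x t = (F24.two1 √A 0 (nu A C) α β).X x t := fun x hx t ht => by
    have e := (hp t ht).2.2.1
    rw [abs_of_pos (hρ0 t ht)] at e
    rw [hXρ x hx t ht, ← e]
    simp only [F24.two1]
    ring
  obtain ⟨s, κ, hs1, hκ⟩ := hi.exists_eq_const_mul (hgi.mono hdom) hs.openI hs.ordI hs.nonemptyI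
    hs.openJ hs.ordJ ⟨0, hs.zero_mem⟩ hρ hm0 (fun x hx t ht => hg.m_pos x t (hdom ⟨hx, ht⟩)) hXg
  refine ⟨α, β, s * Real.exp κ, hαβ, ?_, hdom,
    fun x hx t ht => ⟨hXg x hx t ht, (hp t ht).2.2.2, ?_⟩⟩
  · rcases hs1 with rfl | rfl <;> simp [(Real.exp_pos κ).ne']
  · have h1 := hκ x hx t ht
    have h2 := hd.theta_ne (hs.subI hx)
    have h3 := hd.theta_ne (hs.maps x hx t ht)
    rw [Transf.mult, ← hXg x hx t ht]
    field_simp at h1 ⊢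
    linear_combination h1

end F4

/-! ### The symmetries that fix `t = 0`: families without a pole -/

theorem Intertwines.eq_of_X_eq {V : ℝ → ℝ} {I J : Set ℝ} {X m : ℝ → ℝ → ℝ}
    {T ρ σ a b r s : ℝ → ℝ} (h : Intertwines V (I ×ˢ J) X T m ρ σ a b) (hI : I.Infinite)
    (hX : ∀ x ∈ I, ∀ t ∈ J, X x t = r t * x + s t) {t : ℝ} (ht : t ∈ J) :
    ρ t = r t ∧ σ t = s t := by
  have := linear_coeffs_eq_zero hI (a := ρ t - r t) (b := σ t - s t) fun x hx => by
    have e := h.X_eq (show (x, t) ∈ I ×ˢ J from ⟨hx, ht⟩)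
    rw [hX x hx t ht] at e
    linarith
  exact ⟨by linarith [this.1], by linarith [this.2]⟩

namespace F1

/-- Multiplication by any positive constant is a composition of the symmetries `two2`. -/
theorem exists_comp_eq_exp (B C κ : ℝ) : ∃ g, Transf.IsComposition (two B C) g ∧
    g.IsHeatSymmetry (fun x => 4 * B * x + 2 * C) ∧ g.dom = Set.univ ∧
    ∀ x t, g.X x t = x ∧ g.T t = t ∧ g.m x t = Real.exp κ := by
  refine ⟨(two2 B κ (-1)).comp (two2 B (-κ) 1), .comp _ _ (.of _ (Or.inr ⟨_, _, rfl⟩))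
    (.of _ (Or.inr ⟨_, _, rfl⟩)), (two2_isHeatSymmetry B C _ _).comp (two2_isHeatSymmetry B C _ _),
    by simp [Transf.comp, two2], fun x t => ⟨?_, rfl, ?_⟩⟩
  · simp only [Transf.comp, two2]
    ring
  · simp only [Transf.comp, two2]
    rw [← Real.exp_add]
    congr 1
    ring

theorem converse {B C : ℝ} {E I J : Set ℝ} {μ θ T : ℝ → ℝ} {f X : ℝ → ℝ → ℝ} (hE : IsOpen E)
    (hd : IsDrift (fun x => 4 * B * x + 2 * C) E μ θ)
    (hs : IsLieSymmetryFixingZero μ E I J f X T) :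
    ∃ g, Transf.IsComposition (F1.two B C) g ∧ ∃ s : ℝ, (s = 1 ∨ s = -1) ∧
      I ×ˢ J ⊆ g.dom ∧ ∀ x ∈ I, ∀ t ∈ J,
        X x t = g.X x t ∧ T t = g.T t ∧ f x t = s * g.mult θ x t := by
  have hV : (fun x => 4 * B * x + 2 * C) = potential 0 B C 0 := by
    funext x
    simp [potential]
  obtain ⟨sm, hm0, ρ, σ, a, b, hρ, hi⟩ := intertwines_of_preservesSolutions hd hE hs.openI hs.ordI
    hs.nonemptyI hs.subI hs.openJ hs.smooth_f hs.smooth_X hs.smooth_T hs.maps hs.f_ne hs.X_ne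
    hs.preserves rfl
  have hi' := hi
  rw [hV] at hi'
  have hinf := infinite_of_isOpen hs.openI hs.nonemptyI
  have hJn : J.Nonempty := ⟨0, hs.zero_mem⟩
  have hprof := (hi'.profile hs.openI hs.nonemptyI hs.openJ hs.smooth_X sm hρ hm0 (Or.inl rfl)).1
  have hT : ∀ t ∈ J, HasDerivAt T (ρ t ^ 2) t := fun t ht => by
    obtain ⟨x₀, hx₀⟩ := hs.nonemptyI
    exact hi.T_t (show (x₀, t) ∈ I ×ˢ J from ⟨hx₀, ht⟩)
  obtain ⟨β, hβ⟩ := hprof.exists_eq_div hs.openJ hs.ordJ hs.zero_mem hT hs.T_zero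
  have hα := hρ 0 hs.zero_mem
  -- `g₁` has the same slope `ρ` and the same `T`.
  set g₁ := F1.two1 B C (ρ 0) β with hg₁
  have h₁ : g₁.IsHeatSymmetry _ := two1_isHeatSymmetry B C hα β
  have hdom : I ×ˢ J ⊆ g₁.dom := fun p hp => (hβ p.2 hp.2).1
  have hT₁ : ∀ t ∈ J, T t = g₁.T t := fun t ht => (hβ t ht).2.2
  obtain ⟨ρ₁, σ₁, a₁, b₁, hi₁⟩ := h₁.intertwines
  replace hi₁ := hi₁.mono hdom
  have hρ₁ : ∀ t ∈ J, ρ₁ t = ρ t := fun t ht =>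
    (hi₁.eq_of_X_eq hinf (r := ρ) (s := fun t => -(ρ 0 * (B * t ^ 2)) / (1 + ρ 0 * β * t)
      + B * ρ 0 ^ 4 * t ^ 2 / (1 + ρ 0 * β * t) ^ 2) (fun x hx t ht => by
        rw [(hβ t ht).2.1]
        simp only [hg₁, two1]
        ring) ht).1
  rw [hV] at hi₁
  have hprof₁ := (hi₁.profile hs.openI hs.nonemptyI hs.openJ (h₁.smooth_X.mono hdom)
    (h₁.smooth_m.mono hdom) (fun t ht => (hρ₁ t ht).symm ▸ hρ t ht)
    (fun x hx t ht => (h₁.m_pos x t (hdom ⟨hx, ht⟩)).ne') (Or.inl rfl)).1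
  obtain ⟨k₁, k₂, hk⟩ := hprof.exists_sub_eq hprof₁ hs.openJ hs.ordJ hJn hρ₁ hT
  -- A subsequent `two2` corrects the intercept `σ`.
  set g₂ := g₁.comp (two2 B (-k₁) (-k₂)) with hg₂
  have h₂ : g₂.IsHeatSymmetry _ := h₁.comp (two2_isHeatSymmetry B C (-k₁) (-k₂))
  have hdom₂ : I ×ˢ J ⊆ g₂.dom := fun p hp => ⟨hdom hp, trivial⟩
  have hX₂ : ∀ x ∈ I, ∀ t ∈ J, X x t = g₂.X x t := fun x hx t ht => by
    have e : g₂.X x t = g₁.X x t - -k₁ - -k₂ * g₁.T t := rfl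
    have hp : (x, t) ∈ I ×ˢ J := ⟨hx, ht⟩
    rw [e, hi.X_eq hp, hi₁.X_eq hp, hk t ht, hρ₁ t ht, hT₁ t ht]
    ring
  obtain ⟨ρ₂, σ₂, a₂, b₂, hi₂⟩ := h₂.intertwines
  obtain ⟨s, κ, hs1, hκ⟩ := hi.exists_eq_const_mul (hi₂.mono hdom₂) hs.openI hs.ordI hs.nonemptyI
    hs.openJ hs.ordJ hJn hρ hm0 (fun x hx t ht => h₂.m_pos x t (hdom₂ ⟨hx, ht⟩)) hX₂
  -- Now `m` is off by a constant only, whose absolute value is itself such a composition.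
  obtain ⟨g₃, hc₃, -, hd₃, hg₃⟩ := exists_comp_eq_exp B C κ
  refine ⟨g₂.comp g₃, .comp _ _ (.comp _ _ (.of _ (Or.inl ⟨_, _, hα, rfl⟩))
    (.of _ (Or.inr ⟨_, _, rfl⟩))) hc₃, s, hs1, fun p hp => ⟨hdom₂ hp, hd₃ ▸ trivial⟩,
    fun x hx t ht => ?_⟩
  have hX₃ : (g₂.comp g₃).X x t = X x t := by rw [hX₂ x hx t ht]; exact (hg₃ _ _).1
  refine ⟨hX₃.symm, ?_, ?_⟩
  · rw [hT₁ t ht]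
    exact (hg₃ 0 _).2.1.symm
  · have h1 := hκ x hx t ht
    have h2 := hd.theta_ne (hs.subI hx)
    have h3 := hd.theta_ne (hs.maps x hx t ht)
    have h4 : (g₂.comp g₃).m x t = g₂.m x t * Real.exp κ :=
      congrArg (g₂.m x t * ·) (hg₃ _ _).2.2
    rw [Transf.mult, hX₃, h4]
    field_simp at h1 ⊢
    linear_combination h1

end F1

/-- A reflection that preserves the potential. -/
theorem Intertwines.reflect {V : ℝ → ℝ} {D : Set (ℝ × ℝ)} {X m : ℝ → ℝ → ℝ}
    {T ρ σ a b : ℝ → ℝ} (h : Intertwines V D X T m ρ σ a b) {r c : ℝ} (hr : r = 1 ∨ r = -1)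
    (hV : ∀ x, V (r * (x + c) - c) = V x) :
    Intertwines V D (fun x t => r * (X x t + c) - c) T m (fun t => r * ρ t)
      (fun t => r * (σ t + c) - c) a b := by
  have hr2 : r ^ 2 = 1 := by rcases hr with rfl | rfl <;> norm_num
  refine ⟨fun hp => ?_, fun hp => ?_, fun hp => ?_, h.m_x, fun {x t} hp => ?_⟩
  · rw [h.X_eq hp]
    ring
  · exact ((((h.X_t hp).add_const c).const_mul r).sub_const c).congr_deriv (by ring)
  · exact (h.T_t hp).congr_deriv (by rw [mul_pow, hr2, one_mul])
  · exact (h.m_t hp).congr_deriv (by rw [hV, mul_pow, hr2, one_mul])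

theorem F24.two1_T_zero {a c ν α β : ℝ} (h : 0 < α + β + 1) : (F24.two1 a c ν α β).T 0 = 0 := by
  have h1 : β + 1 + α = α + β + 1 := by ring
  have h2 : α + 1 + β = α + β + 1 := by ring
  simp [F24.two1, F24.Tminus, F24.Tplus, h1, h2, h.ne']

namespace F2

variable {A B C : ℝ}

/-- Multiplication by any positive constant is a commutator of the symmetries `two2`. -/
theorem exists_comp_eq_exp (hA : 0 < A) (B C κ : ℝ) :
    ∃ g, Transf.IsComposition (two A B C) g ∧ g.dom = Set.univ ∧
    ∀ x t, g.X x t = x ∧ g.T t = t ∧ g.m x t = Real.exp κ := by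
  have ha := Real.sqrt_pos.2 hA
  unfold two
  generalize √A = a at *
  generalize 2 * B / A = c at *
  set q := -κ / (2 * a) with hq
  have hκ : κ = -2 * a * q := by rw [hq]; field_simp
  refine ⟨((F24.two2 a c 1 0).comp (F24.two2 a c 0 q)).comp
    ((F24.two2 a c (-1) 0).comp (F24.two2 a c 0 (-q))),
    .comp _ _ (.comp _ _ (.of _ (Or.inr ⟨_, _, rfl⟩)) (.of _ (Or.inr ⟨_, _, rfl⟩)))
      (.comp _ _ (.of _ (Or.inr ⟨_, _, rfl⟩)) (.of _ (Or.inr ⟨_, _, rfl⟩))),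
    by simp [Transf.comp, F24.two2], fun x t => ⟨?_, rfl, ?_⟩⟩
  · simp only [Transf.comp, F24.two2]
    ring
  · simp only [Transf.comp, F24.two2]
    rw [← Real.exp_sub, ← Real.exp_sub, ← Real.exp_sub, ← Real.exp_sub, ← Real.exp_add,
      ← Real.exp_add, ← Real.exp_add, hκ, Real.exp_neg]
    congr 1
    have := (Real.exp_pos (a * t)).ne'
    generalize Real.exp (a * t) = y at *
    field_simp
    ring

theorem converse {E I J : Set ℝ} {μ θ T : ℝ → ℝ} {f X : ℝ → ℝ → ℝ} (hA : 0 < A) (hE : IsOpen E)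
    (hd : IsDrift (fun x => A * x ^ 2 + 4 * B * x + 2 * C) E μ θ)
    (hs : IsLieSymmetryFixingZero μ E I J f X T) :
    ∃ g, Transf.IsComposition (F2.two A B C) g ∧ ∃ r s : ℝ,
      (r = 1 ∨ r = -1) ∧ (s = 1 ∨ s = -1) ∧ I ×ˢ J ⊆ g.dom ∧ ∀ x ∈ I, ∀ t ∈ J,
        X x t + 2 * B / A = r * (g.X x t + 2 * B / A) ∧ T t = g.T t ∧
        f x t = s * (θ x / θ (X x t) * g.m x t) := by
  have hV : (fun x => A * x ^ 2 + 4 * B * x + 2 * C) = potential ((√A) ^ 2) B C 0 := by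
    funext x
    simp [potential, Real.sq_sqrt hA.le]
  have ha := Real.sqrt_pos.2 hA
  have hP := potential_eq (B := B) (C := C) hA
  have hP' : ∀ x, A * x ^ 2 + 4 * B * x + 2 * C =
      (√A) ^ 2 * (x + 2 * B / A) ^ 2 + 2 * (-2 * √A * (nu A B C + 1 / 4)) := fun x => by
    rw [hP x, zero_div, add_zero]
  have hexp := exists_comp_eq_exp hA B C
  unfold two at *
  generalize √A = a at *
  generalize 2 * B / A = c at *
  generalize nu A B C = ν at *
  obtain ⟨sm, hm0, ρ₀, σ₀, a₀, b₀, hρ₀, hi₀⟩ := intertwines_of_preservesSolutions hd hE hs.openI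
    hs.ordI hs.nonemptyI hs.subI hs.openJ hs.smooth_f hs.smooth_X hs.smooth_T hs.maps hs.f_ne
    hs.X_ne hs.preserves rfl
  have hinf := infinite_of_isOpen hs.openI hs.nonemptyI
  have hJn : J.Nonempty := ⟨0, hs.zero_mem⟩
  -- After a reflection, `X` is increasing in `x`.
  obtain ⟨r, hr, hrρ⟩ : ∃ r : ℝ, (r = 1 ∨ r = -1) ∧ ∀ t ∈ J, 0 < r * ρ₀ t := by
    have hp : ∀ t ∈ J, 0 < ρ₀ 0 * ρ₀ t := fun t ht => mul_pos_of_ne_zero hs.ordJ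
      (hi₀.smooth_profile hs.openI hs.nonemptyI hs.openJ hs.smooth_X).1.continuousOn hρ₀
      hs.zero_mem ht
    rcases (hρ₀ 0 hs.zero_mem).lt_or_gt with h0 | h0
    · exact ⟨-1, Or.inr rfl, fun t ht => by
        have := neg_of_mul_pos_right (hp t ht) h0.le
        linarith⟩
    · exact ⟨1, Or.inl rfl, fun t ht => by
        have := pos_of_mul_pos_right (hp t ht) h0.le
        linarith⟩
  have hr2 : r * r = 1 := by rcases hr with rfl | rfl <;> norm_num
  have hi := hi₀.reflect (c := c) hr fun x => by
    simp only [hP']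
    linear_combination a ^ 2 * (x + c) ^ 2 * hr2
  set ρ : ℝ → ℝ := fun t => r * ρ₀ t with hρdef
  set σ : ℝ → ℝ := fun t => r * (σ₀ t + c) - c with hσdef
  set Y : ℝ → ℝ → ℝ := fun x t => r * (X x t + c) - c with hY
  have hρ : ∀ t ∈ J, ρ t ≠ 0 := fun t ht => (hrρ t ht).ne'
  have sY : SmoothOn₂ (I ×ˢ J) Y :=
    (contDiffOn_const.mul (ContDiffOn.add hs.smooth_X contDiffOn_const)).sub contDiffOn_const
  have hi' := hi
  rw [hV] at hi'
  have hprof := (hi'.profile hs.openI hs.nonemptyI hs.openJ sY sm hρ hm0 (Or.inl rfl)).1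
  have hT : ∀ t ∈ J, HasDerivAt T (ρ t ^ 2) t := fun t ht => by
    obtain ⟨x₀, hx₀⟩ := hs.nonemptyI
    exact hi.T_t (show (x₀, t) ∈ I ×ˢ J from ⟨hx₀, ht⟩)
  obtain ⟨α, β, hαβ, hp⟩ := hprof.exists_eq_two1 ha hs.openJ hs.ordJ hs.zero_mem hT hs.T_zero
  -- `g₁` has the same slope `ρ` and the same `T`.
  set g₁ := F24.two1 a c ν α β with hg₁
  have h₁ : g₁.IsHeatSymmetry _ := F24.two1_isHeatSymmetry ha hP hαβ
  have hdom : I ×ˢ J ⊆ g₁.dom := fun p hq => ⟨(hp p.2 hq.2).1, (hp p.2 hq.2).2.1⟩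
  have hT₁ : ∀ t ∈ J, T t = g₁.T t := fun t ht => (hp t ht).2.2.2
  obtain ⟨ρ₁, σ₁, a₁, b₁, hi₁⟩ := h₁.intertwines
  replace hi₁ := hi₁.mono hdom
  have hρ₁ : ∀ t ∈ J, ρ₁ t = ρ t := fun t ht =>
    (hi₁.eq_of_X_eq hinf (r := ρ) (s := fun t => ρ t * c - c) (fun x hx t ht => by
      have e := (hp t ht).2.2.1
      rw [abs_of_pos (show 0 < ρ t from hrρ t ht)] at e
      rw [← e]
      simp only [hg₁, F24.two1]
      ring) ht).1
  rw [hV] at hi₁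
  have hprof₁ := (hi₁.profile hs.openI hs.nonemptyI hs.openJ (h₁.smooth_X.mono hdom)
    (h₁.smooth_m.mono hdom) (fun t ht => (hρ₁ t ht).symm ▸ hρ t ht)
    (fun x hx t ht => (h₁.m_pos x t (hdom ⟨hx, ht⟩)).ne') (Or.inl rfl)).1
  obtain ⟨k₁, k₂, hk⟩ := hprof.exists_sub_eq_exp hprof₁ ha.ne' hs.openJ hs.ordJ hJn hρ₁ hT
  -- A subsequent `two2` corrects the intercept `σ`.
  set g₂ := g₁.comp (F24.two2 a c (-k₁) (-k₂)) with hg₂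
  have h₂ : g₂.IsHeatSymmetry _ := h₁.comp (F24.two2_isHeatSymmetry hP' (-k₁) (-k₂))
  have hdom₂ : I ×ˢ J ⊆ g₂.dom := fun p hp => ⟨hdom hp, trivial⟩
  have hX₂ : ∀ x ∈ I, ∀ t ∈ J, Y x t = g₂.X x t := fun x hx t ht => by
    have e : g₂.X x t = g₁.X x t - -k₁ * Real.exp (a * g₁.T t)
      - -k₂ * Real.exp (-(a * g₁.T t)) := rfl
    have hp : (x, t) ∈ I ×ˢ J := ⟨hx, ht⟩
    rw [e, hi.X_eq hp, hi₁.X_eq hp, hk t ht, hρ₁ t ht, hT₁ t ht]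
    ring
  obtain ⟨ρ₂, σ₂, a₂, b₂, hi₂⟩ := h₂.intertwines
  obtain ⟨s, κ, hs1, hκ⟩ := hi.exists_eq_const_mul (hi₂.mono hdom₂) hs.openI hs.ordI hs.nonemptyI
    hs.openJ hs.ordJ hJn hρ hm0 (fun x hx t ht => h₂.m_pos x t (hdom₂ ⟨hx, ht⟩)) hX₂
  -- Now `m` is off by a constant only, whose absolute value is itself such a composition.
  obtain ⟨g₃, hc₃, hd₃, hg₃⟩ := hexp κ
  refine ⟨g₂.comp g₃, .comp _ _ (.comp _ _ (.of _ (Or.inl ⟨_, _, hαβ, rfl⟩))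
    (.of _ (Or.inr ⟨_, _, rfl⟩))) hc₃, r, s, hr, hs1, fun p hp => ⟨hdom₂ hp, hd₃ ▸ trivial⟩,
    fun x hx t ht => ⟨?_, ?_, ?_⟩⟩
  · have h1 : (g₂.comp g₃).X x t = Y x t := by rw [hX₂ x hx t ht]; exact (hg₃ _ _).1
    rw [h1, hY]
    linear_combination (-(X x t + c)) * hr2
  · rw [hT₁ t ht]
    exact (hg₃ 0 _).2.1.symm
  · have h1 := hκ x hx t ht
    have h2 := hd.theta_ne (hs.subI hx)
    have h3 := hd.theta_ne (hs.maps x hx t ht)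
    have h4 : (g₂.comp g₃).m x t = g₂.m x t * Real.exp κ :=
      congrArg (g₂.m x t * ·) (hg₃ _ _).2.2
    rw [h4]
    field_simp at h1 ⊢
    linear_combination h1

end F2

end FPK

open FPK in
theorem mainTheorem4 :
    -- Family 1
    (∀ (B C : ℝ) (E : Set ℝ) (μ θ : ℝ → ℝ), IsOpen E →
      IsDrift (fun x => 4 * B * x + 2 * C) E μ θ →
      IsSymmetryList μ θ E (F1.list B C) ∧
      (∀ g ∈ F1.two B C, g.IsSymmetry μ θ E ∧ g.T 0 = 0) ∧
      ∀ (I J : Set ℝ) (f X : ℝ → ℝ → ℝ) (T : ℝ → ℝ), IsLieSymmetryFixingZero μ E I J f X T →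
        ∃ g, Transf.IsComposition (F1.two B C) g ∧ ∃ s : ℝ, (s = 1 ∨ s = -1) ∧
          I ×ˢ J ⊆ g.dom ∧ ∀ x ∈ I, ∀ t ∈ J,
            X x t = g.X x t ∧ T t = g.T t ∧ f x t = s * g.mult θ x t) ∧
    -- Family 2
    (∀ (A B C : ℝ) (E : Set ℝ) (μ θ : ℝ → ℝ), 0 < A → IsOpen E →
      IsDrift (fun x => A * x ^ 2 + 4 * B * x + 2 * C) E μ θ →
      IsSymmetryList μ θ E (F2.list A B C) ∧
      (∀ g ∈ F2.two A B C, g.IsSymmetry μ θ E ∧ g.T 0 = 0) ∧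
      ∀ (I J : Set ℝ) (f X : ℝ → ℝ → ℝ) (T : ℝ → ℝ), IsLieSymmetryFixingZero μ E I J f X T →
        ∃ g, Transf.IsComposition (F2.two A B C) g ∧ ∃ r s : ℝ,
          (r = 1 ∨ r = -1) ∧ (s = 1 ∨ s = -1) ∧
          I ×ˢ J ⊆ g.dom ∧ ∀ x ∈ I, ∀ t ∈ J,
            X x t + 2 * B / A = r * (g.X x t + 2 * B / A) ∧ T t = g.T t ∧
            f x t = s * (θ x / θ (X x t) * g.m x t)) ∧
    -- Family 3
    (∀ (C D : ℝ) (E : Set ℝ) (μ θ : ℝ → ℝ), D ≠ 0 → IsOpen E → E ⊆ Set.Ioi 0 →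
      IsDrift (fun x => 2 * C + D / x ^ 2) E μ θ →
      IsSymmetryList μ θ E (F3.list C) ∧
      (∀ α β : ℝ, 0 < α →
        (F3.two1 C α β).IsSymmetry μ θ E ∧ (F3.two1 C α β).T 0 = 0) ∧
      ∀ (I J : Set ℝ) (f X : ℝ → ℝ → ℝ) (T : ℝ → ℝ), IsLieSymmetryFixingZero μ E I J f X T →
        ∃ α β k : ℝ, 0 < α ∧ k ≠ 0 ∧
          I ×ˢ J ⊆ (F3.two1 C α β).dom ∧ ∀ x ∈ I, ∀ t ∈ J,
            X x t = (F3.two1 C α β).X x t ∧ T t = (F3.two1 C α β).T t ∧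
            f x t = k * (F3.two1 C α β).mult θ x t) ∧
    -- Family 4
    (∀ (A C D : ℝ) (E : Set ℝ) (μ θ : ℝ → ℝ), 0 < A → D ≠ 0 → IsOpen E → E ⊆ Set.Ioi 0 →
      IsDrift (fun x => A * x ^ 2 + 2 * C + D / x ^ 2) E μ θ →
      IsSymmetryList μ θ E (F4.list A C) ∧
      (∀ α β : ℝ, 0 < α + β + 1 →
        (F24.two1 √A 0 (F4.nu A C) α β).IsSymmetry μ θ E ∧
        (F24.two1 √A 0 (F4.nu A C) α β).T 0 = 0) ∧
      ∀ (I J : Set ℝ) (f X : ℝ → ℝ → ℝ) (T : ℝ → ℝ), IsLieSymmetryFixingZero μ E I J f X T →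
        ∃ α β k : ℝ, 0 < α + β + 1 ∧ k ≠ 0 ∧
          I ×ˢ J ⊆ (F24.two1 √A 0 (F4.nu A C) α β).dom ∧ ∀ x ∈ I, ∀ t ∈ J,
            X x t = (F24.two1 √A 0 (F4.nu A C) α β).X x t ∧
            T t = (F24.two1 √A 0 (F4.nu A C) α β).T t ∧
            f x t = k * (F24.two1 √A 0 (F4.nu A C) α β).mult θ x t) := by
  refine ⟨fun B C E μ θ hE hd => ⟨F1.isSymmetryList hE hd, ?_, fun I J f X T hs =>
      F1.converse hE hd hs⟩,
    fun A B C E μ θ hA hE hd => ⟨F2.isSymmetryList hA hE hd, ?_, fun I J f X T hs =>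
      F2.converse hA hE hd hs⟩,
    fun C D E μ θ hD hE hE0 hd => ⟨F3.isSymmetryList hD hE hE0 hd, fun α β hα =>
      ⟨(F3.two1_isHeatSymmetry C D hα β).isSymmetry hd hE, by simp [F3.two1]⟩,
      fun I J f X T hs => F3.converse hD hE hE0 hd hs⟩,
    fun A C D E μ θ hA hD hE hE0 hd => ⟨F4.isSymmetryList hA hD hE hE0 hd, fun α β hαβ =>
      ⟨(F24.two1_isHeatSymmetry (Real.sqrt_pos.2 hA) (F4.potential_eq hA) hαβ).isSymmetry hd hE,
        F24.two1_T_zero hαβ⟩,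
      fun I J f X T hs => F4.converse hA hD hE hE0 hd hs⟩⟩
  · rintro g (⟨α, β, hα, rfl⟩ | ⟨α, β, rfl⟩)
    · exact ⟨(F1.two1_isHeatSymmetry B C hα β).isSymmetry hd hE, by simp [F1.two1]⟩
    · exact ⟨(F1.two2_isHeatSymmetry B C α β).isSymmetry hd hE, rfl⟩
  · rintro g (⟨α, β, hαβ, rfl⟩ | ⟨α, β, rfl⟩)
    · exact ⟨(F24.two1_isHeatSymmetry (Real.sqrt_pos.2 hA) (F2.potential_eq hA) hαβ).isSymmetry
        hd hE, F24.two1_T_zero hαβ⟩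
    · refine ⟨(F24.two2_isHeatSymmetry (a := √A) (c := 2 * B / A)
        (C := -2 * √A * (F2.nu A B C + 1 / 4)) (fun x => ?_) α β).isSymmetry hd hE, rfl⟩
      rw [F2.potential_eq hA, zero_div, add_zero]
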